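/- Let $A$ be a finite-dimensional semisimple $\mathbb{Q}$-algebra and let $e_1,\dots,e_m$ be its distinct irreducible central idempotents (nonzero central idempotents that are not the sum of two nonzero orthogonal central idempotents). Let $S$ be an infinite set of prime numbers, let $\mathbb{Z}_S\subseteq\mathbb{Q}$ be the localization of $\mathbb{Z}$ at the nonzero integers not divisible by any prime in $S$, and let $\mathfrak{O}$ be a maximal $\mathbb{Z}_S$-order in $A$. (Then $e_i\in\mathfrak{O}$ for all $i$.) Let $\underline{u}=(u_1,\dots,u_m)\in\mathbb{Q}^m$ with $u_i>0$ for all $i$, and for a finite $\mathfrak{O}$-module $G$ put $|G|^{\underline{u}}:=\prod_{i=1}^m|e_iG|^{u_i}$. Let $X=X(A,\underline{u},\mathfrak{O})$ be the random finite $\mathfrak{O}$-module such that for all finite $\mathfrak{O}$-modules $G_1,G_2$ $$\frac{\mathbb{P}(X\cong G_1)}{\mathbb{P}(X\cong G_2)}=\frac{|G_2|^{\underline{u}}\,|\mathrm{Aut}_{\mathfrak{O}}(G_2)|}{|G_1|^{\underline{u}}\,|\mathrm{Aut}_{\mathfrak{O}}(G_1)|}.$$ Such a random module exists, and $\mathbb{E}\big(|\mathrm{Sur}_{\mathfrak{O}}(X,G)|\big)=1/|G|^{\underline{u}}$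 for every finite $\mathfrak{O}$-module $G$, where $\mathrm{Sur}_{\mathfrak{O}}(X,G)$ is the set of surjective $\mathfrak{O}$-module homomorphisms $X\to G$. If $Y$ is a random variable taking values in finite $\mathfrak{O}$-modules such that $$\mathbb{E}\big(|\mathrm{Sur}_{\mathfrak{O}}(Y,G)|\big)=\frac{1}{|G|^{\underline{u}}}=\mathbb{E}\big(|\mathrm{Sur}_{\mathfrak{O}}(X,G)|\big)$$ for all finite $\mathfrak{O}$-modules $G$, then $$\mathbb{P}(Y\cong G)=\mathbb{P}(X\cong G)$$ for all finite $\mathfrak{O}$-modules $G$. -/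

import Mathlib

open MeasureTheory
open scoped ENNReal nonZeroDivisors

namespace CohenMartinet

universe u

/-- The nonzero integers that are not divisible by any prime in `S`. -/
def denominators (S : Set Nat.Primes) : Submonoid ℤ where
  carrier := {n | n ≠ 0 ∧ ∀ p ∈ S, ¬ (((p : ℕ) : ℤ) ∣ n)}
  one_mem' := by
    refine ⟨one_ne_zero, fun p _ h => ?_⟩
    exact (Nat.prime_iff_prime_int.mp p.2).not_isUnit (isUnit_of_dvd_one h)
  mul_mem' := by
    rintro a b ⟨ha, ha'⟩ ⟨hb, hb'⟩
    refine ⟨mul_ne_zero ha hb, fun p hp h => ?_⟩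
    rcases (Nat.prime_iff_prime_int.mp p.2).dvd_or_dvd h with h | h
    · exact ha' p hp h
    · exact hb' p hp h

theorem denominators_le (S : Set Nat.Primes) : denominators S ≤ ℤ⁰ :=
  fun _ hn => mem_nonZeroDivisors_of_ne_zero hn.1

/-- `ℤ_S`, the localization of `ℤ` at the nonzero integers prime to `S`, as a subring of `ℚ`. -/
noncomputable abbrev ZS (S : Set Nat.Primes) : Subalgebra ℤ ℚ :=
  Localization.subalgebra.ofField ℚ (denominators S) (denominators_le S)

section Orders

variable {A : Type u} [Ring A] [Algebra ℚ A]

/-- A `ℤ_S`-order of `A`: a subring containing `ℤ_S` which is a full `ℤ_S`-lattice of `A`, that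
is, finitely generated as a `ℤ_S`-module and spanning `A` over `ℚ`. -/
def IsOrderOver (S : Set Nat.Primes) (O : Subalgebra (ZS S) A) : Prop :=
  Submodule.IsLattice ℚ (Subalgebra.toSubmodule O)

/-- A maximal `ℤ_S`-order of `A`. -/
def IsMaximalOrder (S : Set Nat.Primes) (O : Subalgebra (ZS S) A) : Prop :=
  Maximal (IsOrderOver S) O

/-- `e` is a central idempotent of `A`. -/
def IsCentralIdempotent (e : A) : Prop :=
  IsIdempotentElem e ∧ e ∈ Set.center A

/-- `e` is an irreducible central idempotent: nonzero, and not the sum of two nonzero orthogonal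
central idempotents. -/
def IsIrreducibleCentralIdempotent (e : A) : Prop :=
  IsCentralIdempotent e ∧ e ≠ 0 ∧
    ∀ f g : A, IsCentralIdempotent f → IsCentralIdempotent g → f * g = 0 → e = f + g →
      f = 0 ∨ g = 0

/-- `e 0, …, e (m - 1)` is the list, without repetition, of all irreducible central idempotents
of `A`. -/
structure IsIdempotentList {m : ℕ} (e : Fin m → A) : Prop where
  injective : Function.Injective e
  mem_range_iff : ∀ x : A, x ∈ Set.range e ↔ IsIrreducibleCentralIdempotent x

/-- Every central idempotent lies in every maximal order. -/
theorem IsMaximalOrder.mem_of_isCentralIdempotent {S : Set Nat.Primes} {O : Subalgebra (ZS S) A}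
    (hO : IsMaximalOrder S O) {e : A} (he : IsCentralIdempotent e) : e ∈ O := by
  obtain ⟨hid, hc⟩ := he
  have hid' : e * e = e := hid
  have hcomm : ∀ x : A, e * x = x * e := fun x => (Set.mem_center_iff.mp hc).comm x
  have hee : ∀ x : A, e * (e * x) = e * x := fun x => by rw [← mul_assoc, hid']
  have hxe : ∀ x y : A, x * (e * y) = e * (x * y) := fun x y => by
    rw [← mul_assoc, ← hcomm, mul_assoc]
  -- the order `e O + (1 - e) O`
  let M : Submodule (ZS S) A :=
    (Subalgebra.toSubmodule O).map (LinearMap.mulLeft (ZS S) e) ⊔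
      (Subalgebra.toSubmodule O).map (LinearMap.mulLeft (ZS S) (1 - e))
  have hM : ∀ x : A, x ∈ M ↔ ∃ a ∈ O, ∃ b ∈ O, x = e * a + (1 - e) * b := by
    intro x
    simp only [M, Submodule.mem_sup, Submodule.mem_map, Subalgebra.mem_toSubmodule,
      LinearMap.mulLeft_apply]
    constructor
    · rintro ⟨_, ⟨a, ha, rfl⟩, _, ⟨b, hb, rfl⟩, rfl⟩
      exact ⟨a, ha, b, hb, rfl⟩
    · rintro ⟨a, ha, b, hb, rfl⟩
      exact ⟨_, ⟨a, ha, rfl⟩, _, ⟨b, hb, rfl⟩, rfl⟩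
  have hle : ∀ x ∈ O, x ∈ M := fun x hx => (hM x).2 ⟨x, hx, x, hx, by noncomm_ring⟩
  let O' : Subalgebra (ZS S) A := Submodule.toSubalgebra M (hle 1 O.one_mem) (by
    intro x y hx hy
    obtain ⟨a, ha, b, hb, rfl⟩ := (hM x).1 hx
    obtain ⟨c, hc, d, hd, rfl⟩ := (hM y).1 hy
    refine (hM _).2 ⟨a * c, O.mul_mem ha hc, b * d, O.mul_mem hb hd, ?_⟩
    simp only [sub_mul, mul_add, add_mul, mul_sub, one_mul, mul_assoc, hxe, hee]
    abel)
  have hOO' : O ≤ O' := hle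
  have hO' : IsOrderOver S O' := by
    have hl : Submodule.IsLattice ℚ (Subalgebra.toSubmodule O) := hO.prop
    have : Subalgebra.toSubmodule O' = M := Submodule.toSubalgebra_toSubmodule M _ _
    refine ⟨?_, ?_⟩
    · rw [this]
      exact (hl.fg.map _).sup (hl.fg.map _)
    · refine top_le_iff.mp (hl.span_eq_top.symm.le.trans (Submodule.span_mono ?_))
      exact hle
  have h : e ∈ O' := (hM e).2 ⟨1, O.one_mem, 0, O.zero_mem, by simp⟩
  exact hO.le_of_ge hO' hOO' h

end Orders

/-- A finite left module over `R`. -/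
structure FiniteModule (R : Type u) [Ring R] where
  /-- The underlying finite set. -/
  carrier : Type
  [addCommGroup : AddCommGroup carrier]
  [module : Module R carrier]
  [finite : Finite carrier]

namespace FiniteModule

instance (R : Type u) [Ring R] : CoeSort (FiniteModule R) Type := ⟨FiniteModule.carrier⟩

attribute [instance] FiniteModule.addCommGroup FiniteModule.module FiniteModule.finite

end FiniteModule

section Counting

variable {R : Type u} [Ring R]

/-- `G` and `H` are isomorphic `R`-modules. -/
def Iso (G H : FiniteModule R) : Prop := Nonempty (G ≃ₗ[R] H)

/-- `|Sur_R(G, H)|`. -/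
noncomputable def surCount (G H : FiniteModule R) : ℕ :=
  Nat.card {f : G →ₗ[R] H // Function.Surjective f}

/-- `|Aut_R(G)|`. -/
noncomputable def autCount (G : FiniteModule R) : ℕ := Nat.card (G ≃ₗ[R] G)

/-- The set `a G = {a • g | g ∈ G}`. -/
def component (a : R) (G : FiniteModule R) : Set G := Set.range fun g : G => a • g

end Counting

section Probability

variable {R : Type u} [Ring R] {Ω : Type*} [MeasurableSpace Ω]

/-- `X` is a random variable with values in finite `R`-modules: the events `X ≅ G` are
measurable. -/
def IsRandomModule (X : Ω → FiniteModule R) : Prop :=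
  ∀ G : FiniteModule R, MeasurableSet {ω | Iso (X ω) G}

/-- The probability that `X ≅ G`. -/
noncomputable def probIso (P : Measure Ω) (X : Ω → FiniteModule R) (G : FiniteModule R) : ℝ :=
  P.real {ω | Iso (X ω) G}

/-- The `G`-moment `𝔼 |Sur_R(X, G)|`. -/
noncomputable def surMoment (P : Measure Ω) (X : Ω → FiniteModule R) (G : FiniteModule R) : ℝ≥0∞ :=
  ∫⁻ ω, (surCount (X ω) G : ℝ≥0∞) ∂P

end Probability

section Distribution

variable {A : Type u} [Ring A] [Algebra ℚ A] {S : Set Nat.Primes} {O : Subalgebra (ZS S) A}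

/-- The irreducible central idempotent `e i`, as an element of the maximal order `O`. -/
def idem (hO : IsMaximalOrder S O) {m : ℕ} {e : Fin m → A} (he : IsIdempotentList e)
    (i : Fin m) : O :=
  ⟨e i, hO.mem_of_isCentralIdempotent ((he.mem_range_iff (e i)).1 ⟨i, rfl⟩).1⟩

/-- `|G|^u = ∏ i, |e i G| ^ (u i)`. -/
noncomputable def cardPow (hO : IsMaximalOrder S O) {m : ℕ} {e : Fin m → A}
    (he : IsIdempotentList e) (u : Fin m → ℚ) (G : FiniteModule O) : ℝ :=
  ∏ i, (Nat.card (component (idem hO he i) G) : ℝ) ^ (u i : ℝ)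

/-- `X`, on the probability space `(Ω, P)`, is a random module `X(A, u, O)`: the probabilities of
`G₁` and `G₂` are inversely proportional to `|G₁|^u |Aut G₁|` and `|G₂|^u |Aut G₂|`. The right
side is positive, so that the equation forces all `probIso P X G` to be nonzero. -/
def IsCohenMartinetModule (hO : IsMaximalOrder S O) {m : ℕ} {e : Fin m → A}
    (he : IsIdempotentList e) (u : Fin m → ℚ) {Ω : Type*} [MeasurableSpace Ω] (P : Measure Ω)
    (X : Ω → FiniteModule O) : Prop :=
  IsProbabilityMeasure P ∧ IsRandomModule X ∧
    ∀ G₁ G₂ : FiniteModule O,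
      probIso P X G₁ / probIso P X G₂ =
        (cardPow hO he u G₂ * autCount G₂) / (cardPow hO he u G₁ * autCount G₁)

end Distribution

end CohenMartinet

/-!
Over a maximal order every finite-index submodule of a finitely generated projective module admits
as many homomorphisms to a given finite module as the projective module itself. Hence, for finite
modules `K` and `G`, the number of extensions `K → E → G` divided by `|Aut E|`, summed over all `E`,
is `1`. Since `|E|^u = |K|^u |G|^u`, a random module with masses proportional to
`|E|^{-u} / |Aut E|` has moments `|G|^{-u}`, and the total mass is finite because adding the simple
modules one at a time enlarges it only by factors with convergent product.

For the converse, fix a finite set `T` of simple modules and count the surjections onto `G` whose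
kernel has no simple quotient in `T`. A Bonferroni sieve over `T` expresses the expected number of
these through the moments, and as `T` grows the count converges to the number of isomorphisms onto
`G`, so that the moments determine the probability of `G`.
-/

namespace CohenMartinet

universe u v

section SimpleModules

variable {R : Type*} [Ring R]

theorem exists_injective_quotient_annihilator (R M : Type*) [Ring R] [AddCommGroup M]
    [Module R M] :
    ∃ j : (R ⧸ Module.annihilator R M) →ₗ[R] (M → M), Function.Injective j := by
  let j : R →ₗ[R] (M → M) := LinearMap.pi fun x => LinearMap.toSpanSingleton R M x
  have hj : LinearMap.ker j = Module.annihilator R M := by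
    ext r
    rw [LinearMap.mem_ker, Module.mem_annihilator, funext_iff]
    rfl
  exact ⟨(Module.annihilator R M).liftQ j hj.ge,
    LinearMap.ker_eq_bot.1 (Submodule.ker_liftQ_eq_bot _ _ _ hj.le)⟩

variable {K K' : Type*} [AddCommGroup K] [Module R K] [AddCommGroup K'] [Module R K']

theorem isSemisimpleModule_quotient_annihilator [Finite K] [IsSimpleModule R K] :
    IsSemisimpleModule R (R ⧸ Module.annihilator R K) :=
  have ⟨_, hj⟩ := exists_injective_quotient_annihilator R K
  IsSemisimpleModule.of_injective _ hj

theorem nonempty_linearEquiv_of_annihilator_le [Finite K] [IsSimpleModule R K]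
    [IsSimpleModule R K'] (h : Module.annihilator R K ≤ Module.annihilator R K') :
    Nonempty (K ≃ₗ[R] K') := by
  classical
  have := IsSimpleModule.nontrivial R K'
  obtain ⟨y, hy⟩ := exists_ne (0 : K')
  obtain ⟨j, hj⟩ := exists_injective_quotient_annihilator R K
  let g : (R ⧸ Module.annihilator R K) →ₗ[R] K' :=
    (Module.annihilator R K).liftQ (LinearMap.toSpanSingleton R K' y)
      fun _ hr => Module.mem_annihilator.1 (h hr) y
  obtain ⟨F, hF⟩ := IsSemisimpleModule.extension_property j hj g
  have hF_ne : F ≠ 0 := by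
    rintro rfl
    exact hy ((one_smul R y).symm.trans (LinearMap.congr_fun hF (Submodule.Quotient.mk 1)).symm)
  obtain ⟨x, hx⟩ : ∃ x, F ∘ₗ LinearMap.single R (fun _ : K => K) x ≠ 0 := by
    by_contra! hzero
    exact hF_ne (LinearMap.pi_ext' (by simpa using hzero))
  exact ⟨LinearEquiv.ofBijective _ (LinearMap.bijective_of_ne_zero hx)⟩

theorem linearMap_eq_zero_of_isEmpty_linearEquiv [IsSimpleModule R K] [IsSimpleModule R K']
    (h : ¬ Nonempty (K ≃ₗ[R] K')) (f : K →ₗ[R] K') : f = 0 :=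
  f.bijective_or_eq_zero.resolve_left fun hf => h ⟨LinearEquiv.ofBijective f hf⟩

theorem exists_isSimpleModule_submodule_of_finite (M : Type*) [AddCommGroup M] [Module R M]
    [Finite M] [Nontrivial M] : ∃ m : Submodule R M, IsSimpleModule R m :=
  have ⟨m, hm⟩ := IsAtomic.exists_atom (Submodule R M)
  ⟨m, isSimpleModule_iff_isAtom.2 hm⟩

theorem exists_isSimpleModule_quotient_of_finite (M : Type*) [AddCommGroup M] [Module R M]
    [Finite M] [Nontrivial M] : ∃ m : Submodule R M, IsSimpleModule R (M ⧸ m) :=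
  have ⟨m, hm⟩ := IsCoatomic.exists_coatom (Submodule R M)
  ⟨m, isSimpleModule_iff_isCoatom.2 hm⟩

end SimpleModules

section FinitePrimitiveIdeals

variable {R : Type*} [Ring R]

/-- `P` is the annihilator of a finite simple left module. Such a module is written as `R ⧸ I`
with `I` a maximal left ideal, so that the definition does not quantify over a universe. -/
def IsFinitePrimitive (P : Ideal R) : Prop :=
  ∃ I : Ideal R, I.IsMaximal ∧ Finite (R ⧸ I) ∧ P = Module.annihilator R (R ⧸ I)

theorem isFinitePrimitive_annihilator (K : Type*) [AddCommGroup K] [Module R K] [Finite K]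
    [IsSimpleModule R K] : IsFinitePrimitive (Module.annihilator R K) := by
  obtain ⟨I, hI, ⟨e⟩⟩ := isSimpleModule_iff_quot_maximal.1 ‹IsSimpleModule R K›
  exact ⟨I, hI, Finite.of_equiv _ e.toEquiv, e.annihilator_eq⟩

namespace IsFinitePrimitive

variable {P : Ideal R}

theorem isTwoSided (hP : IsFinitePrimitive P) : P.IsTwoSided := by
  obtain ⟨I, -, -, rfl⟩ := hP
  infer_instance

theorem ne_top (hP : IsFinitePrimitive P) : P ≠ ⊤ := by
  obtain ⟨I, hI, -, rfl⟩ := hP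
  intro h
  have hone := Module.mem_annihilator.1 ((Ideal.eq_top_iff_one _).1 h) (Submodule.Quotient.mk 1)
  rw [one_smul, Submodule.Quotient.mk_eq_zero] at hone
  exact (Ideal.ne_top_iff_one I).1 hI.ne_top hone

theorem exists_natCast_mem (hP : IsFinitePrimitive P) : ∃ n : ℕ, n ≠ 0 ∧ (n : R) ∈ P := by
  obtain ⟨I, -, _, rfl⟩ := hP
  refine ⟨Nat.card (R ⧸ I), Nat.card_pos.ne', Module.mem_annihilator.2 fun m => ?_⟩
  rw [Nat.cast_smul_eq_nsmul, card_nsmul_eq_zero']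

theorem eq_of_le (hP : IsFinitePrimitive P) {J : Ideal R} [J.IsTwoSided] (h : P ≤ J)
    (hJ : J ≠ ⊤) : J = P := by
  obtain ⟨I, hI, _, rfl⟩ := hP
  obtain ⟨I', hI', hJI'⟩ := Ideal.exists_le_maximal J hJ
  have : IsSimpleModule R (R ⧸ I) := isSimpleModule_iff_isCoatom.2 hI.out
  have : IsSimpleModule R (R ⧸ I') := isSimpleModule_iff_isCoatom.2 hI'.out
  have hJ' : J ≤ Module.annihilator R (R ⧸ I') := by
    intro a ha
    refine Module.mem_annihilator.2 fun m => ?_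
    obtain ⟨r, rfl⟩ := Submodule.Quotient.mk_surjective _ m
    rw [← Submodule.Quotient.mk_smul, Submodule.Quotient.mk_eq_zero]
    exact hJI' (J.mul_mem_right _ ha)
  obtain ⟨e⟩ := nonempty_linearEquiv_of_annihilator_le (h.trans hJ')
  exact le_antisymm (hJ'.trans e.annihilator_eq.ge) h

theorem mem_or_mem (hP : IsFinitePrimitive P) {a b : R} (h : ∀ r, a * r * b ∈ P) :
    a ∈ P ∨ b ∈ P := by
  obtain ⟨I, hI, _, rfl⟩ := hP
  have : IsSimpleModule R (R ⧸ I) := isSimpleModule_iff_isCoatom.2 hI.out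
  by_contra! hab
  simp only [Module.mem_annihilator, not_forall] at hab h
  obtain ⟨⟨y, hy⟩, ⟨x, hx⟩⟩ := hab
  obtain ⟨r, rfl⟩ := IsSimpleModule.toSpanSingleton_surjective R hx y
  rw [LinearMap.toSpanSingleton_apply, smul_smul, smul_smul] at hy
  exact hy (h r x)

theorem le_or_le (hP : IsFinitePrimitive P) {I J : Ideal R} (h : I * J ≤ P) : I ≤ P ∨ J ≤ P := by
  by_contra! hIJ
  obtain ⟨a, ha, haP⟩ := Set.not_subset.1 hIJ.1
  obtain ⟨b, hb, hbP⟩ := Set.not_subset.1 hIJ.2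
  have hmem : ∀ r, a * r * b ∈ P := fun r => by
    rw [mul_assoc]
    exact h (Ideal.mul_mem_mul ha (J.mul_mem_left r hb))
  exact (hP.mem_or_mem hmem).elim haP hbP

end IsFinitePrimitive

/-- The product of a list of left ideals. The left ideals of a noncommutative ring do not form a
monoid, since `I * ⊤ = I` can fail, and so `List.prod` is not available. -/
def idealProd (l : List (Ideal R)) : Ideal R := l.foldr (· * ·) ⊤

theorem idealProd_cons (P : Ideal R) (l : List (Ideal R)) :
    idealProd (P :: l) = P * idealProd l := rfl

theorem idealProd_append (l l' : List (Ideal R)) :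
    idealProd (l ++ l') = idealProd l * idealProd l' := by
  induction l with
  | nil => exact (Submodule.top_smul (idealProd l')).symm
  | cons P l ih => rw [List.cons_append, idealProd_cons, idealProd_cons, ih, mul_assoc]

theorem isTwoSided_idealProd {l : List (Ideal R)} (hl : ∀ P ∈ l, IsFinitePrimitive P) :
    (idealProd l).IsTwoSided := by
  induction l with
  | nil => exact inferInstanceAs (⊤ : Ideal R).IsTwoSided
  | cons P l ih =>
    have := ih fun Q hQ => hl Q (List.mem_cons_of_mem P hQ)
    exact inferInstanceAs (P * idealProd l).IsTwoSided

theorem exists_natCast_mem_idealProd {l : List (Ideal R)} (hl : ∀ P ∈ l, IsFinitePrimitive P) :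
    ∃ n : ℕ, n ≠ 0 ∧ (n : R) ∈ idealProd l := by
  induction l with
  | nil => exact ⟨1, one_ne_zero, Submodule.mem_top⟩
  | cons P l ih =>
    simp only [List.mem_cons, forall_eq_or_imp] at hl
    obtain ⟨k, hk, hkP⟩ := hl.1.exists_natCast_mem
    obtain ⟨n, hn, hnl⟩ := ih hl.2
    refine ⟨k * n, mul_ne_zero hk hn, ?_⟩
    rw [Nat.cast_mul]
    exact Ideal.mul_mem_mul hkP hnl

theorem IsFinitePrimitive.mem_of_idealProd_le {P : Ideal R} (hP : IsFinitePrimitive P)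
    {l : List (Ideal R)} (hl : ∀ Q ∈ l, IsFinitePrimitive Q) (h : idealProd l ≤ P) : P ∈ l := by
  induction l with
  | nil => exact absurd (top_le_iff.1 h) hP.ne_top
  | cons Q l ih =>
    simp only [List.mem_cons, forall_eq_or_imp] at hl ⊢
    have := hP.isTwoSided
    exact (hP.le_or_le h).imp (fun hQP => hl.1.eq_of_le hQP hP.ne_top) (ih hl.2)

theorem exists_idealProd_le_of_finite_quotient (X : Ideal R) [Finite (R ⧸ X)] :
    ∃ l : List (Ideal R), (∀ P ∈ l, IsFinitePrimitive P) ∧ idealProd l ≤ X := by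
  induction hn : Nat.card (R ⧸ X) using Nat.strong_induction_on generalizing X with
  | _ n ih =>
  by_cases hX : X = ⊤
  · exact ⟨[], by simp, hX ▸ le_top⟩
  have : Nontrivial (R ⧸ X) := Submodule.Quotient.nontrivial_iff.2 hX
  obtain ⟨m, hm⟩ := exists_isSimpleModule_submodule_of_finite (R := R) (R ⧸ X)
  have := IsSimpleModule.nontrivial R m
  let X' : Ideal R := m.comap X.mkQ
  have hmX' : m = Submodule.map X.mkQ X' :=
    (Submodule.map_comap_eq_of_surjective (Submodule.mkQ_surjective X) m).symm
  have e : ((R ⧸ X) ⧸ m) ≃ₗ[R] (R ⧸ X') :=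
    (Submodule.quotEquivOfEq _ _ hmX').trans (Submodule.quotientQuotientEquivQuotient X X'
      ((Submodule.ker_mkQ X).symm.le.trans (LinearMap.ker_le_comap _)))
  have : Finite ((R ⧸ X) ⧸ m) := Finite.of_surjective _ (Submodule.mkQ_surjective m)
  have : Finite (R ⧸ X') := Finite.of_equiv _ e.toEquiv
  have hcard : Nat.card (R ⧸ X') < n := by
    rw [← hn, Submodule.card_eq_card_quotient_mul_card m, Nat.card_congr e.toEquiv]
    exact lt_mul_of_one_lt_left (Nat.card_pos (α := R ⧸ X')) (Finite.one_lt_card (α := m))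
  obtain ⟨l, hl, hlX'⟩ := ih _ hcard X' rfl
  refine ⟨Module.annihilator R m :: l, ?_, Ideal.mul_le.2 fun p hp x hx => ?_⟩
  · simpa only [List.mem_cons, forall_eq_or_imp] using ⟨isFinitePrimitive_annihilator m, hl⟩
  · rw [← Submodule.Quotient.mk_eq_zero X]
    exact congrArg Subtype.val (Module.mem_annihilator.1 hp ⟨_, hlX' hx⟩)

end FinitePrimitiveIdeals

section ArithmeticRings

/-- A ring whose additive group is torsion-free and whose quotients `R ⧸ n R` have at most
polynomially many elements, as is the case for an order. -/
structure IsArithmeticRing (R : Type*) [Ring R] : Prop where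
  natCast_mul_eq_zero : ∀ n : ℕ, n ≠ 0 → ∀ x : R, (n : R) * x = 0 → x = 0
  exists_card_quotient_le : ∃ g : ℕ, ∀ n : ℕ, n ≠ 0 →
    Finite (R ⧸ Ideal.span {(n : R)}) ∧ Nat.card (R ⧸ Ideal.span {(n : R)}) ≤ n ^ g

/-- The maximality of an order, expressed without its ambient algebra: a fraction `k⁻¹ x` which
carries a two-sided ideal of finite index into itself belongs to the order. -/
structure IsIntegrallyClosedOrder (R : Type*) [Ring R] : Prop extends IsArithmeticRing R where
  dvd_of_mul_left_mem : ∀ (I : Ideal R) [I.IsTwoSided] (n k : ℕ), n ≠ 0 → (n : R) ∈ I → k ≠ 0 →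
    ∀ x : R, (∀ y ∈ I, ∃ z ∈ I, x * y = k * z) → (k : R) ∣ x
  dvd_of_mul_right_mem : ∀ (I : Ideal R) [I.IsTwoSided] (n k : ℕ), n ≠ 0 → (n : R) ∈ I → k ≠ 0 →
    ∀ x : R, (∀ y ∈ I, ∃ z ∈ I, y * x = k * z) → (k : R) ∣ x

/-- The properties of a maximal order on which the counting of its finite modules rests. -/
structure IsDedekindLike (R : Type*) [Ring R] : Prop extends IsArithmeticRing R where
  projective : ∀ P : Ideal R, IsFinitePrimitive P → Module.Projective R P
  inf_le_mul : ∀ P Q : Ideal R, IsFinitePrimitive P → IsFinitePrimitive Q → P ≠ Q →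
    P ⊓ Q ≤ P * Q

variable {R : Type*} [Ring R]

theorem IsArithmeticRing.natCast_mul_cancel (hR : IsArithmeticRing R) {n : ℕ} (hn : n ≠ 0)
    {x y : R} (h : (n : R) * x = n * y) : x = y :=
  sub_eq_zero.1 (hR.natCast_mul_eq_zero n hn _ (by rw [mul_sub, h, sub_self]))

theorem IsArithmeticRing.finite_quotient (hR : IsArithmeticRing R) {n : ℕ} (hn : n ≠ 0)
    {I : Ideal R} (hnI : (n : R) ∈ I) : Finite (R ⧸ I) := by
  obtain ⟨g, hg⟩ := hR.exists_card_quotient_le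
  have := (hg n hn).1
  exact Finite.of_surjective _
    (Submodule.factor_surjective ((Ideal.span_singleton_le_iff_mem I).2 hnI))

theorem natCast_dvd_iff_mem_span {k : ℕ} {x : R} : (k : R) ∣ x ↔ x ∈ Ideal.span {(k : R)} := by
  simp only [Ideal.mem_span_singleton', Dvd.dvd, Nat.cast_comm, eq_comm]

theorem exists_eq_natCast_mul_of_mem_mul {I J : Ideal R} [I.IsTwoSided] {k : ℕ}
    (hJ : J ≤ Ideal.span {(k : R)}) {x : R} (hx : x ∈ I * J) : ∃ z ∈ I, x = k * z := by
  induction hx using Submodule.smul_induction_on' with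
  | smul a ha b hb =>
    obtain ⟨c, rfl⟩ := natCast_dvd_iff_mem_span.2 (hJ hb)
    exact ⟨a * c, I.mul_mem_right c ha, by
      rw [smul_eq_mul, ← mul_assoc, ← mul_assoc, Nat.cast_comm]⟩
  | add x _ y _ hx hy =>
    obtain ⟨⟨z, hz, rfl⟩, ⟨w, hw, rfl⟩⟩ := hx, hy
    exact ⟨z + w, I.add_mem hz hw, (mul_add _ _ _).symm⟩

end ArithmeticRings

section ScaledInverse

variable {R : Type*} [Ring R]

theorem IsFinitePrimitive.natCast_mem_or_forall_mem {P : Ideal R} (hP : IsFinitePrimitive P) {k : ℕ}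
    {N : Ideal R} [N.IsTwoSided] (hN : N ≤ Ideal.span {(k : R)})
    (hPN : ∀ x ∈ P, (k : R) * x ∈ N) :
    (k : R) ∈ N ∨ ∀ x ∈ N, ∃ z ∈ P, x = k * z := by
  let J : Ideal R := Submodule.comap (LinearMap.toSpanSingleton R R (k : R)) N
  have hJ : ∀ {z}, z ∈ J ↔ (k : R) * z ∈ N := fun {z} => by
    rw [Nat.cast_comm]
    rfl
  have : J.IsTwoSided := ⟨fun b ha => by
    rw [hJ] at ha ⊢
    rw [← mul_assoc]
    exact N.mul_mem_right b ha⟩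
  refine or_iff_not_imp_left.2 fun hkN x hx => ?_
  have hJP : J = P := hP.eq_of_le (fun x hx => hJ.2 (hPN x hx)) fun hJtop =>
    hkN (mul_one (k : R) ▸ hJ.1 (hJtop ▸ Submodule.mem_top))
  obtain ⟨z, rfl⟩ := natCast_dvd_iff_mem_span.2 (hN hx)
  exact ⟨z, hJP ▸ hJ.2 hx, rfl⟩

/-- `k P⁻¹`, where `P⁻¹ = {x | P x ⊆ R}` is the inverse of the ideal `P` in the total fraction
ring of `R`. The factor `k ∈ P` clears denominators, so that everything takes place in `R`. -/
def scaledInverse (k : ℕ) (P : Ideal R) [P.IsTwoSided] : Ideal R where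
  carrier := {x | ∀ y ∈ P, (k : R) ∣ y * x}
  zero_mem' y _ := by rw [mul_zero]; exact dvd_zero _
  add_mem' ha hb y hy := by rw [mul_add]; exact dvd_add (ha y hy) (hb y hy)
  smul_mem' r x hx y hy := by
    rw [smul_eq_mul, ← mul_assoc]
    exact hx _ (P.mul_mem_right r hy)

variable {k : ℕ} {P : Ideal R} [P.IsTwoSided]

instance : (scaledInverse k P).IsTwoSided :=
  ⟨fun b ha y hy => by rw [← mul_assoc]; exact (ha y hy).mul_right b⟩

theorem natCast_mem_scaledInverse : (k : R) ∈ scaledInverse k P :=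
  fun y _ => ⟨y, (Nat.cast_comm k y).symm⟩

theorem natCast_dvd_mul_of_mem_scaledInverse (hR : IsIntegrallyClosedOrder R) (hk : k ≠ 0)
    (hkP : (k : R) ∈ P) {x y : R} (hx : x ∈ scaledInverse k P) (hy : y ∈ P) : (k : R) ∣ x * y := by
  refine hR.dvd_of_mul_right_mem P k k hk hkP hk _ fun z hz => ?_
  obtain ⟨w, hw⟩ := hx z hz
  exact ⟨w * y, P.mul_mem_left w hy, by rw [← mul_assoc, hw, mul_assoc]⟩

theorem not_idealProd_le_span (hR : IsIntegrallyClosedOrder R) (hk : k ≠ 0)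
    (hkP : (k : R) ∈ P) (hP : IsFinitePrimitive P) (h : ∀ x ∈ scaledInverse k P, (k : R) ∣ x)
    (l : List (Ideal R)) (hl : ∀ Q ∈ l, IsFinitePrimitive Q) :
    ¬ idealProd l ≤ Ideal.span {(k : R)} := by
  induction hn : l.length using Nat.strong_induction_on generalizing l with
  | _ n ih =>
  intro hle
  have hkP' := (Ideal.span_singleton_le_iff_mem P).2 hkP
  obtain ⟨l₁, l₂, rfl⟩ := List.append_of_mem (hP.mem_of_idealProd_le hl (hle.trans hkP'))
  simp only [List.mem_append, List.mem_cons, or_imp, forall_and, forall_eq] at hl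
  obtain ⟨hl₁, -, hl₂⟩ := hl
  rw [idealProd_append, idealProd_cons] at hle
  have := isTwoSided_idealProd hl₂
  have hPl₂ : ∀ Q ∈ P :: l₂, IsFinitePrimitive Q := by
    simpa only [List.mem_cons, forall_eq_or_imp] using ⟨hP, hl₂⟩
  obtain ⟨m, hm, hmPl₂⟩ := exists_natCast_mem_idealProd hPl₂
  rw [idealProd_cons] at hmPl₂
  -- `B D ⊆ k R` gives `(D B) D ⊆ k D`, hence `D B ⊆ k R`: a cyclic rotation of the product.
  have hrotate : P * idealProd l₂ * idealProd l₁ ≤ Ideal.span {(k : R)} := fun x hx =>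
    natCast_dvd_iff_mem_span.1 <| hR.dvd_of_mul_left_mem _ m k hm hmPl₂ hk x fun y hy =>
      exists_eq_natCast_mul_of_mem_mul hle (by
        rw [← mul_assoc]
        exact Ideal.mul_mem_mul hx hy)
  refine ih (l₂ ++ l₁).length ?_ (l₂ ++ l₁) ?_ rfl fun x hx =>
    natCast_dvd_iff_mem_span.1 (h x fun y hy => natCast_dvd_iff_mem_span.2 (hrotate ?_))
  · simp only [← hn, List.length_append, List.length_cons]
    omega
  · exact fun Q hQ => (List.mem_append.1 hQ).elim (hl₂ Q) (hl₁ Q)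
  · rw [mul_assoc, ← idealProd_append]
    exact Ideal.mul_mem_mul hy hx

theorem exists_mem_scaledInverse_not_dvd (hR : IsIntegrallyClosedOrder R) (hk : k ≠ 0)
    (hkP : (k : R) ∈ P) (hP : IsFinitePrimitive P) :
    ∃ x ∈ scaledInverse k P, ¬ (k : R) ∣ x := by
  by_contra! h
  have := hR.finite_quotient hk (Ideal.mem_span_singleton_self (k : R))
  obtain ⟨l, hl, hle⟩ := exists_idealProd_le_of_finite_quotient (Ideal.span {(k : R)})
  exact not_idealProd_le_span hR hk hkP hP h l hl hle

theorem natCast_mem_scaledInverse_mul (hR : IsIntegrallyClosedOrder R) (hk : k ≠ 0)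
    (hkP : (k : R) ∈ P) (hP : IsFinitePrimitive P) : (k : R) ∈ scaledInverse k P * P := by
  obtain ⟨x, hx, hkx⟩ := exists_mem_scaledInverse_not_dvd hR hk hkP hP
  refine (hP.natCast_mem_or_forall_mem (Ideal.mul_le.2 fun x hx y hy => ?_) fun y hy =>
    Ideal.mul_mem_mul natCast_mem_scaledInverse hy).resolve_right fun hle => hkx ?_
  · exact natCast_dvd_iff_mem_span.1 (natCast_dvd_mul_of_mem_scaledInverse hR hk hkP hx hy)
  · exact hR.dvd_of_mul_left_mem P k k hk hkP hk x fun y hy => hle _ (Ideal.mul_mem_mul hx hy)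

theorem natCast_mem_mul_scaledInverse (hR : IsIntegrallyClosedOrder R) (hk : k ≠ 0)
    (hkP : (k : R) ∈ P) (hP : IsFinitePrimitive P) : (k : R) ∈ P * scaledInverse k P := by
  obtain ⟨x, hx, hkx⟩ := exists_mem_scaledInverse_not_dvd hR hk hkP hP
  refine (hP.natCast_mem_or_forall_mem (Ideal.mul_le.2 fun y hy x hx => ?_) fun y hy => ?_)
    |>.resolve_right fun hle => hkx ?_
  · exact natCast_dvd_iff_mem_span.1 (hx y hy)
  · rw [Nat.cast_comm]
    exact Ideal.mul_mem_mul hy natCast_mem_scaledInverse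
  · exact hR.dvd_of_mul_right_mem P k k hk hkP hk x fun y hy => hle _ (Ideal.mul_mem_mul hy hx)

theorem exists_linearMap_natCast_mul_eq (hR : IsIntegrallyClosedOrder R) (hk : k ≠ 0)
    {x : R} (hx : x ∈ scaledInverse k P) :
    ∃ f : P →ₗ[R] R, ∀ y : P, (k : R) * f y = y * x := by
  choose f hf using fun y : P => hx y y.2
  refine ⟨⟨⟨f, fun y z => hR.natCast_mul_cancel hk ?_⟩, fun r y => hR.natCast_mul_cancel hk ?_⟩,
    fun y => (hf y).symm⟩
  · rw [← hf, mul_add, ← hf, ← hf, Submodule.coe_add, add_mul]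
  · change (k : R) * f (r • y) = k * (r * f y)
    rw [← hf, ← mul_assoc, Nat.cast_comm, mul_assoc, ← hf, Submodule.coe_smul, smul_eq_mul,
      mul_assoc]

theorem projective_of_natCast_mem_scaledInverse_mul (hR : IsIntegrallyClosedOrder R) (hk : k ≠ 0)
    (h : (k : R) ∈ scaledInverse k P * P) : Module.Projective R P := by
  have hsplit : ∀ t ∈ scaledInverse k P * P, ∃ s : P →ₗ[R] (P →₀ R), ∀ y : P,
      (k : R) * Finsupp.linearCombination R id (s y) = y * t := fun t ht => by
    induction ht using Submodule.smul_induction_on' with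
    | smul x hx p hp =>
      obtain ⟨f, hf⟩ := exists_linearMap_natCast_mul_eq hR hk hx
      refine ⟨Finsupp.lsingle ⟨p, hp⟩ ∘ₗ f, fun y => ?_⟩
      simp [← mul_assoc, hf]
    | add t _ t' _ ih ih' =>
      obtain ⟨⟨s, hs⟩, ⟨s', hs'⟩⟩ := ih, ih'
      refine ⟨s + s', fun y => ?_⟩
      rw [LinearMap.add_apply, map_add, Submodule.coe_add, mul_add, hs, hs', mul_add]
  obtain ⟨s, hs⟩ := hsplit k h
  refine Module.projective_def.2 ⟨s, fun y => Subtype.ext (hR.natCast_mul_cancel hk ?_)⟩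
  rw [hs, Nat.cast_comm]

theorem inf_le_mul_of_natCast_mem_mul_scaledInverse (hR : IsIntegrallyClosedOrder R) (hk : k ≠ 0)
    (hkP : (k : R) ∈ P) (hP : IsFinitePrimitive P) (h : (k : R) ∈ P * scaledInverse k P)
    {Q : Ideal R} (hQ : IsFinitePrimitive Q) (hPQ : P ≠ Q) : P ⊓ Q ≤ P * Q := by
  rintro x ⟨hxP, hxQ⟩
  have := hQ.isTwoSided
  obtain ⟨q, hqP, hqQ⟩ : ∃ q ∈ P, q ∉ Q := by
    by_contra! hle
    exact hPQ (hP.eq_of_le hle hQ.ne_top).symm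
  have hinv : ∀ y ∈ scaledInverse k P, ∃ z ∈ Q, y * x = k * z := fun y hy => by
    obtain ⟨z, hz⟩ := natCast_dvd_mul_of_mem_scaledInverse hR hk hkP hy hxP
    refine ⟨z, (hQ.mem_or_mem (a := q) fun r => ?_).resolve_left hqQ, hz⟩
    obtain ⟨w, hw⟩ := hy (q * r) (P.mul_mem_right r hqP)
    have hwx : q * r * z = w * x := hR.natCast_mul_cancel hk <| by
      rw [← mul_assoc, Nat.cast_comm, mul_assoc, ← hz, ← mul_assoc, hw, mul_assoc]
    exact hwx ▸ Q.mul_mem_left w hxQ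
  have hmul : ∀ t ∈ P * scaledInverse k P, ∃ z ∈ P * Q, t * x = k * z := fun t ht => by
    induction ht using Submodule.smul_induction_on' with
    | smul p hp y hy =>
      obtain ⟨z, hz, hyx⟩ := hinv y hy
      refine ⟨p * z, Ideal.mul_mem_mul hp hz, ?_⟩
      rw [smul_eq_mul, mul_assoc, hyx, ← mul_assoc, ← Nat.cast_comm, mul_assoc]
    | add t _ t' _ ih ih' =>
      obtain ⟨⟨z, hz, htz⟩, ⟨z', hz', htz'⟩⟩ := ih, ih'
      exact ⟨z + z', add_mem hz hz', by rw [add_mul, htz, htz', mul_add]⟩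
  obtain ⟨z, hz, hkz⟩ := hmul k h
  exact hR.natCast_mul_cancel hk hkz ▸ hz

end ScaledInverse

theorem IsIntegrallyClosedOrder.isDedekindLike {R : Type*} [Ring R]
    (hR : IsIntegrallyClosedOrder R) : IsDedekindLike R where
  toIsArithmeticRing := hR.toIsArithmeticRing
  projective P hP := by
    have := hP.isTwoSided
    obtain ⟨k, hk, hkP⟩ := hP.exists_natCast_mem
    exact projective_of_natCast_mem_scaledInverse_mul hR hk
      (natCast_mem_scaledInverse_mul hR hk hkP hP)
  inf_le_mul P Q hP hQ hPQ := by
    have := hP.isTwoSided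
    obtain ⟨k, hk, hkP⟩ := hP.exists_natCast_mem
    exact inf_le_mul_of_natCast_mem_mul_scaledInverse hR hk hkP hP
      (natCast_mem_mul_scaledInverse hR hk hkP hP) hQ hPQ

section MaximalOrders

instance (S : Set Nat.Primes) : IsNoetherianRing (ZS S) :=
  IsLocalization.isNoetherianRing (denominators S) (ZS S) inferInstance

theorem exists_residue (S : Set Nat.Primes) {n : ℕ} (hn : n ≠ 0) (z : ZS S) :
    ∃ (i : Fin n) (z' : ZS S), z = (i : ℕ) + n * z' := by
  let q := Ideal.Quotient.mk (Ideal.span {(n : ZS S)})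
  let T : Set (ZS S ⧸ Ideal.span {(n : ZS S)}) := Set.range fun i : Fin n => q (i : ℕ)
  have hT : ∀ t : ℤ, q t ∈ T := fun t => by
    have hn' : (n : ℤ) ≠ 0 := Nat.cast_ne_zero.2 hn
    have hmod : ((t % n).toNat : ℤ) = t % n := Int.toNat_of_nonneg (Int.emod_nonneg t hn')
    refine ⟨⟨(t % n).toNat, ?_⟩, Ideal.Quotient.eq.2 (Ideal.mem_span_singleton'.2
      ⟨-((t / n : ℤ) : ZS S), ?_⟩)⟩
    · exact_mod_cast hmod.trans_lt (Int.emod_lt_of_pos t (by positivity))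
    · have hdiv := congrArg (Int.cast : ℤ → ZS S) (hmod ▸ Int.emod_add_mul_ediv t n)
      push_cast at hdiv
      linear_combination -hdiv
  obtain ⟨⟨a, b⟩, hab⟩ := IsLocalization.surj (denominators S) z
  simp only [algebraMap_int_eq, eq_intCast] at hab
  have hb : IsUnit (q ((b : ℤ) : ZS S)) := (IsLocalization.map_units (ZS S) b).map q
  -- The unit `b` permutes the finite set `T`, which contains `a = b z`.
  let mulB : T → T := fun t => ⟨q ((b : ℤ) : ZS S) * t, by
    obtain ⟨_, i, rfl⟩ := t
    simpa using hT (b * (i : ℕ))⟩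
  have hmulB : Function.Surjective mulB := Finite.surjective_of_injective fun t t' htt' =>
    Subtype.ext (hb.mul_left_cancel (congrArg Subtype.val htt'))
  obtain ⟨t, ht⟩ := hmulB ⟨q a, hT a⟩
  have hz : q z ∈ T := by
    have hzt : q z = t := hb.mul_left_cancel (by
      rw [← map_mul, mul_comm, hab]
      exact (congrArg Subtype.val ht).symm)
    exact hzt ▸ t.2
  obtain ⟨i, hi⟩ := hz
  obtain ⟨z', hz'⟩ := Ideal.mem_span_singleton.1 (Ideal.Quotient.eq.1 hi.symm)
  exact ⟨i, z', by linear_combination hz'⟩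

variable {A : Type u} [Ring A] [Algebra ℚ A] {S : Set Nat.Primes} {O : Subalgebra (ZS S) A}

theorem IsOrderOver.exists_card_quotient_le (hO : IsOrderOver S O) :
    ∃ g : ℕ, ∀ n : ℕ, n ≠ 0 → Finite (O ⧸ Ideal.span {(n : O)}) ∧
      Nat.card (O ⧸ Ideal.span {(n : O)}) ≤ n ^ g := by
  have : Module.Finite (ZS S) O := Module.Finite.iff_fg.2 hO.fg
  obtain ⟨g, f, hf⟩ := Module.Finite.exists_fin' (ZS S) O
  refine ⟨g, fun n hn => ?_⟩
  let q : (Fin g → Fin n) → O ⧸ Ideal.span {(n : O)} :=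
    fun c => Submodule.Quotient.mk (f fun j => ((c j : ℕ) : ZS S))
  have hq : Function.Surjective q := by
    intro x
    obtain ⟨x, rfl⟩ := Submodule.Quotient.mk_surjective _ x
    obtain ⟨z, rfl⟩ := hf x
    choose c z' hz using fun j => exists_residue S hn (z j)
    have hcz : (fun j => ((c j : ℕ) : ZS S)) - z = (n : ZS S) • (-z') := by
      ext j
      simp [hz j]
    refine ⟨c, (Submodule.Quotient.eq _).2 ?_⟩
    rw [← map_sub, hcz, map_smul, Algebra.smul_def, map_natCast, ← natCast_dvd_iff_mem_span]
    exact dvd_mul_right _ _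
  have := Finite.of_surjective q hq
  exact ⟨this, (Nat.card_le_card_of_surjective q hq).trans (by simp)⟩

theorem inv_natCast_smul_eq_iff {n : ℕ} (hn : n ≠ 0) {x y : A} :
    (n : ℚ)⁻¹ • x = y ↔ x = n * y := by
  rw [inv_smul_eq_iff₀ (Nat.cast_ne_zero.2 hn), Nat.cast_smul_eq_nsmul, nsmul_eq_mul]

theorem isArithmeticRing_of_isOrderOver (hO : IsOrderOver S O) : IsArithmeticRing O where
  natCast_mul_eq_zero n hn x hx := by
    have hnx : (n : ℚ) • (x : A) = 0 := by
      rw [Nat.cast_smul_eq_nsmul, nsmul_eq_mul]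
      simpa using congrArg Subtype.val hx
    exact Subtype.ext ((smul_eq_zero_iff_right (Nat.cast_ne_zero.2 hn)).1 hnx)
  exists_card_quotient_le := hO.exists_card_quotient_le

/-- The left order of a submodule of `A`. -/
def leftOrder (X : Submodule (ZS S) A) : Subalgebra (ZS S) A where
  carrier := {x | ∀ y ∈ X, x * y ∈ X}
  mul_mem' ha hb y hy := by rw [mul_assoc]; exact ha _ (hb y hy)
  add_mem' ha hb y hy := by rw [add_mul]; exact X.add_mem (ha y hy) (hb y hy)
  algebraMap_mem' r _ hy := by rw [← Algebra.smul_def]; exact X.smul_mem r hy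

/-- The right order of a submodule of `A`. -/
def rightOrder (X : Submodule (ZS S) A) : Subalgebra (ZS S) A where
  carrier := {x | ∀ y ∈ X, y * x ∈ X}
  mul_mem' ha hb y hy := by rw [← mul_assoc]; exact hb _ (ha y hy)
  add_mem' ha hb y hy := by rw [mul_add]; exact X.add_mem (ha y hy) (hb y hy)
  algebraMap_mem' r _ hy := by
    rw [← Algebra.commutes, ← Algebra.smul_def]; exact X.smul_mem r hy

theorem IsMaximalOrder.le_of_natCast_mul_mem (hO : IsMaximalOrder S O)
    {O' : Subalgebra (ZS S) A} (h : O ≤ O') {n : ℕ} (hn : n ≠ 0)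
    (hO' : ∀ x ∈ O', (n : A) * x ∈ O) : O' ≤ O := by
  have hl : Submodule.IsLattice ℚ (Subalgebra.toSubmodule O) := hO.prop
  refine hO.le_of_ge ⟨?_, top_le_iff.1 (hl.span_eq_top.ge.trans (Submodule.span_mono h))⟩ h
  let N := (Subalgebra.toSubmodule O).map (LinearMap.mulLeft (ZS S) ((n : ℚ)⁻¹ • (1 : A)))
  have hN : N.FG := hl.fg.map _
  have : IsNoetherian (ZS S) N := isNoetherian_of_fg_of_noetherian N hN
  refine Submodule.FG.of_le hN fun y hy => Submodule.mem_map.2 ⟨n * y, hO' y hy, ?_⟩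
  rw [LinearMap.mulLeft_apply, smul_one_mul, inv_natCast_smul_eq_iff hn]

theorem IsMaximalOrder.isIntegrallyClosedOrder (hO : IsMaximalOrder S O) :
    IsIntegrallyClosedOrder O where
  toIsArithmeticRing := isArithmeticRing_of_isOrderOver hO.prop
  dvd_of_mul_left_mem I _ n k hn hnI hk x hx := by
    let X : Submodule (ZS S) A := (I.restrictScalars (ZS S)).map O.val.toLinearMap
    have hO' : leftOrder X ≤ O := hO.le_of_natCast_mul_mem
      (fun r hr => by
        rintro _ ⟨y, hy, rfl⟩
        exact ⟨⟨r, hr⟩ * y, I.mul_mem_left _ hy, rfl⟩) hn fun y hy => by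
          obtain ⟨z, -, hz⟩ := hy n ⟨_, hnI, map_natCast O.val n⟩
          rw [Nat.cast_comm, ← hz]
          exact z.2
    have hx' : (k : ℚ)⁻¹ • (x : A) ∈ O := hO' <| by
      rintro _ ⟨y, hy, rfl⟩
      obtain ⟨z, hz, hxy⟩ := hx y hy
      refine ⟨z, hz, (?_ : (z : A) = (k : ℚ)⁻¹ • (x : A) * y)⟩
      rw [smul_mul_assoc, eq_comm, inv_natCast_smul_eq_iff hk]
      simpa using congrArg Subtype.val hxy
    exact ⟨⟨_, hx'⟩, Subtype.ext (by simpa using (inv_natCast_smul_eq_iff hk).1 rfl)⟩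
  dvd_of_mul_right_mem I _ n k hn hnI hk x hx := by
    let X : Submodule (ZS S) A := (I.restrictScalars (ZS S)).map O.val.toLinearMap
    have hO' : rightOrder X ≤ O := hO.le_of_natCast_mul_mem
      (fun r hr => by
        rintro _ ⟨y, hy, rfl⟩
        exact ⟨y * ⟨r, hr⟩, I.mul_mem_right _ hy, rfl⟩) hn fun y hy => by
          obtain ⟨z, -, hz⟩ := hy n ⟨_, hnI, map_natCast O.val n⟩
          rw [← hz]
          exact z.2
    have hx' : (k : ℚ)⁻¹ • (x : A) ∈ O := hO' <| by
      rintro _ ⟨y, hy, rfl⟩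
      obtain ⟨z, hz, hyx⟩ := hx y hy
      refine ⟨z, hz, (?_ : (z : A) = (y : A) * (k : ℚ)⁻¹ • (x : A))⟩
      rw [mul_smul_comm, eq_comm, inv_natCast_smul_eq_iff hk]
      simpa using congrArg Subtype.val hyx
    exact ⟨⟨_, hx'⟩, Subtype.ext (by simpa using (inv_natCast_smul_eq_iff hk).1 rfl)⟩

end MaximalOrders

section HomCardinalities

theorem natCard_eq_ker_mul {G H : Type*} [AddCommGroup G] [AddCommGroup H] (φ : G →+ H)
    (hφ : Function.Surjective φ) : Nat.card G = Nat.card φ.ker * Nat.card H := by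
  rw [AddSubgroup.card_eq_card_quotient_mul_card_addSubgroup φ.ker, mul_comm,
    Nat.card_congr (QuotientAddGroup.quotientKerEquivOfSurjective φ hφ).toEquiv]

variable {R M N K L : Type*} [Ring R] [AddCommGroup M] [Module R M] [AddCommGroup N] [Module R N]
  [AddCommGroup K] [Module R K] [AddCommGroup L] [Module R L]

theorem card_hom_congr (e : M ≃ₗ[R] N) (e' : K ≃ₗ[R] L) :
    Nat.card (M →ₗ[R] K) = Nat.card (N →ₗ[R] L) :=
  Nat.card_congr (e.arrowCongrAddEquiv e').toEquiv

theorem card_hom_prod (M N K : Type*) [AddCommGroup M] [Module R M] [AddCommGroup N]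
    [Module R N] [AddCommGroup K] [Module R K] :
    Nat.card (M × N →ₗ[R] K) = Nat.card (M →ₗ[R] K) * Nat.card (N →ₗ[R] K) := by
  rw [← Nat.card_congr (LinearMap.coprodEquiv (R := R) (M := M) (M₂ := N) (M₃ := K) ℕ).toEquiv,
    Nat.card_prod]

theorem card_hom_self (R K : Type*) [Ring R] [AddCommGroup K] [Module R K] :
    Nat.card (R →ₗ[R] K) = Nat.card K :=
  Nat.card_congr (LinearMap.ringLmapEquivSelf R ℕ K).toEquiv

theorem card_hom_pi (R : Type*) [Ring R] (n : ℕ) (K : Type*) [AddCommGroup K] [Module R K] :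
    Nat.card ((Fin n → R) →ₗ[R] K) = Nat.card K ^ n := by
  rw [← Nat.card_congr ((Pi.basisFun R (Fin n)).constr ℕ (M' := K)).toEquiv, Nat.card_fun,
    Nat.card_fin]

theorem card_hom_eq_mul [Module.Projective R M] (f : N →ₗ[R] L) (hf : Function.Surjective f) :
    Nat.card (M →ₗ[R] N) = Nat.card (M →ₗ[R] LinearMap.ker f) * Nat.card (M →ₗ[R] L) := by
  let φ : (M →ₗ[R] N) →+ (M →ₗ[R] L) :=
    { toFun := fun a => f.comp a
      map_zero' := LinearMap.comp_zero f
      map_add' := fun a b => LinearMap.comp_add _ _ _ }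
  rw [natCard_eq_ker_mul φ (fun b => Module.projective_lifting_property f b hf)]
  congr 1
  exact Nat.card_congr
    { toFun a := a.1.codRestrict _ fun m => LinearMap.congr_fun a.2 m
      invFun b := ⟨(LinearMap.ker f).subtype.comp b, LinearMap.ext fun m => (b m).2⟩
      left_inv _ := rfl
      right_inv _ := rfl }

/-- Schanuel's lemma. -/
theorem nonempty_ker_prod_linearEquiv [Module.Projective R M] [Module.Projective R N]
    (f : M →ₗ[R] K) (g : N →ₗ[R] K) (hf : Function.Surjective f) (hg : Function.Surjective g) :
    Nonempty ((LinearMap.ker f × N) ≃ₗ[R] (M × LinearMap.ker g)) := by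
  obtain ⟨s, hs⟩ := Module.projective_lifting_property g f hg
  obtain ⟨t, ht⟩ := Module.projective_lifting_property f g hf
  have hgs : ∀ m, g (s m) = f m := LinearMap.congr_fun hs
  have hft : ∀ n, f (t n) = g n := LinearMap.congr_fun ht
  let forward : (LinearMap.ker f × N) →ₗ[R] M := (LinearMap.ker f).subtype.coprod t
  let backward : (M × LinearMap.ker g) →ₗ[R] N := s.coprod (LinearMap.ker g).subtype
  refine ⟨LinearEquiv.ofLinearMap
    (forward.prod ((LinearMap.snd R _ _ - s ∘ₗ forward).codRestrict _ fun x => ?_))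
    (((LinearMap.fst R _ _ - t ∘ₗ backward).codRestrict _ fun y => ?_).prod backward)
    (LinearMap.ext fun y => ?_) (LinearMap.ext fun x => ?_)⟩
  · ext <;> simp [forward, backward]
  · ext <;> simp [forward, backward]
  · simp [forward, hgs, hft]
  · simp [backward, hgs, hft]

end HomCardinalities

section ProjectiveSubmodules

variable {R M : Type*} [Ring R] [AddCommGroup M] [Module R M]

theorem finite_quotient_submoduleOf (N N' : Submodule R M) [Finite (M ⧸ N)] :
    Finite (N' ⧸ N.submoduleOf N') :=
  Finite.of_injective ((N.submoduleOf N').mapQ N N'.subtype le_rfl)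
    (LinearMap.ker_eq_bot.1 (Submodule.ker_liftQ_eq_bot _ _ _
      ((LinearMap.ker_comp _ _).trans (congrArg _ N.ker_mkQ)).le))

theorem finite_quotient_induction {p : Submodule R M → Prop} (htop : p ⊤)
    (hle : ∀ N N' : Submodule R M, N ≤ N' → Finite (M ⧸ N') → Finite (N' ⧸ N.submoduleOf N') →
      IsSimpleModule R (N' ⧸ N.submoduleOf N') → p N' → p N)
    (N : Submodule R M) [Finite (M ⧸ N)] : p N := by
  have : Finite (Set.Ici N) := Finite.of_equiv _ (Submodule.comapMkQRelIso N).toEquiv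
  suffices h : ∀ N' : Set.Ici N, p N' from h ⟨N, Set.self_mem_Ici⟩
  intro N₁
  induction N₁ using WellFoundedGT.induction with
  | _ N₁ ih =>
  obtain rfl | hlt := eq_or_lt_of_le (le_top : N₁ ≤ ⊤)
  · exact htop
  obtain ⟨N₂, hcov, -⟩ := exists_covBy_le_of_lt hlt
  have hcov' : (N₁ : Submodule R M) ⋖ N₂ :=
    (Set.OrdConnected.apply_covBy_apply_iff (OrderEmbedding.subtype (· ∈ Set.Ici N))
      (by simpa only [OrderEmbedding.coe_subtype, Subtype.range_coe] using
        Set.ordConnected_Ici)).2 hcov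
  have hfinite : Finite (M ⧸ (N₁ : Submodule R M)) :=
    Finite.of_surjective _ (Submodule.factor_surjective N₁.2)
  refine hle N₁ N₂ hcov'.le (Finite.of_surjective _ (Submodule.factor_surjective N₂.2)) ?_
    ((covBy_iff_quot_is_simple hcov'.le).1 hcov') (ih N₂ hcov.lt)
  exact finite_quotient_submoduleOf _ _

theorem projective_of_le_of_isSemisimpleModule {P I : Ideal R} (hPI : P ≤ I)
    [Module.Projective R P] [IsSemisimpleModule R (R ⧸ P)] : Module.Projective R I := by
  obtain ⟨C, hC⟩ := exists_isCompl (Submodule.map P.mkQ I)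
  obtain ⟨_, ⟨a, ha, rfl⟩, c, hc, hac⟩ := Submodule.mem_sup.1
    (hC.sup_eq_top.ge (Submodule.mem_top : P.mkQ 1 ∈ ⊤))
  rw [← eq_sub_iff_add_eq', ← map_sub] at hac
  subst hac
  have hmem : ∀ x ∈ I, x * (1 - a) ∈ P := fun x hx => by
    have hI : x * (1 - a) ∈ I := by
      rw [mul_sub, mul_one]
      exact I.sub_mem hx (I.mul_mem_left x ha)
    rw [← Submodule.Quotient.mk_eq_zero P]
    exact (Submodule.mem_bot R).1 (hC.inf_eq_bot.le ⟨⟨_, hI, rfl⟩, C.smul_mem x hc⟩)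
  let i : I →ₗ[R] P × R :=
    ((LinearMap.toSpanSingleton R R (1 - a)).restrict hmem).prod I.subtype
  let s : P × R →ₗ[R] I :=
    (Submodule.inclusion hPI).coprod (LinearMap.toSpanSingleton R I ⟨a, ha⟩)
  refine Module.Projective.of_split i s ?_
  refine LinearMap.ext fun x => Subtype.ext ?_
  change (x : R) * (1 - a) + x * a = x
  rw [← mul_add, sub_add_cancel, mul_one]

theorem IsDedekindLike.projective_of_isSimpleModule_quotient (hR : IsDedekindLike R)
    {I : Ideal R} [Finite (R ⧸ I)] [IsSimpleModule R (R ⧸ I)] : Module.Projective R I := by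
  have := hR.projective _ (isFinitePrimitive_annihilator (R ⧸ I))
  have := isSemisimpleModule_quotient_annihilator (R := R) (K := R ⧸ I)
  refine projective_of_le_of_isSemisimpleModule
    (P := Module.annihilator R (R ⧸ I)) fun r hr => ?_
  rw [← Submodule.Quotient.mk_eq_zero I, ← mul_one r, ← smul_eq_mul, Submodule.Quotient.mk_smul]
  exact Module.mem_annihilator.1 hr _

theorem nonempty_prod_linearEquiv_of_isSimpleModule_quotient [Module.Projective R M]
    {N : Submodule R M} {I : Ideal R} (e : (M ⧸ N) ≃ₗ[R] R ⧸ I) :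
    Nonempty ((N × R) ≃ₗ[R] M × I) := by
  have hker : LinearMap.ker (e.toLinearMap ∘ₗ N.mkQ) = N := by
    rw [LinearEquiv.ker_comp, Submodule.ker_mkQ]
  obtain ⟨s⟩ := nonempty_ker_prod_linearEquiv (e.toLinearMap ∘ₗ N.mkQ) I.mkQ
    (e.surjective.comp N.mkQ_surjective) I.mkQ_surjective
  exact ⟨((LinearEquiv.ofEq _ _ hker.symm).prodCongr (.refl R R)).trans
    (s.trans ((LinearEquiv.refl R M).prodCongr (.ofEq _ _ I.ker_mkQ)))⟩

theorem IsDedekindLike.projective_of_finite_quotient (hR : IsDedekindLike R)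
    [Module.Projective R M] (N : Submodule R M) [Finite (M ⧸ N)] : Module.Projective R N := by
  induction N using finite_quotient_induction with
  | htop => exact .of_equiv Submodule.topEquiv.symm
  | hle N N' hNN' _ _ hsimple _ =>
    obtain ⟨I, hI, ⟨e⟩⟩ := isSimpleModule_iff_quot_maximal.1 hsimple
    have : Finite (R ⧸ I) := Finite.of_equiv _ e.toEquiv
    have : IsSimpleModule R (R ⧸ I) := isSimpleModule_iff_isCoatom.2 hI.out
    have := hR.projective_of_isSimpleModule_quotient (I := I)
    obtain ⟨s⟩ := nonempty_prod_linearEquiv_of_isSimpleModule_quotient e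
    have : Module.Projective R (N.submoduleOf N' × R) := .of_equiv s.symm
    have : Module.Projective R (N.submoduleOf N') :=
      .of_split (LinearMap.inl R _ R) (LinearMap.fst R _ R) (LinearMap.fst_comp_inl R _ R)
    exact .of_equiv (Submodule.submoduleOfEquivOfLe hNN')

end ProjectiveSubmodules

section HomCount

variable {R M K : Type*} [Ring R] [AddCommGroup M] [Module R M] [AddCommGroup K] [Module R K]

theorem IsFinitePrimitive.exists_mem_one_sub_mem {P Q : Ideal R} (hP : IsFinitePrimitive P)
    (hQ : IsFinitePrimitive Q) (hPQ : P ≠ Q) : ∃ b ∈ Q, 1 - b ∈ P := by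
  have := hP.isTwoSided
  have := hQ.isTwoSided
  have : (P ⊔ Q).IsTwoSided := by
    refine ⟨fun {x} r hx => ?_⟩
    obtain ⟨a, ha, b, hb, rfl⟩ := Submodule.mem_sup.1 hx
    rw [add_mul]
    exact Submodule.add_mem_sup (P.mul_mem_right r ha) (Q.mul_mem_right r hb)
  have htop : P ⊔ Q = ⊤ := by
    by_contra h
    exact hPQ ((hP.eq_of_le le_sup_left h).symm.trans (hQ.eq_of_le le_sup_right h))
  obtain ⟨a, ha, b, hb, hab⟩ := Submodule.mem_sup.1 (htop.ge (Submodule.mem_top : (1 : R) ∈ ⊤))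
  exact ⟨b, hb, by rwa [← hab, add_sub_cancel_right]⟩

theorem smul_mem_map_ker_of_mem_mul {P Q : Ideal R} {N : Submodule R M}
    (hN : ∀ b ∈ Q, ∀ m : M, b • m ∈ N) (hK : P ≤ Module.annihilator R K) (α : N →ₗ[R] K)
    {x : R} (hx : x ∈ P * Q) (m : M) : x • m ∈ (LinearMap.ker α).map N.subtype := by
  suffices h : P * Q ≤ ((LinearMap.ker α).map N.subtype).comap (LinearMap.toSpanSingleton R M m)
    from h hx
  refine Ideal.mul_le.2 fun a ha b hb => ⟨a • ⟨b • m, hN b hb m⟩, ?_, (mul_smul a b m).symm⟩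
  rw [SetLike.mem_coe, LinearMap.mem_ker, map_smul]
  exact Module.mem_annihilator.1 (hK ha) _

theorem IsDedekindLike.exists_extension (hR : IsDedekindLike R) {P Q : Ideal R}
    (hP : IsFinitePrimitive P) (hQ : IsFinitePrimitive Q) (hPQ : P ≠ Q) {N : Submodule R M}
    (hN : ∀ b ∈ Q, ∀ m : M, b • m ∈ N) (hK : P ≤ Module.annihilator R K) (α : N →ₗ[R] K) :
    ∃ β : M →ₗ[R] K, β ∘ₗ N.subtype = α := by
  have := hP.isTwoSided
  have := hQ.isTwoSided
  obtain ⟨b, hbQ, hbP⟩ := hP.exists_mem_one_sub_mem hQ hPQ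
  -- `b` acts as the identity on `K` and maps `M` into `N`, so that `m ↦ α (b • m)` extends `α`.
  refine ⟨{ toFun := fun m => α ⟨b • m, hN b hbQ m⟩, map_add' := ?_, map_smul' := ?_ }, ?_⟩
  · intro m m'
    rw [← map_add]
    exact congrArg α (Subtype.ext (smul_add b m m'))
  · intro r m
    have hcommQ : b * r - r * b ∈ Q := Q.sub_mem (Q.mul_mem_right r hbQ) (Q.mul_mem_left r hbQ)
    have hcommP : b * r - r * b ∈ P := by
      rw [show b * r - r * b = r * (1 - b) - (1 - b) * r by noncomm_ring]
      exact P.sub_mem (P.mul_mem_left r hbP) (P.mul_mem_right r hbP)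
    obtain ⟨y, hy, hym⟩ := smul_mem_map_ker_of_mem_mul hN hK α
      (hR.inf_le_mul P Q hP hQ hPQ ⟨hcommP, hcommQ⟩) m
    rw [RingHom.id_apply, ← map_smul, ← sub_eq_zero, ← map_sub, ← LinearMap.mem_ker.1 hy]
    refine congrArg α (Subtype.ext ?_)
    rw [← N.subtype_apply y, hym]
    simp only [AddSubgroupClass.coe_sub, SetLike.val_smul, sub_smul, mul_smul]
  · ext n
    have hb : (1 - b) • α n = 0 := Module.mem_annihilator.1 (hK hbP) _
    rw [sub_smul, one_smul, sub_eq_zero] at hb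
    exact (map_smul α b n).trans hb.symm

theorem IsDedekindLike.card_hom_eq_of_isEmpty_linearEquiv (hR : IsDedekindLike R) [Finite K]
    [IsSimpleModule R K] {N : Submodule R M} [Finite (M ⧸ N)] [IsSimpleModule R (M ⧸ N)]
    (h : ¬ Nonempty ((M ⧸ N) ≃ₗ[R] K)) : Nat.card (N →ₗ[R] K) = Nat.card (M →ₗ[R] K) := by
  symm
  refine Nat.card_congr (Equiv.ofBijective (fun β : M →ₗ[R] K => β ∘ₗ N.subtype) ⟨?_, ?_⟩)
  · intro β β' hββ'
    have hker : N ≤ LinearMap.ker (β - β') := fun x hx =>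
      sub_eq_zero.2 (LinearMap.congr_fun hββ' ⟨x, hx⟩)
    rw [← sub_eq_zero, ← N.liftQ_mkQ (β - β') hker,
      linearMap_eq_zero_of_isEmpty_linearEquiv h (N.liftQ _ hker), LinearMap.zero_comp]
  · refine hR.exists_extension (isFinitePrimitive_annihilator K)
      (isFinitePrimitive_annihilator (M ⧸ N))
      (fun heq => h (nonempty_linearEquiv_of_annihilator_le heq.ge)) (fun b hb m => ?_) le_rfl
    rw [← Submodule.Quotient.mk_eq_zero N, Submodule.Quotient.mk_smul]
    exact Module.mem_annihilator.1 hb _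

theorem IsDedekindLike.exists_pow_mul_card_hom_eq (hR : IsDedekindLike R) [Module.Projective R M]
    {I : Ideal R} [Finite (R ⧸ I)] [IsSimpleModule R (R ⧸ I)] (N : Submodule R M)
    [Finite (M ⧸ N)] :
    ∃ n : ℕ, Nat.card (R →ₗ[R] R ⧸ I) ^ n * Nat.card (N →ₗ[R] R ⧸ I) =
      Nat.card (I →ₗ[R] R ⧸ I) ^ n * Nat.card (M →ₗ[R] R ⧸ I) := by
  set a := Nat.card (R →ₗ[R] R ⧸ I)
  set b := Nat.card (I →ₗ[R] R ⧸ I)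
  induction N using finite_quotient_induction with
  | htop =>
    exact ⟨0, by rw [card_hom_congr Submodule.topEquiv (.refl R (R ⧸ I)), pow_zero, pow_zero]⟩
  | hle N N' hNN' _ _ _ ih =>
    have := hR.projective_of_finite_quotient N'
    rw [← card_hom_congr (Submodule.submoduleOfEquivOfLe hNN') (.refl R (R ⧸ I))]
    obtain ⟨n, hn⟩ := ih
    by_cases hI : Nonempty ((N' ⧸ N.submoduleOf N') ≃ₗ[R] R ⧸ I)
    · obtain ⟨e⟩ := hI
      obtain ⟨s⟩ := nonempty_prod_linearEquiv_of_isSimpleModule_quotient e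
      have hs := card_hom_congr s (.refl R (R ⧸ I))
      rw [card_hom_prod, card_hom_prod] at hs
      refine ⟨n + 1, ?_⟩
      calc a ^ (n + 1) * Nat.card (N.submoduleOf N' →ₗ[R] R ⧸ I)
          = a ^ n * (Nat.card (N.submoduleOf N' →ₗ[R] R ⧸ I) * a) := by ring
        _ = a ^ n * Nat.card (N' →ₗ[R] R ⧸ I) * b := by rw [hs, mul_assoc]
        _ = b ^ (n + 1) * Nat.card (M →ₗ[R] R ⧸ I) := by rw [hn]; ring
    · exact ⟨n, by rw [hR.card_hom_eq_of_isEmpty_linearEquiv hI, hn]⟩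

/-- Counting homomorphisms out of `k R ≅ R` in two ways, where `k R ⊆ I ⊆ R`. -/
theorem IsDedekindLike.card_hom_maximal_eq_card_hom_self (hR : IsDedekindLike R) {I : Ideal R}
    [Finite (R ⧸ I)] [IsSimpleModule R (R ⧸ I)] :
    Nat.card (I →ₗ[R] R ⧸ I) = Nat.card (R →ₗ[R] R ⧸ I) := by
  obtain ⟨k, hk, hkI⟩ : ∃ k : ℕ, k ≠ 0 ∧ (k : R) ∈ I := by
    refine ⟨Nat.card (R ⧸ I), Nat.card_pos.ne', (Submodule.Quotient.mk_eq_zero I).1 ?_⟩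
    rw [← nsmul_one, Submodule.Quotient.mk_smul, card_nsmul_eq_zero']
  let J : Ideal R := Ideal.span {(k : R)}
  have hJI : J ≤ I := (Ideal.span_singleton_le_iff_mem I).2 hkI
  have e : R ≃ₗ[R] J.submoduleOf I :=
    (LinearEquiv.ofInjective (LinearMap.toSpanSingleton R R (k : R)) <|
      (injective_iff_map_eq_zero _).2 fun r hr =>
        hR.natCast_mul_eq_zero k hk r ((Nat.cast_comm k r).trans hr)).trans <|
    (LinearEquiv.ofEq _ _ (LinearMap.span_singleton_eq_range R R (k : R)).symm).trans
      (Submodule.submoduleOfEquivOfLe hJI).symm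
  have := hR.finite_quotient hk (Ideal.mem_span_singleton_self (k : R))
  have := finite_quotient_submoduleOf J I
  have := hR.projective_of_isSimpleModule_quotient (I := I)
  obtain ⟨n, hn⟩ := hR.exists_pow_mul_card_hom_eq (I := I) (J.submoduleOf I)
  rw [← card_hom_congr e (.refl R (R ⧸ I)), ← pow_succ, ← pow_succ] at hn
  exact (Nat.pow_left_injective (Nat.succ_ne_zero n) hn).symm

theorem IsDedekindLike.card_hom_eq_of_isSimpleModule (hR : IsDedekindLike R)
    [Module.Projective R M] [Finite K] [IsSimpleModule R K] (N : Submodule R M)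
    [Finite (M ⧸ N)] : Nat.card (N →ₗ[R] K) = Nat.card (M →ₗ[R] K) := by
  obtain ⟨I, hI, ⟨e⟩⟩ := isSimpleModule_iff_quot_maximal.1 ‹IsSimpleModule R K›
  have : Finite (R ⧸ I) := Finite.of_equiv _ e.toEquiv
  have : IsSimpleModule R (R ⧸ I) := isSimpleModule_iff_isCoatom.2 hI.out
  obtain ⟨n, hn⟩ := hR.exists_pow_mul_card_hom_eq (I := I) N
  rw [hR.card_hom_maximal_eq_card_hom_self, card_hom_self] at hn
  rw [card_hom_congr (.refl R N) e, card_hom_congr (.refl R M) e]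
  exact Nat.eq_of_mul_eq_mul_left (pow_pos Nat.card_pos n) hn

theorem IsDedekindLike.card_hom_eq_of_finite_quotient (hR : IsDedekindLike R)
    [Module.Projective R M] (N : Submodule R M) [Finite (M ⧸ N)] (G : Type*) [AddCommGroup G]
    [Module R G] [Finite G] : Nat.card (N →ₗ[R] G) = Nat.card (M →ₗ[R] G) := by
  have := hR.projective_of_finite_quotient N
  induction hn : Nat.card G using Nat.strong_induction_on generalizing G with
  | _ n ih =>
  rcases subsingleton_or_nontrivial G with hG | hG
  · rw [Nat.card_unique, Nat.card_unique]
  obtain ⟨m, hm⟩ := exists_isSimpleModule_quotient_of_finite (R := R) G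
  have : Finite (G ⧸ m) := Finite.of_surjective _ m.mkQ_surjective
  have := IsSimpleModule.nontrivial R (G ⧸ m)
  have hcard : Nat.card (LinearMap.ker m.mkQ) < n := by
    rw [← hn, m.ker_mkQ, Submodule.card_eq_card_quotient_mul_card m]
    exact lt_mul_of_one_lt_right (Nat.card_pos (α := m)) (Finite.one_lt_card (α := G ⧸ m))
  rw [card_hom_eq_mul m.mkQ m.mkQ_surjective, card_hom_eq_mul m.mkQ m.mkQ_surjective,
    ih _ hcard _ rfl, hR.card_hom_eq_of_isSimpleModule N]

theorem IsDedekindLike.card_hom_ker_pi (hR : IsDedekindLike R) {d : ℕ} {G H : Type*}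
    [AddCommGroup G] [Module R G] [Finite G] [AddCommGroup H] [Module R H] [Finite H]
    (f : (Fin d → R) →ₗ[R] G) : Nat.card (LinearMap.ker f →ₗ[R] H) = Nat.card H ^ d := by
  have : Finite ((Fin d → R) ⧸ LinearMap.ker f) :=
    Finite.of_equiv _ f.quotKerEquivRange.symm.toEquiv
  rw [hR.card_hom_eq_of_finite_quotient (LinearMap.ker f), card_hom_pi]

end HomCount

section IsoClasses

variable (R : Type u) [Ring R]

/-- Isomorphism of finite modules, as an equivalence relation. -/
def isoSetoid : Setoid (FiniteModule R) where
  r := Iso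
  iseqv := ⟨fun _ => ⟨LinearEquiv.refl _ _⟩, fun ⟨e⟩ => ⟨e.symm⟩, fun ⟨e⟩ ⟨f⟩ => ⟨e.trans f⟩⟩

/-- The isomorphism classes of finite modules. -/
def IsoClass : Type (max 1 u) := Quotient (isoSetoid R)

variable {R}

/-- A representative of an isomorphism class. -/
noncomputable def IsoClass.out (E : IsoClass R) : FiniteModule R := Quotient.out E

/-- The isomorphism class of a finite module. -/
def FiniteModule.toClass (G : FiniteModule R) : IsoClass R := Quotient.mk (isoSetoid R) G

theorem FiniteModule.toClass_eq_iff {G H : FiniteModule R} : G.toClass = H.toClass ↔ Iso G H :=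
  Quotient.eq (r := isoSetoid R)

theorem FiniteModule.iso_out (G : FiniteModule R) : Iso G.toClass.out G :=
  Quotient.mk_out (s := isoSetoid R) G

theorem IsoClass.toClass_out (E : IsoClass R) : E.out.toClass = E := Quotient.out_eq E

theorem IsoClass.iso_out_iff {E : IsoClass R} {G : FiniteModule R} :
    Iso E.out G ↔ E = G.toClass := by
  rw [← FiniteModule.toClass_eq_iff, E.toClass_out]

/-- A model in `Type` of a finite module in any universe. -/
noncomputable def FiniteModule.ofFinite (M : Type v) [AddCommGroup M] [Module R M] [Finite M] :
    FiniteModule R where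
  carrier := Shrink.{0} M

/-- The isomorphism between a finite module and its model in `Type`. -/
noncomputable def FiniteModule.ofFiniteEquiv (M : Type v) [AddCommGroup M] [Module R M] [Finite M] :
    FiniteModule.ofFinite (R := R) M ≃ₗ[R] M := Shrink.linearEquiv.{0} R M

instance finite_linearMap {M N : Type*} [AddCommGroup M] [Module R M] [AddCommGroup N] [Module R N]
    [Finite M] [Finite N] : Finite (M →ₗ[R] N) := DFunLike.finite _

instance finite_linearEquiv {M N : Type*} [AddCommGroup M] [Module R M] [AddCommGroup N]
    [Module R N] [Finite M] [Finite N] : Finite (M ≃ₗ[R] N) := DFunLike.finite _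

theorem autCount_pos (G : FiniteModule R) : 0 < autCount G :=
  Nat.card_pos (α := G ≃ₗ[R] G)

theorem autCount_ne_zero (G : FiniteModule R) : (autCount G : ℝ≥0∞) ≠ 0 := by
  exact_mod_cast (autCount_pos G).ne'

/-- Transport of linear equivalences along an isomorphism of their targets. -/
def linearEquivCongrRight {M N N' : Type*} [AddCommGroup M] [Module R M] [AddCommGroup N]
    [Module R N] [AddCommGroup N'] [Module R N'] (e : N ≃ₗ[R] N') :
    (M ≃ₗ[R] N) ≃ (M ≃ₗ[R] N') where
  toFun a := a.trans e
  invFun a := a.trans e.symm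
  left_inv a := by ext; simp
  right_inv a := by ext; simp

theorem card_linearEquiv_eq_autCount {G : FiniteModule R} {M : Type*} [AddCommGroup M] [Module R M]
    (e : G ≃ₗ[R] M) : Nat.card (G ≃ₗ[R] M) = autCount G :=
  Nat.card_congr (linearEquivCongrRight e.symm)

theorem autCount_congr {G H : FiniteModule R} (e : G ≃ₗ[R] H) : autCount G = autCount H := by
  rw [← card_linearEquiv_eq_autCount e, ← card_linearEquiv_eq_autCount e.symm]
  exact Nat.card_congr ⟨fun a => a.symm, fun a => a.symm, fun _ => rfl, fun _ => rfl⟩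

theorem surCount_congr {G G' H H' : FiniteModule R} (e : G ≃ₗ[R] G') (f : H ≃ₗ[R] H') :
    surCount G H = surCount G' H' :=
  Nat.card_congr (Equiv.subtypeEquiv (e.arrowCongrAddEquiv f).toEquiv fun a => by
    simp [LinearEquiv.arrowCongrAddEquiv])

theorem tsum_card_linearEquiv_div_autCount (M : Type v) [AddCommGroup M] [Module R M] [Finite M] :
    ∑' E : IsoClass R, (Nat.card (E.out ≃ₗ[R] M) : ℝ≥0∞) / autCount E.out = 1 := by
  set G := FiniteModule.ofFinite (R := R) M
  have e : G ≃ₗ[R] M := FiniteModule.ofFiniteEquiv M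
  obtain ⟨s⟩ := G.iso_out
  rw [tsum_eq_single G.toClass]
  · rw [card_linearEquiv_eq_autCount (s.trans e)]
    exact ENNReal.div_self (autCount_ne_zero _) (ENNReal.natCast_ne_top _)
  · intro E hE
    have : IsEmpty (E.out ≃ₗ[R] M) := ⟨fun a => hE (IsoClass.iso_out_iff.1 ⟨a.trans e.symm⟩)⟩
    simp

theorem tsum_card_div_autCount {Z : Type*} [Finite Z] (M : Z → Type v) [∀ z, AddCommGroup (M z)]
    [∀ z, Module R (M z)] [∀ z, Finite (M z)] (X : IsoClass R → Type*)
    (e : ∀ E, X E ≃ Σ z, (E.out ≃ₗ[R] M z)) :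
    ∑' E : IsoClass R, (Nat.card (X E) : ℝ≥0∞) / autCount E.out = Nat.card Z := by
  have := Fintype.ofFinite Z
  have hX : ∀ E, (Nat.card (X E) : ℝ≥0∞) / autCount E.out
      = ∑' z, (Nat.card (E.out ≃ₗ[R] M z) : ℝ≥0∞) / autCount E.out := fun E => by
    rw [Nat.card_congr (e E), Nat.card_sigma, tsum_fintype]
    push_cast
    simp only [div_eq_mul_inv, Finset.sum_mul]
  simp_rw [hX]
  rw [ENNReal.tsum_comm]
  simp_rw [tsum_card_linearEquiv_div_autCount]
  simp [Nat.card_eq_fintype_card]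

end IsoClasses

section ShortExact

variable {R : Type u} [Ring R]

/-- Short exact sequences `0 → K → E → G → 0`. -/
@[ext]
structure ShortExactSeq (R : Type u) [Ring R] (K E G : Type*) [AddCommGroup K] [Module R K]
    [AddCommGroup E] [Module R E] [AddCommGroup G] [Module R G] where
  /-- The inclusion of the kernel. -/
  inc : K →ₗ[R] E
  /-- The projection to the quotient. -/
  proj : E →ₗ[R] G
  inc_injective : Function.Injective inc
  proj_surjective : Function.Surjective proj
  exact : Function.Exact inc proj

/-- A surjection `H → G` together with a surjection from its kernel to `K`. -/
structure SurPair (R : Type u) [Ring R] (H K G : Type*) [AddCommGroup H] [Module R H]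
    [AddCommGroup K] [Module R K] [AddCommGroup G] [Module R G] where
  /-- The surjection to `G`. -/
  φ : H →ₗ[R] G
  φ_surjective : Function.Surjective φ
  /-- The surjection from the kernel. -/
  ψ : LinearMap.ker φ →ₗ[R] K
  ψ_surjective : Function.Surjective ψ

variable {H K E G : Type*} [AddCommGroup H] [Module R H] [AddCommGroup K] [Module R K]
    [AddCommGroup E] [Module R E] [AddCommGroup G] [Module R G]

theorem exists_comp_eq_of_ker_le (χ : H →ₗ[R] E) (hχ : Function.Surjective χ) (φ : H →ₗ[R] G)
    (h : LinearMap.ker χ ≤ LinearMap.ker φ) : ∃ π : E →ₗ[R] G, π ∘ₗ χ = φ := by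
  refine ⟨(LinearMap.ker χ).liftQ φ h ∘ₗ (χ.quotKerEquivOfSurjective hχ).symm, ?_⟩
  ext x
  have hx : (χ.quotKerEquivOfSurjective hχ).symm (χ x) = Submodule.Quotient.mk x :=
    (χ.quotKerEquivOfSurjective hχ).symm_apply_eq.2 rfl
  simp [hx]

/-- Surjections with kernel `N` are the isomorphisms with the quotient by `N`. -/
noncomputable def surjectionEquiv (N : Submodule R H) :
    {χ : H →ₗ[R] E // Function.Surjective χ ∧ LinearMap.ker χ = N} ≃ (E ≃ₗ[R] (H ⧸ N)) where
  toFun χ := ((Submodule.quotEquivOfEq _ _ χ.2.2.symm).trans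
    (χ.1.quotKerEquivOfSurjective χ.2.1)).symm
  invFun e := ⟨e.symm ∘ₗ N.mkQ, e.symm.surjective.comp N.mkQ_surjective, by
    rw [LinearEquiv.ker_comp, Submodule.ker_mkQ]⟩
  left_inv _ := rfl
  right_inv e := by
    ext x
    obtain ⟨b, rfl⟩ := e.symm.surjective x
    obtain ⟨b, rfl⟩ := N.mkQ_surjective b
    rw [LinearEquiv.symm_apply_eq, LinearEquiv.apply_symm_apply]
    rfl

/-- Injections with image `N` are the isomorphisms with `N`. -/
noncomputable def injectionEquiv (N : Submodule R E) :
    {i : K →ₗ[R] E // Function.Injective i ∧ LinearMap.range i = N} ≃ (K ≃ₗ[R] N) where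
  toFun i := (LinearEquiv.ofInjective i.1 i.2.1).trans (LinearEquiv.ofEq _ _ i.2.2)
  invFun e := ⟨N.subtype ∘ₗ e, N.injective_subtype.comp e.injective, by
    rw [LinearMap.range_comp, LinearEquiv.range, Submodule.map_top, Submodule.range_subtype]⟩
  left_inv _ := rfl
  right_inv _ := LinearEquiv.ext fun _ => rfl

namespace SurPair

theorem ext_of_apply {z z' : SurPair R H K G} (hφ : ∀ x, z.φ x = z'.φ x)
    (hψ : ∀ x (hx : z.φ x = 0) (hx' : z'.φ x = 0), z.ψ ⟨x, hx⟩ = z'.ψ ⟨x, hx'⟩) : z = z' := by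
  obtain ⟨φ, _, ψ, _⟩ := z
  obtain ⟨φ', _, ψ', _⟩ := z'
  obtain rfl : φ = φ' := LinearMap.ext hφ
  obtain rfl : ψ = ψ' := LinearMap.ext fun x => hψ x x.2 x.2
  rfl

/-- The kernel of the second surjection, in `H`. -/
def kernel (z : SurPair R H K G) : Submodule R H :=
  (LinearMap.ker z.ψ).map (LinearMap.ker z.φ).subtype

theorem mem_kernel {z : SurPair R H K G} {x : H} :
    x ∈ z.kernel ↔ ∃ h : z.φ x = 0, z.ψ ⟨x, h⟩ = 0 := by
  simp [kernel]

theorem kernel_le (z : SurPair R H K G) : z.kernel ≤ LinearMap.ker z.φ :=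
  Submodule.map_subtype_le _ _

theorem finite_quotient_kernel (z : SurPair R H K G) [Finite K] [Finite G] :
    Finite (H ⧸ z.kernel) := by
  choose σ hσ using z.φ_surjective
  have hmem (x : H) : z.φ (x - σ (z.φ x)) = 0 := by rw [map_sub, hσ, sub_self]
  refine Finite.of_injective
    (fun q : H ⧸ z.kernel => (z.φ q.out, z.ψ ⟨q.out - σ (z.φ q.out), hmem _⟩)) fun q q' h => ?_
  obtain ⟨hφ, hψ⟩ := Prod.ext_iff.1 h
  rw [← Quotient.out_eq q, ← Quotient.out_eq q']
  refine (Submodule.Quotient.eq _).2 (mem_kernel.2 ⟨by simpa [sub_eq_zero] using hφ, ?_⟩)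
  dsimp only at hφ hψ
  rw [← sub_eq_zero, ← map_sub] at hψ
  convert hψ using 2
  ext
  simp [hφ]

end SurPair

namespace ShortExactSeq

theorem proj_inc (s : ShortExactSeq R K E G) (k : K) : s.proj (s.inc k) = 0 :=
  s.exact.apply_apply_eq_zero k

/-- The isomorphism of `K` with the kernel of `E → G`. -/
noncomputable def kerEquiv (s : ShortExactSeq R K E G) : K ≃ₗ[R] LinearMap.ker s.proj :=
  injectionEquiv _ ⟨s.inc, s.inc_injective, s.exact.linearMap_ker_eq.symm⟩

theorem inc_kerEquiv_symm (s : ShortExactSeq R K E G) (x : LinearMap.ker s.proj) :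
    s.inc (s.kerEquiv.symm x) = x :=
  congrArg Subtype.val (s.kerEquiv.apply_symm_apply x)

/-- The two surjections out of `H` and out of the preimage of `K` that a surjection `χ : H → E`
yields. -/
noncomputable def pullback (s : ShortExactSeq R K E G) (χ : H →ₗ[R] E)
    (hχ : Function.Surjective χ) : SurPair R H K G where
  φ := s.proj ∘ₗ χ
  φ_surjective := s.proj_surjective.comp hχ
  ψ := s.kerEquiv.symm.toLinearMap ∘ₗ
    χ.restrict (p := LinearMap.ker (s.proj ∘ₗ χ)) (q := LinearMap.ker s.proj) fun _ hx => hx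
  ψ_surjective k := by
    obtain ⟨x, hx⟩ := hχ (s.inc k)
    have hx0 : s.proj (χ x) = 0 := by rw [hx, s.proj_inc]
    exact ⟨⟨x, hx0⟩, s.kerEquiv.symm_apply_eq.2 (Subtype.ext hx)⟩

variable {χ : H →ₗ[R] E} (hχ : Function.Surjective χ)

theorem inc_pullback_ψ (s : ShortExactSeq R K E G) (x : LinearMap.ker (s.pullback χ hχ).φ) :
    s.inc ((s.pullback χ hχ).ψ x) = χ x :=
  s.inc_kerEquiv_symm _

theorem pullback_eq_iff {s : ShortExactSeq R K E G} {z : SurPair R H K G} :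
    s.pullback χ hχ = z ↔ s.proj ∘ₗ χ = z.φ ∧ ∀ x, s.inc (z.ψ x) = χ x := by
  constructor
  · rintro rfl
    exact ⟨rfl, s.inc_pullback_ψ hχ⟩
  · rintro ⟨hφ, hψ⟩
    exact SurPair.ext_of_apply (LinearMap.congr_fun hφ) fun x hx hx' =>
      s.inc_injective ((s.inc_pullback_ψ hχ ⟨x, hx⟩).trans (hψ ⟨x, hx'⟩).symm)

theorem kernel_pullback (s : ShortExactSeq R K E G) :
    (s.pullback χ hχ).kernel = LinearMap.ker χ := by
  ext x
  simp only [SurPair.mem_kernel, ← s.inc_injective.eq_iff, s.inc_pullback_ψ hχ, map_zero,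
    LinearMap.mem_ker, exists_prop, and_iff_right_iff_imp]
  exact fun hx => (congrArg s.proj hx).trans (map_zero _)

theorem pullback_injective :
    Function.Injective fun s : ShortExactSeq R K E G => s.pullback χ hχ := by
  intro s s' h
  obtain ⟨hφ, hψ⟩ := (pullback_eq_iff hχ).1 h
  refine ShortExactSeq.ext (LinearMap.ext fun k => ?_)
    ((LinearMap.cancel_right hχ).1 hφ)
  obtain ⟨x, rfl⟩ := (s'.pullback χ hχ).ψ_surjective k
  rw [hψ, s'.inc_pullback_ψ]

theorem exists_pullback_eq (z : SurPair R H K G) (hz : LinearMap.ker χ = z.kernel) :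
    ∃ s : ShortExactSeq R K E G, s.pullback χ hχ = z := by
  have hker : LinearMap.ker z.ψ = LinearMap.ker (χ ∘ₗ (LinearMap.ker z.φ).subtype) := by
    rw [LinearMap.ker_comp, hz]
    exact (Submodule.comap_map_eq_of_injective (LinearMap.ker z.φ).injective_subtype _).symm
  obtain ⟨π, hπ⟩ := exists_comp_eq_of_ker_le χ hχ z.φ (hz ▸ z.kernel_le)
  obtain ⟨ι, hι⟩ := exists_comp_eq_of_ker_le z.ψ z.ψ_surjective _ hker.le
  have hπ' : ∀ x, π (χ x) = z.φ x := LinearMap.congr_fun hπ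
  have hι' : ∀ x, ι (z.ψ x) = χ x := LinearMap.congr_fun hι
  refine ⟨⟨ι, π, ?_, ?_, ?_⟩, (pullback_eq_iff hχ).2 ⟨hπ, hι'⟩⟩
  · refine (injective_iff_map_eq_zero ι).2 fun k hk => ?_
    obtain ⟨x, rfl⟩ := z.ψ_surjective k
    exact hker.ge ((hι' x).symm.trans hk)
  · exact .of_comp (g := χ) (by rw [← LinearMap.coe_comp, hπ]; exact z.φ_surjective)
  · intro y
    obtain ⟨x, rfl⟩ := hχ y
    rw [hπ']
    refine ⟨fun hx => ⟨z.ψ ⟨x, hx⟩, hι' _⟩, ?_⟩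
    rintro ⟨k, hk⟩
    obtain ⟨w, rfl⟩ := z.ψ_surjective k
    rw [← hπ', ← hk, hι', hπ']
    exact w.2

end ShortExactSeq

theorem tsum_card_pullback_div_autCount (p : SurPair R H K G → Prop) [Finite {z // p z}] [Finite K]
    [Finite G] :
    ∑' E : IsoClass R, (Nat.card {x : {χ : H →ₗ[R] E.out // Function.Surjective χ} ×
        ShortExactSeq R K E.out G // p (x.2.pullback x.1.1 x.1.2)} : ℝ≥0∞) / autCount E.out
      = Nat.card {z // p z} := by
  have := fun z : {z // p z} => z.1.finite_quotient_kernel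
  refine tsum_card_div_autCount (fun z : {z // p z} => H ⧸ z.1.kernel) _ fun E =>
    Equiv.trans ?_ (Equiv.sigmaCongrRight fun z : {z // p z} => surjectionEquiv z.1.kernel)
  refine Equiv.ofBijective (fun x => ⟨⟨_, x.2⟩, x.1.1.1, x.1.1.2,
    (x.1.2.kernel_pullback x.1.1.2).symm⟩) ⟨?_, ?_⟩
  · rintro ⟨⟨⟨χ, hχ⟩, s⟩, hs⟩ ⟨⟨⟨χ', hχ'⟩, s'⟩, hs'⟩ h
    obtain rfl : χ = χ' := congrArg (fun y => y.2.1) h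
    obtain rfl := ShortExactSeq.pullback_injective hχ (congrArg (fun y => y.1.1) h)
    rfl
  · rintro ⟨⟨z, hz⟩, χ, hχ, hker⟩
    obtain ⟨s, rfl⟩ := ShortExactSeq.exists_pullback_eq hχ z hker
    exact ⟨⟨⟨⟨χ, hχ⟩, s⟩, hz⟩, rfl⟩

end ShortExact

section Moments

variable {R : Type u} [Ring R]

/-- The number of short exact sequences `0 → K → E → G → 0`. -/
noncomputable def seqCount (K E G : FiniteModule R) : ℕ := Nat.card (ShortExactSeq R K E G)

theorem tsum_seqCount_div_autCount (H G : FiniteModule R) :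
    ∑' K : IsoClass R, (seqCount K.out H G : ℝ≥0∞) / autCount K.out = surCount H G := by
  refine tsum_card_div_autCount
    (fun f : {f : H →ₗ[R] G // Function.Surjective f} => LinearMap.ker f.1) _ fun K =>
      Equiv.trans ?_ (Equiv.sigmaCongrRight
        fun f : {f : H →ₗ[R] G // Function.Surjective f} => injectionEquiv (LinearMap.ker f.1))
  exact {
    toFun s := ⟨⟨s.proj, s.proj_surjective⟩, s.inc, s.inc_injective,
      s.exact.linearMap_ker_eq.symm⟩
    invFun x := ⟨x.2.1, x.1.1, x.2.2.1, x.1.2, LinearMap.exact_iff.2 x.2.2.2.symm⟩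
    left_inv _ := rfl
    right_inv _ := rfl }

variable {F K E G : Type*} [AddCommGroup F] [Module R F] [AddCommGroup K] [Module R K]
  [AddCommGroup E] [Module R E] [AddCommGroup G] [Module R G]

theorem ShortExactSeq.proj_comp_eq_zero_iff (s : ShortExactSeq R K E G) {h : F →ₗ[R] E} :
    s.proj ∘ₗ h = 0 ↔ ∃ t : F →ₗ[R] K, s.inc ∘ₗ t = h := by
  constructor
  · intro hh
    refine ⟨s.kerEquiv.symm.toLinearMap ∘ₗ h.codRestrict _ (LinearMap.congr_fun hh), ?_⟩
    exact LinearMap.ext fun x => s.inc_kerEquiv_symm _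
  · rintro ⟨t, rfl⟩
    exact LinearMap.ext fun x => s.proj_inc (t x)

theorem ShortExactSeq.nonempty_lift_equiv [Module.Projective R F] (s : ShortExactSeq R K E G)
    (f : F →ₗ[R] G) : Nonempty ((F →ₗ[R] K) ≃ {g : F →ₗ[R] E // s.proj ∘ₗ g = f}) := by
  obtain ⟨g₀, hg₀⟩ := Module.projective_lifting_property s.proj f s.proj_surjective
  refine ⟨Equiv.ofBijective (fun t => ⟨g₀ + s.inc ∘ₗ t, ?_⟩) ⟨?_, ?_⟩⟩
  · rw [LinearMap.comp_add, hg₀, s.proj_comp_eq_zero_iff.2 ⟨t, rfl⟩, add_zero]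
  · intro t t' h
    exact (LinearMap.cancel_left s.inc_injective).1 (add_left_cancel (congrArg Subtype.val h))
  · rintro ⟨g, hg⟩
    obtain ⟨t, ht⟩ := s.proj_comp_eq_zero_iff (h := g - g₀) |>.1 (by
      rw [LinearMap.comp_sub, hg, hg₀, sub_self])
    exact ⟨t, Subtype.ext ((congrArg (g₀ + ·) ht).trans (add_sub_cancel g₀ g))⟩

/-- The first surjection of `z` is `f` on `F`, and the second one is the identity on `K`. Such a
pair is determined by the restriction of its second surjection to the kernel of `f`. -/
def SurPair.IsSplit (f : F →ₗ[R] G) (z : SurPair R (K × F) K G) : Prop :=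
  (∀ x, z.φ x = f x.2) ∧ ∀ k h, z.ψ ⟨(k, 0), h⟩ = k

variable (f : F →ₗ[R] G) (hf : Function.Surjective f)

/-- The pair of surjections out of `K × F` whose kernel is the relation defining the pushout of
`ker f → F` along `α`. -/
def pushoutPair (α : LinearMap.ker f →ₗ[R] K) : SurPair R (K × F) K G where
  φ := f ∘ₗ LinearMap.snd R K F
  φ_surjective := hf.comp Prod.snd_surjective
  ψ := LinearMap.fst R K F ∘ₗ Submodule.subtype _ +
    α ∘ₗ (LinearMap.snd R K F).restrict (q := LinearMap.ker f) fun _ hx => hx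
  ψ_surjective k := ⟨⟨(k, 0), map_zero f⟩, (congrArg (k + ·) (map_zero α)).trans (add_zero k)⟩

theorem pushoutPair_ψ_apply (α : LinearMap.ker f →ₗ[R] K)
    (x : LinearMap.ker (pushoutPair f hf α).φ) :
    (pushoutPair f hf α).ψ x = x.1.1 + α ⟨x.1.2, x.2⟩ := rfl

theorem isSplit_pushoutPair (α : LinearMap.ker f →ₗ[R] K) : (pushoutPair f hf α).IsSplit f :=
  ⟨fun _ => rfl, fun k _ => (congrArg (k + ·) (map_zero α)).trans (add_zero k)⟩

theorem pushoutPair_injective : Function.Injective (pushoutPair (K := K) f hf) := by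
  intro α β h
  ext x
  have hψ := LinearMap.congr_fun (eq_of_heq (SurPair.mk.inj h).2) ⟨(0, x), x.2⟩
  exact add_left_cancel hψ

theorem SurPair.IsSplit.exists_pushoutPair_eq {z : SurPair R (K × F) K G} (hz : z.IsSplit f) :
    ∃ α, pushoutPair f hf α = z := by
  have hmem (x : LinearMap.ker f) : LinearMap.inr R K F x ∈ LinearMap.ker z.φ := by
    rw [LinearMap.mem_ker, hz.1]
    exact x.2
  refine ⟨z.ψ ∘ₗ (LinearMap.inr R K F).restrict fun x hx => hmem ⟨x, hx⟩,
    ext_of_apply (fun x => (hz.1 x).symm) fun x hx hx' => ?_⟩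
  have hx₁ : z.φ (x.1, 0) = 0 := by rw [hz.1]; exact map_zero f
  have hx₂ : z.φ (0, x.2) = 0 := hmem ⟨x.2, hx⟩
  have hsum : (⟨x, hx'⟩ : LinearMap.ker z.φ) = ⟨(x.1, 0), hx₁⟩ + ⟨(0, x.2), hx₂⟩ :=
    Subtype.ext (by simp)
  calc _ = x.1 + z.ψ ⟨(0, x.2), hx₂⟩ := pushoutPair_ψ_apply f hf _ ⟨x, hx⟩
    _ = z.ψ ⟨(x.1, 0), hx₁⟩ + z.ψ ⟨(0, x.2), hx₂⟩ := congrArg (· + _) (hz.2 x.1 hx₁).symm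
    _ = z.ψ ⟨x, hx'⟩ := by rw [hsum, map_add]

/-- The pairs of surjections out of `K × F` that are split along `f` are the homomorphisms
`ker f → K`. -/
noncomputable def pushoutPairEquiv :
    (LinearMap.ker f →ₗ[R] K) ≃ {z : SurPair R (K × F) K G // z.IsSplit f} :=
  Equiv.ofBijective (fun α => ⟨pushoutPair f hf α, isSplit_pushoutPair f hf α⟩)
    ⟨fun _ _ h => pushoutPair_injective f hf (congrArg Subtype.val h), fun ⟨_, hz⟩ =>
      (hz.exists_pushoutPair_eq f hf).imp fun _ => Subtype.ext⟩

theorem isSplit_pullback_iff (s : ShortExactSeq R K E G) {χ : K × F →ₗ[R] E}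
    (hχ : Function.Surjective χ) : (s.pullback χ hχ).IsSplit f ↔
      χ ∘ₗ LinearMap.inl R K F = s.inc ∧ s.proj ∘ₗ χ ∘ₗ LinearMap.inr R K F = f := by
  constructor
  · rintro ⟨hφ, hψ⟩
    refine ⟨LinearMap.ext fun k => ?_, LinearMap.ext fun x => hφ (0, x)⟩
    have hk : (s.pullback χ hχ).φ (k, 0) = 0 := (hφ _).trans (map_zero f)
    exact (s.inc_pullback_ψ hχ ⟨(k, 0), hk⟩).symm.trans (congrArg s.inc (hψ k hk))
  · rintro ⟨hinl, hinr⟩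
    have hχk (k : K) : χ (k, 0) = s.inc k := LinearMap.congr_fun hinl k
    refine ⟨fun x => ?_, fun k hk => s.inc_injective ?_⟩
    · have hx : χ x = s.inc x.1 + χ (0, x.2) := by rw [← hχk, ← map_add]; simp
      have hproj : s.proj (χ x) = s.proj (χ (0, x.2)) := by
        rw [hx, map_add, s.proj_inc, zero_add]
      exact hproj.trans (LinearMap.congr_fun hinr x.2)
    · rw [s.inc_pullback_ψ, hχk]

theorem ShortExactSeq.coprod_surjective (s : ShortExactSeq R K E G) {g : F →ₗ[R] E}
    (hg : Function.Surjective (s.proj ∘ₗ g)) : Function.Surjective (s.inc.coprod g) := by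
  intro e
  obtain ⟨x, hx⟩ := hg (s.proj e)
  obtain ⟨k, hk⟩ := (s.exact (e - g x)).1 (by rw [map_sub, sub_eq_zero]; exact hx.symm)
  exact ⟨(k, x), by rw [LinearMap.coprod_apply, hk, sub_add_cancel]⟩

/-- A surjection `K × F → E` whose pullback is split along `f` is a short exact sequence with a
lift of `f`. -/
noncomputable def splitPullbackEquiv :
    {x : {χ : K × F →ₗ[R] E // Function.Surjective χ} × ShortExactSeq R K E G //
      (x.2.pullback x.1.1 x.1.2).IsSplit f} ≃
    Σ s : ShortExactSeq R K E G, {g : F →ₗ[R] E // s.proj ∘ₗ g = f} where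
  toFun x := ⟨x.1.2, x.1.1.1 ∘ₗ LinearMap.inr R K F, ((isSplit_pullback_iff f _ _).1 x.2).2⟩
  invFun x := ⟨⟨⟨x.1.inc.coprod x.2.1, x.1.coprod_surjective (by rwa [x.2.2])⟩, x.1⟩,
    (isSplit_pullback_iff f _ _).2 ⟨LinearMap.coprod_inl _ _, by
      rw [LinearMap.coprod_inr, x.2.2]⟩⟩
  left_inv x := by
    refine Subtype.ext (Prod.ext (Subtype.ext (LinearMap.prod_ext ?_ ?_)) rfl)
    · exact (LinearMap.coprod_inl _ _).trans ((isSplit_pullback_iff f _ _).1 x.2).1.symm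
    · exact LinearMap.coprod_inr _ _
  right_inv x := Sigma.ext rfl (heq_of_eq (Subtype.ext (LinearMap.coprod_inr _ _)))

-- An extension with a lift of `f : Rᵈ → G` is a homomorphism `ker f → K`, of which there are
-- `|K|ᵈ`, and each extension has `|K|ᵈ` lifts.
theorem IsDedekindLike.tsum_seqCount_div_autCount_eq_one (hR : IsDedekindLike R)
    (K G : FiniteModule R) :
    ∑' E : IsoClass R, (seqCount K E.out G : ℝ≥0∞) / autCount E.out = 1 := by
  obtain ⟨d, f, hf⟩ := Module.Finite.exists_fin' R G
  have hcard_ker : Nat.card (LinearMap.ker f →ₗ[R] K) = Nat.card K ^ d := hR.card_hom_ker_pi f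
  have hpos : Nat.card K ^ d ≠ 0 := pow_ne_zero _ Nat.card_pos.ne'
  have : Finite (LinearMap.ker f →ₗ[R] K) := Nat.finite_of_card_ne_zero (hcard_ker ▸ hpos)
  have : Finite {z : SurPair R (K × (Fin d → R)) K G // z.IsSplit f} :=
    Finite.of_equiv _ (pushoutPairEquiv f hf)
  have hmass := tsum_card_pullback_div_autCount
    (SurPair.IsSplit f : SurPair R (K × (Fin d → R)) K G → Prop)
  have hcard_lift (E : IsoClass R) : Nat.card (Σ s : ShortExactSeq R K E.out G,
      {g : (Fin d → R) →ₗ[R] E.out // s.proj ∘ₗ g = f}) = seqCount K E.out G * Nat.card K ^ d := by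
    have e := Equiv.sigmaCongrRight fun s : ShortExactSeq R K E.out G =>
      (s.nonempty_lift_equiv f).some
    rw [← Nat.card_congr e, Nat.card_congr (Equiv.sigmaEquivProd _ _), Nat.card_prod, card_hom_pi,
      seqCount]
  simp_rw [Nat.card_congr (splitPullbackEquiv f hf), hcard_lift,
    ← Nat.card_congr (pushoutPairEquiv f hf), hcard_ker, Nat.cast_mul, mul_comm, mul_div_assoc,
    ENNReal.tsum_mul_left] at hmass
  exact (ENNReal.mul_eq_left (by exact_mod_cast hpos) (ENNReal.natCast_ne_top _)).1 hmass

end Moments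

section HomFree

variable {R : Type u} [Ring R]

variable (R) in
/-- The isomorphism classes of finite simple modules. -/
def SimpleClass : Type (max 1 u) := {E : IsoClass R // IsSimpleModule R E.out}

/-- A representative of an isomorphism class of finite simple modules. -/
noncomputable def SimpleClass.out (K : SimpleClass R) : FiniteModule R := IsoClass.out K.1

instance (K : SimpleClass R) : IsSimpleModule R K.out := K.2

theorem SimpleClass.not_nonempty_linearEquiv {K L : SimpleClass R} (h : K ≠ L) :
    ¬ Nonempty (K.out ≃ₗ[R] L.out) := fun hKL =>
  h (Subtype.ext ((IsoClass.iso_out_iff.1 hKL).trans (IsoClass.toClass_out L.1)))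

theorem SimpleClass.annihilator_ne {K L : SimpleClass R} (h : K ≠ L) :
    Module.annihilator R K.out ≠ Module.annihilator R L.out := fun hKL =>
  not_nonempty_linearEquiv h (nonempty_linearEquiv_of_annihilator_le hKL.le)

theorem exists_simpleClass (M : Type v) [AddCommGroup M] [Module R M] [Finite M]
    [IsSimpleModule R M] : ∃ K : SimpleClass R, Nonempty (K.out ≃ₗ[R] M) := by
  obtain ⟨e⟩ := (FiniteModule.ofFinite (R := R) M).iso_out
  have e' := e.trans (FiniteModule.ofFiniteEquiv (R := R) M)
  exact ⟨⟨_, IsSimpleModule.congr e'⟩, ⟨e'⟩⟩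

variable {T : Set (SimpleClass R)} {M N G : Type*} [AddCommGroup M] [Module R M] [AddCommGroup N]
  [Module R N] [AddCommGroup G] [Module R G]

/-- `M` has no nonzero homomorphism to a simple module in `T`. -/
def HomFree (T : Set (SimpleClass R)) (M : Type*) [AddCommGroup M] [Module R M] : Prop :=
  ∀ K ∈ T, ∀ f : M →ₗ[R] K.out, f = 0

theorem homFree_insert {L : SimpleClass R} :
    HomFree (insert L T) M ↔ (∀ f : M →ₗ[R] L.out, f = 0) ∧ HomFree T M :=
  Set.forall_mem_insert

theorem HomFree.congr (h : HomFree T M) (e : M ≃ₗ[R] N) : HomFree T N := fun K hK f =>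
  (LinearMap.cancel_right e.surjective).1 (h K hK (f ∘ₗ e.toLinearMap))

theorem homFree_congr (e : M ≃ₗ[R] N) : HomFree T M ↔ HomFree T N :=
  ⟨fun h => h.congr e, fun h => h.congr e.symm⟩

theorem HomFree.ker (h : HomFree T M) (hR : IsDedekindLike R) {L : SimpleClass R} (hL : L ∉ T)
    (hG : Module.annihilator R L.out ≤ Module.annihilator R G) (ψ : M →ₗ[R] G) :
    HomFree T (LinearMap.ker ψ) := by
  intro K hK α
  have hmem : ∀ b ∈ Module.annihilator R L.out, ∀ m : M, b • m ∈ LinearMap.ker ψ := fun b hb m => by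
    rw [LinearMap.mem_ker, map_smul]
    exact Module.mem_annihilator.1 (hG hb) _
  obtain ⟨β, hβ⟩ := hR.exists_extension (isFinitePrimitive_annihilator K.out)
    (isFinitePrimitive_annihilator L.out) (SimpleClass.annihilator_ne (ne_of_mem_of_not_mem hK hL))
    hmem le_rfl α
  rw [← hβ, h K hK β, LinearMap.zero_comp]

theorem HomFree.of_ker (ψ : M →ₗ[R] G) (hψ : Function.Surjective ψ)
    (h : HomFree T (LinearMap.ker ψ)) (hG : HomFree T G) : HomFree T M := by
  intro K hK β
  obtain ⟨γ, rfl⟩ := exists_comp_eq_of_ker_le ψ hψ β fun x hx =>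
    LinearMap.congr_fun (h K hK (β ∘ₗ (LinearMap.ker ψ).subtype)) ⟨x, hx⟩
  rw [hG K hK γ, LinearMap.zero_comp]

/-- The powers `K ^ j` of a finite module `K`. -/
def FiniteModule.pow (K : FiniteModule R) : ℕ → FiniteModule R
  | 0 => { carrier := PUnit }
  | j + 1 => { carrier := K × K.pow j }

instance (K : FiniteModule R) : Unique (K.pow 0) := inferInstanceAs (Unique PUnit)

theorem homFree_pow {L : SimpleClass R} (hL : L ∉ T) (j : ℕ) : HomFree T (L.out.pow j) := by
  induction j with
  | zero => exact fun _ _ f => Subsingleton.elim f 0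
  | succ j ih =>
    intro K hK f
    have hLK : ¬ Nonempty (L.out ≃ₗ[R] K.out) :=
      SimpleClass.not_nonempty_linearEquiv (ne_of_mem_of_not_mem hK hL).symm
    exact LinearMap.prod_ext (M := L.out) (M₂ := L.out.pow j) (f := f) (g := 0)
      ((linearMap_eq_zero_of_isEmpty_linearEquiv hLK _).trans (LinearMap.zero_comp _).symm)
      ((ih K hK _).trans (LinearMap.zero_comp _).symm)

theorem annihilator_le_annihilator_pow (L : FiniteModule R) (j : ℕ) :
    Module.annihilator R L ≤ Module.annihilator R (L.pow j) := fun r hr =>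
  Module.mem_annihilator.2 fun x => by
    induction j with
    | zero => exact Subsingleton.elim _ _
    | succ j ih => exact Prod.ext (Module.mem_annihilator.1 hr x.1) (ih x.2)

theorem card_hom_pow (L : FiniteModule R) (j : ℕ) :
    Nat.card (L.pow j →ₗ[R] L) = Nat.card (L →ₗ[R] L) ^ j := by
  induction j with
  | zero => rw [pow_zero, Nat.card_unique]
  | succ j ih =>
    rw [pow_succ', ← ih]
    exact card_hom_prod L (L.pow j) L

theorem autCount_le_surCount {H K : FiniteModule R} (f : H →ₗ[R] K) (hf : Function.Surjective f) :
    autCount K ≤ surCount H K := by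
  refine Nat.card_le_card_of_injective (fun a : K ≃ₗ[R] K =>
    (⟨a ∘ₗ f, a.surjective.comp hf⟩ : {f : H →ₗ[R] K // Function.Surjective f})) fun a b h => ?_
  exact LinearEquiv.toLinearMap_injective ((LinearMap.cancel_right hf).1 (congrArg Subtype.val h))

theorem one_le_surCount_div_autCount {H K : FiniteModule R} (f : H →ₗ[R] K)
    (hf : Function.Surjective f) : (1 : ℝ≥0∞) ≤ surCount H K / autCount K := by
  rw [ENNReal.le_div_iff_mul_le (Or.inl (autCount_ne_zero _))
    (Or.inl (ENNReal.natCast_ne_top _)), one_mul]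
  exact_mod_cast autCount_le_surCount f hf

end HomFree

section PowerSurjections

variable {R : Type u} [Ring R] {M K : Type*} [AddCommGroup M] [Module R M] [AddCommGroup K]
  [Module R K] {L : Type*} [AddCommGroup L] [Module R L]

theorem card_surjection_ker_le :
    Nat.card {x : {ψ : M →ₗ[R] L // Function.Surjective ψ} × (M →ₗ[R] K) //
      LinearMap.ker x.1.1 ≤ LinearMap.ker x.2} =
    Nat.card {ψ : M →ₗ[R] L // Function.Surjective ψ} * Nat.card (L →ₗ[R] K) := by
  rw [← Nat.card_prod]
  symm
  refine Nat.card_congr (Equiv.ofBijective (fun y => ⟨(y.1, y.2 ∘ₗ y.1.1),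
    LinearMap.ker_le_ker_comp _ _⟩) ⟨?_, ?_⟩)
  · rintro ⟨ψ, a⟩ ⟨ψ', a'⟩ h
    obtain ⟨rfl, ha⟩ := Prod.ext_iff.1 (congrArg Subtype.val h)
    exact Prod.ext rfl ((LinearMap.cancel_right ψ.2).1 ha)
  · rintro ⟨⟨ψ, α⟩, h⟩
    obtain ⟨a, rfl⟩ := exists_comp_eq_of_ker_le ψ.1 ψ.2 α h
    exact ⟨(ψ, a), rfl⟩

variable [IsSimpleModule R K]

theorem surjective_prod_iff_not_ker_le {ψ : M →ₗ[R] L} (hψ : Function.Surjective ψ)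
    (α : M →ₗ[R] K) :
    Function.Surjective (α.prod ψ) ↔ ¬ LinearMap.ker ψ ≤ LinearMap.ker α := by
  constructor
  · intro hs h
    have := IsSimpleModule.nontrivial R K
    obtain ⟨k, hk⟩ := exists_ne (0 : K)
    obtain ⟨m, hm⟩ := hs (k, 0)
    exact hk ((congrArg Prod.fst hm).symm.trans (h (congrArg Prod.snd hm)))
  · intro h
    have hne : α ∘ₗ (LinearMap.ker ψ).subtype ≠ 0 := fun h0 =>
      h fun m hm => LinearMap.congr_fun h0 ⟨m, hm⟩
    rintro ⟨k, l⟩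
    obtain ⟨m, rfl⟩ := hψ l
    obtain ⟨m', hm' : α m' = k - α m⟩ := LinearMap.surjective_of_ne_zero hne (k - α m)
    refine ⟨m + m', Prod.ext ?_ ?_⟩
    · exact (map_add α m m').trans (by rw [hm', add_sub_cancel])
    · exact (map_add ψ m m').trans (by rw [LinearMap.mem_ker.1 m'.2, add_zero])

/-- The surjections onto `K × L` are the surjections `ψ` onto `L` together with a homomorphism to
`K` that does not vanish on the kernel of `ψ`. -/
def surjectionProdEquiv :
    {f : M →ₗ[R] K × L // Function.Surjective f} ≃
      {x : {ψ : M →ₗ[R] L // Function.Surjective ψ} × (M →ₗ[R] K) //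
        ¬ LinearMap.ker x.1.1 ≤ LinearMap.ker x.2} where
  toFun f := ⟨(⟨LinearMap.snd R K L ∘ₗ f.1, Prod.snd_surjective.comp f.2⟩,
    LinearMap.fst R K L ∘ₗ f.1), (surjective_prod_iff_not_ker_le
      (Prod.snd_surjective.comp f.2) _).1 f.2⟩
  invFun x := ⟨x.1.2.prod x.1.1.1, (surjective_prod_iff_not_ker_le x.1.1.2 _).2 x.2⟩

/-- The number of surjections from a module to a finite module. -/
noncomputable def surCountTo (M : Type*) [AddCommGroup M] [Module R M] (G : FiniteModule R) : ℕ :=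
  Nat.card {f : M →ₗ[R] G // Function.Surjective f}

theorem surCountTo_pow_zero (M : Type*) [AddCommGroup M] [Module R M] (K : FiniteModule R) :
    surCountTo M (K.pow 0) = 1 := by
  have : Unique {f : M →ₗ[R] K.pow 0 // Function.Surjective f} :=
    { default := ⟨0, fun x => ⟨0, Subsingleton.elim _ _⟩⟩
      uniq := fun f => Subtype.ext (LinearMap.ext fun x => Subsingleton.elim _ _) }
  exact Nat.card_unique

variable (M : Type*) [AddCommGroup M] [Module R M] [Finite M] (K : FiniteModule R)
  [IsSimpleModule R K] (j : ℕ)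

theorem surCountTo_pow_succ_add :
    surCountTo M (K.pow (j + 1)) + surCountTo M (K.pow j) * Nat.card (K →ₗ[R] K) ^ j =
      surCountTo M (K.pow j) * Nat.card (M →ₗ[R] K) := by
  classical
  let vanishes (x : {ψ : M →ₗ[R] K.pow j // Function.Surjective ψ} × (M →ₗ[R] K)) : Prop :=
    LinearMap.ker x.1.1 ≤ LinearMap.ker x.2
  calc surCountTo M (K.pow (j + 1)) + surCountTo M (K.pow j) * Nat.card (K →ₗ[R] K) ^ j
      = Nat.card {x // ¬ vanishes x} + Nat.card {x // vanishes x} := by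
        rw [card_surjection_ker_le, card_hom_pow]
        exact congrArg (· + _) (Nat.card_congr (surjectionProdEquiv (L := K.pow j)))
    _ = surCountTo M (K.pow j) * Nat.card (M →ₗ[R] K) := by
        rw [add_comm, ← Nat.card_sum, Nat.card_congr (Equiv.sumCompl vanishes), Nat.card_prod]
        rfl

theorem surCountTo_pow_eq_prod : (surCountTo M (K.pow j) : ℝ) = ∏ i ∈ Finset.range j,
    ((Nat.card (M →ₗ[R] K) : ℝ) - (Nat.card (K →ₗ[R] K) : ℝ) ^ i) := by
  induction j with
  | zero => simp [surCountTo_pow_zero]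
  | succ j ih =>
    rw [Finset.prod_range_succ, ← ih, mul_sub, eq_sub_iff_add_eq]
    exact_mod_cast surCountTo_pow_succ_add M K j

theorem two_le_card_end : (2 : ℝ) ≤ Nat.card (K →ₗ[R] K) := by
  have := IsSimpleModule.nontrivial R K
  exact_mod_cast Finite.one_lt_card (α := K →ₗ[R] K)

end PowerSurjections

section Weights

variable {R : Type u} [Ring R]

/-- Positive finite functions of finite modules that are multiplicative in short exact
sequences. -/
structure IsWeight (c : FiniteModule R → ℝ≥0∞) : Prop where
  mul : ∀ {K E G : FiniteModule R}, ShortExactSeq R K E G → c E = c K * c G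
  ne_zero : ∀ G, c G ≠ 0
  ne_top : ∀ G, c G ≠ ⊤

/-- The mass of an isomorphism class of finite modules with respect to the weight `c`, that is, the
unnormalized probability of this class. -/
noncomputable def mass (c : FiniteModule R → ℝ≥0∞) (E : IsoClass R) : ℝ≥0∞ :=
  c E.out / autCount E.out

namespace IsWeight

variable {c : FiniteModule R → ℝ≥0∞}

theorem mass_ne_zero (hc : IsWeight c) (E : IsoClass R) : mass c E ≠ 0 :=
  ENNReal.div_ne_zero.2 ⟨hc.ne_zero _, ENNReal.natCast_ne_top _⟩

theorem mass_ne_top (hc : IsWeight c) (E : IsoClass R) : mass c E ≠ ⊤ :=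
  ENNReal.div_ne_top (hc.ne_top _) (autCount_ne_zero _)

theorem mass_mul_seqCount_div (hc : IsWeight c) (H K : IsoClass R) (G : FiniteModule R) :
    mass c H * ((seqCount K.out H.out G : ℝ≥0∞) / autCount K.out) =
      c G * (mass c K * ((seqCount K.out H.out G : ℝ≥0∞) / autCount H.out)) := by
  rcases isEmpty_or_nonempty (ShortExactSeq R K.out H.out G) with h | ⟨⟨s⟩⟩
  · simp [seqCount]
  · simp only [mass, hc.mul s, div_eq_mul_inv]
    ring

theorem tsum_indicator_mul_surCount_le (hc : IsWeight c) (hR : IsDedekindLike R)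
    (G : FiniteModule R) {D : Set (IsoClass R)}
    (hD : ∀ K H : IsoClass R, H ∈ D → ShortExactSeq R K.out H.out G → K ∈ D) :
    ∑' H : IsoClass R, D.indicator (mass c) H * surCount H.out G ≤
      c G * ∑' K, D.indicator (mass c) K := by
  have hterm (H K : IsoClass R) :
      D.indicator (mass c) H * ((seqCount K.out H.out G : ℝ≥0∞) / autCount K.out) ≤
      c G * (D.indicator (mass c) K * ((seqCount K.out H.out G : ℝ≥0∞) / autCount H.out)) := by
    by_cases hH : H ∈ D
    · rcases isEmpty_or_nonempty (ShortExactSeq R K.out H.out G) with h | ⟨⟨s⟩⟩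
      · simp [seqCount]
      · rw [Set.indicator_of_mem hH, Set.indicator_of_mem (hD K H hH s), hc.mass_mul_seqCount_div]
    · simp [Set.indicator_of_notMem hH]
  calc ∑' H : IsoClass R, D.indicator (mass c) H * surCount H.out G
      = ∑' (H : IsoClass R) (K : IsoClass R),
          D.indicator (mass c) H * ((seqCount K.out H.out G : ℝ≥0∞) / autCount K.out) := by
        simp_rw [← tsum_seqCount_div_autCount, ENNReal.tsum_mul_left]
    _ ≤ ∑' (H : IsoClass R) (K : IsoClass R), c G * (D.indicator (mass c) K *
          ((seqCount K.out H.out G : ℝ≥0∞) / autCount H.out)) :=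
        ENNReal.tsum_le_tsum fun H => ENNReal.tsum_le_tsum (hterm H)
    _ = c G * ∑' K, D.indicator (mass c) K := by
        rw [ENNReal.tsum_comm]
        simp_rw [ENNReal.tsum_mul_left, hR.tsum_seqCount_div_autCount_eq_one, mul_one]

theorem tsum_mass_mul_surCount (hc : IsWeight c) (hR : IsDedekindLike R) (G : FiniteModule R) :
    ∑' H : IsoClass R, mass c H * surCount H.out G = c G * ∑' K, mass c K := by
  simp_rw [← tsum_seqCount_div_autCount, ← ENNReal.tsum_mul_left, hc.mass_mul_seqCount_div]
  rw [ENNReal.tsum_comm]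
  simp_rw [ENNReal.tsum_mul_left, hR.tsum_seqCount_div_autCount_eq_one, mul_one]

end IsWeight

end Weights

section SimpleModuleCount

variable {R : Type u} [Ring R]

theorem exists_prime_nsmul_eq_zero (R K : Type*) [Ring R] [AddCommGroup K] [Module R K] [Finite K]
    [IsSimpleModule R K] : ∃ p : ℕ, p.Prime ∧ ∀ x : K, p • x = 0 := by
  have := IsSimpleModule.nontrivial R K
  obtain ⟨p, hp, hdvd⟩ := Nat.exists_prime_and_dvd (Finite.one_lt_card (α := K)).ne'
  have := Fact.mk hp
  obtain ⟨x, hx⟩ := exists_prime_addOrderOf_dvd_card' p hdvd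
  have hx0 : x ≠ 0 := fun h => hp.ne_one (by rw [← hx, h, addOrderOf_zero])
  have hpx : (p • LinearMap.id : K →ₗ[R] K) x = 0 := by
    rw [← hx]
    exact addOrderOf_nsmul_eq_zero x
  have hzero : (p • LinearMap.id : K →ₗ[R] K) = 0 :=
    (LinearMap.injective_or_eq_zero _).resolve_left fun h => hx0 (h (hpx.trans (map_zero _).symm))
  exact ⟨p, hp, LinearMap.congr_fun hzero⟩

namespace SimpleClass

/-- The residue characteristic of a finite simple module. -/
noncomputable def char (K : SimpleClass R) : ℕ := (exists_prime_nsmul_eq_zero R K.out).choose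

theorem prime_char (K : SimpleClass R) : K.char.Prime :=
  (exists_prime_nsmul_eq_zero R K.out).choose_spec.1

theorem char_nsmul (K : SimpleClass R) (x : K.out) : K.char • x = 0 :=
  (exists_prime_nsmul_eq_zero R K.out).choose_spec.2 x

theorem exists_addOrderOf_eq_char (K : SimpleClass R) : ∃ x : K.out, addOrderOf x = K.char := by
  have := IsSimpleModule.nontrivial R K.out
  obtain ⟨x, hx⟩ := exists_ne (0 : K.out)
  exact ⟨x, addOrderOf_eq_prime (K.char_nsmul x) hx (hp := ⟨K.prime_char⟩)⟩

theorem char_le_card (K : SimpleClass R) : K.char ≤ Nat.card K.out := by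
  obtain ⟨x, hx⟩ := K.exists_addOrderOf_eq_char
  exact hx ▸ addOrderOf_le_card

theorem char_sub_one_le_autCount (K : SimpleClass R) : K.char - 1 ≤ autCount K.out := by
  obtain ⟨x, hx⟩ := K.exists_addOrderOf_eq_char
  -- The multiplications by `1, …, char - 1` are distinct automorphisms.
  have hne : ∀ i : Fin (K.char - 1), ((i : ℕ) + 1) • (LinearMap.id : K.out →ₗ[R] K.out) ≠ 0 := by
    intro i h
    have hdvd : addOrderOf x ∣ i + 1 := addOrderOf_dvd_of_nsmul_eq_zero (LinearMap.congr_fun h x)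
    have := Nat.le_of_dvd (Nat.succ_pos _) hdvd
    omega
  let multiplication : Fin (K.char - 1) → (K.out ≃ₗ[R] K.out) := fun i =>
    LinearEquiv.ofBijective _ (LinearMap.bijective_of_ne_zero (hne i))
  have hinj : Function.Injective multiplication := by
    intro i j hij
    have h := nsmul_injOn_Iio_addOrderOf (x := x) (x₁ := (i : ℕ) + 1) (x₂ := (j : ℕ) + 1)
      (by simp only [Set.mem_Iio]; omega) (by simp only [Set.mem_Iio]; omega)
      (LinearEquiv.congr_fun hij x)
    exact Fin.ext (Nat.succ_injective h)
  simpa [autCount] using Nat.card_le_card_of_injective multiplication hinj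

theorem exists_mem_annihilator_one_sub_mem (L : SimpleClass R) (s : Finset (SimpleClass R))
    (hL : L ∉ s) : ∃ a : R, (∀ K ∈ s, a ∈ Module.annihilator R K.out) ∧
      1 - a ∈ Module.annihilator R L.out := by
  classical
  induction s using Finset.induction_on with
  | empty => exact ⟨1, by simp, by simp⟩
  | insert K s _ ih =>
    simp only [Finset.mem_insert, not_or] at hL
    obtain ⟨a, ha, ha'⟩ := ih hL.2
    obtain ⟨b, hb, hb'⟩ := (isFinitePrimitive_annihilator L.out).exists_mem_one_sub_mem
      (isFinitePrimitive_annihilator K.out) (annihilator_ne hL.1)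
    refine ⟨a * b, ?_, ?_⟩
    · simp only [Finset.mem_insert, forall_eq_or_imp]
      exact ⟨Ideal.mul_mem_left _ _ hb, fun K' hK' => Ideal.mul_mem_right _ _ (ha K' hK')⟩
    · rw [show 1 - a * b = (1 - a) + a * (1 - b) by noncomm_ring]
      exact Ideal.add_mem _ ha' (Ideal.mul_mem_left _ _ hb')

theorem surjective_pi_toSpanSingleton (s : Finset (SimpleClass R)) (x : ∀ K : s, K.1.out)
    (hx : ∀ K, x K ≠ 0) : Function.Surjective
      (LinearMap.pi fun K : s => LinearMap.toSpanSingleton R K.1.out (x K)) := by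
  classical
  intro y
  choose r hr using fun K : s => IsSimpleModule.toSpanSingleton_surjective R (hx K) (y K)
  choose a ha ha' using fun K : s =>
    exists_mem_annihilator_one_sub_mem K.1 (s.erase K.1) (by simp)
  have hself (K : s) : a K • x K = x K := by
    have h := Module.mem_annihilator.1 (ha' K) (x K)
    rwa [sub_smul, one_smul, sub_eq_zero, eq_comm] at h
  have hother (K L : s) (h : L ≠ K) : a L • x K = 0 :=
    Module.mem_annihilator.1 (ha L K.1 (Finset.mem_erase.2
      ⟨fun hKL => h (Subtype.ext hKL.symm), K.2⟩)) (x K)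
  refine ⟨∑ L : s, r L * a L, funext fun K => ?_⟩
  rw [LinearMap.pi_apply, LinearMap.toSpanSingleton_apply, Finset.sum_smul,
    Finset.sum_eq_single K _ (by simp)]
  · rw [mul_smul, hself, ← hr K, LinearMap.toSpanSingleton_apply]
  · intro L _ hLK
    rw [mul_smul, hother K L hLK, smul_zero]

theorem card_le_of_char_eq {g p : ℕ} (hp : p.Prime) [Finite (R ⧸ Ideal.span {(p : R)})]
    (hg : Nat.card (R ⧸ Ideal.span {(p : R)}) ≤ p ^ g) (s : Finset (SimpleClass R))
    (hs : ∀ K ∈ s, K.char = p) : s.card ≤ g := by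
  have hne (K : s) : ∃ x : K.1.out, x ≠ 0 :=
    have := IsSimpleModule.nontrivial R K.1.out
    exists_ne 0
  choose x hx using hne
  have hker : Ideal.span {(p : R)} ≤
      LinearMap.ker (LinearMap.pi fun K : s => LinearMap.toSpanSingleton R K.1.out (x K)) := by
    rw [Ideal.span_singleton_le_iff_mem, LinearMap.mem_ker]
    refine funext fun K => ?_
    rw [LinearMap.pi_apply, LinearMap.toSpanSingleton_apply, Nat.cast_smul_eq_nsmul, ← hs K.1 K.2,
      char_nsmul, Pi.zero_apply]
  have hsurj := surjective_pi_toSpanSingleton s x hx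
  refine (Nat.pow_le_pow_iff_right hp.one_lt).1 ?_
  calc p ^ s.card ≤ ∏ K : s, Nat.card K.1.out := by
        rw [← Fintype.card_coe, ← Finset.card_univ, ← Finset.prod_const]
        exact Finset.prod_le_prod' fun K _ => hs K.1 K.2 ▸ K.1.char_le_card
    _ = Nat.card (∀ K : s, K.1.out) := Nat.card_pi.symm
    _ ≤ Nat.card (R ⧸ Ideal.span {(p : R)}) :=
        Nat.card_le_card_of_surjective (Submodule.liftQ _ _ hker) fun y =>
          (hsurj y).imp' Submodule.Quotient.mk fun _ => id
    _ ≤ p ^ g := hg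

end SimpleClass

end SimpleModuleCount

section SimpleMasses

variable {R : Type u} [Ring R] {c : FiniteModule R → ℝ≥0∞}

/-- The weight of simple modules decays like a negative power of their order. -/
def HasDecay (c : FiniteModule R → ℝ≥0∞) : Prop :=
  ∃ ε : ℝ, 0 < ε ∧ ∀ K : FiniteModule R, IsSimpleModule R K →
    c K ≤ ENNReal.ofReal ((Nat.card K : ℝ) ^ (-ε))

theorem HasDecay.mass_lt_one (hc : HasDecay c) (K : SimpleClass R) : mass c K.1 < 1 := by
  obtain ⟨ε, hε, h⟩ := hc
  have := IsSimpleModule.nontrivial R K.out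
  have hcard : (1 : ℝ) < Nat.card K.out := by exact_mod_cast Finite.one_lt_card (α := K.out)
  calc mass c K.1 ≤ c K.out := ENNReal.div_le_of_le_mul
        (le_mul_of_one_le_right' (by exact_mod_cast autCount_pos K.out))
    _ ≤ ENNReal.ofReal ((Nat.card K.out : ℝ) ^ (-ε)) := h K.out K.2
    _ < 1 := ENNReal.ofReal_lt_one.2
        (Real.rpow_lt_one_of_one_lt_of_neg hcard (neg_lt_zero.2 hε))

theorem SimpleClass.char_le_two_mul_autCount (K : SimpleClass R) :
    K.char ≤ 2 * autCount K.out := by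
  have := K.char_sub_one_le_autCount
  have := autCount_pos K.out
  omega

theorem mass_le_of_le_rpow {ε : ℝ} (hε : 0 < ε) {K : SimpleClass R}
    (h : c K.out ≤ ENNReal.ofReal ((Nat.card K.out : ℝ) ^ (-ε))) :
    mass c K.1 ≤ ENNReal.ofReal (2 * (K.char : ℝ) ^ (-(1 + ε))) := by
  have hp0 : (0 : ℝ) < K.char := by exact_mod_cast K.prime_char.pos
  have hrpow : (K.char : ℝ) ^ (-ε) = (K.char : ℝ) ^ (-(1 + ε)) * K.char := by
    rw [← Real.rpow_add_one hp0.ne']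
    ring_nf
  have haut : (K.char : ℝ) ≤ 2 * autCount K.out := by exact_mod_cast K.char_le_two_mul_autCount
  refine ENNReal.div_le_of_le_mul (h.trans ?_)
  rw [← ENNReal.ofReal_natCast, ← ENNReal.ofReal_mul (by positivity)]
  refine ENNReal.ofReal_le_ofReal ?_
  calc (Nat.card K.out : ℝ) ^ (-ε) ≤ (K.char : ℝ) ^ (-ε) :=
        Real.rpow_le_rpow_of_nonpos hp0 (by exact_mod_cast K.char_le_card) (by linarith)
    _ ≤ (K.char : ℝ) ^ (-(1 + ε)) * (2 * autCount K.out) := by rw [hrpow]; gcongr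
    _ = 2 * (K.char : ℝ) ^ (-(1 + ε)) * autCount K.out := by ring

theorem IsArithmeticRing.exists_tsum_char_le (hR : IsArithmeticRing R) :
    ∃ g : ℕ, ∀ f : ℕ → ℝ≥0∞, ∑' K : SimpleClass R, f K.char ≤ g * ∑' n, f n := by
  classical
  obtain ⟨g, hg⟩ := hR.exists_card_quotient_le
  refine ⟨g, fun f => ?_⟩
  rw [ENNReal.tsum_eq_iSup_sum]
  refine iSup_le fun s => ?_
  have hfiber : ∀ n ∈ s.image SimpleClass.char, {K ∈ s | K.char = n}.card ≤ g := fun n hn => by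
    obtain ⟨K, -, rfl⟩ := Finset.mem_image.1 hn
    obtain ⟨_, hcard⟩ := hg _ K.prime_char.ne_zero
    exact SimpleClass.card_le_of_char_eq K.prime_char hcard _ fun L hL => (Finset.mem_filter.1 hL).2
  calc ∑ K ∈ s, f K.char
      = ∑ n ∈ s.image SimpleClass.char, {K ∈ s | K.char = n}.card • f n :=
        Finset.sum_comp f SimpleClass.char
    _ ≤ ∑ n ∈ s.image SimpleClass.char, g * f n := Finset.sum_le_sum fun n hn => by
        rw [nsmul_eq_mul]
        gcongr
        exact_mod_cast hfiber n hn
    _ = g * ∑ n ∈ s.image SimpleClass.char, f n := (Finset.mul_sum _ _ _).symm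
    _ ≤ g * ∑' n, f n := by gcongr; exact ENNReal.sum_le_tsum _

theorem HasDecay.tsum_mass_simpleClass_ne_top (hc : HasDecay c) (hR : IsArithmeticRing R) :
    ∑' K : SimpleClass R, mass c K.1 ≠ ⊤ := by
  obtain ⟨ε, hε, h⟩ := hc
  obtain ⟨g, hg⟩ := hR.exists_tsum_char_le
  have hsum : Summable fun n : ℕ => 2 * (n : ℝ) ^ (-(1 + ε)) :=
    (Real.summable_nat_rpow.2 (by linarith)).mul_left 2
  have hle : ∑' K : SimpleClass R, mass c K.1 ≤
      g * ∑' n : ℕ, ENNReal.ofReal (2 * (n : ℝ) ^ (-(1 + ε))) :=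
    (ENNReal.tsum_le_tsum fun K : SimpleClass R => mass_le_of_le_rpow hε (h K.out K.2)).trans
      (hg fun n => ENNReal.ofReal (2 * (n : ℝ) ^ (-(1 + ε))))
  exact ne_top_of_le_ne_top
    (ENNReal.mul_ne_top (ENNReal.natCast_ne_top g) hsum.tsum_ofReal_ne_top) hle

end SimpleMasses

section Convergence

variable {R : Type u} [Ring R] {c : FiniteModule R → ℝ≥0∞}

/-- Sets of isomorphism classes that are closed under submodules. -/
def IsSubmoduleClosed (D : Set (IsoClass R)) : Prop :=
  ∀ K E : IsoClass R, E ∈ D → ∀ i : K.out →ₗ[R] E.out, Function.Injective i → K ∈ D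

theorem toClass_ofFinite_range {H K : IsoClass R} (i : K.out →ₗ[R] H.out)
    (hi : Function.Injective i) :
    (FiniteModule.ofFinite (R := R) (LinearMap.range i)).toClass = K :=
  (IsoClass.iso_out_iff.1
    ⟨(LinearEquiv.ofInjective i hi).trans (FiniteModule.ofFiniteEquiv _).symm⟩).symm

theorem exists_finite_isSubmoduleClosed (s : Finset (IsoClass R)) :
    ∃ D : Set (IsoClass R), D.Finite ∧ ↑s ⊆ D ∧ IsSubmoduleClosed D := by
  refine ⟨⋃ H ∈ s, Set.range fun N : Submodule R H.out =>
    (FiniteModule.ofFinite (R := R) N).toClass, ?_, ?_, ?_⟩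
  · refine s.finite_toSet.biUnion fun H _ => ?_
    have : Finite (Submodule R H.out) := Finite.of_injective _ SetLike.coe_injective
    exact Set.finite_range _
  · intro H hH
    simp only [Set.mem_iUnion]
    exact ⟨H, hH, _, toClass_ofFinite_range LinearMap.id Function.injective_id⟩
  · intro K E hE i hi
    simp only [Set.mem_iUnion] at hE ⊢
    obtain ⟨H, hH, N, rfl⟩ := hE
    obtain ⟨e⟩ := (FiniteModule.ofFinite (R := R) N).iso_out
    let e' := e.trans (FiniteModule.ofFiniteEquiv (R := R) N)
    exact ⟨H, hH, _, toClass_ofFinite_range ((N.subtype ∘ₗ e'.toLinearMap) ∘ₗ i)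
      ((N.injective_subtype.comp e'.injective).comp hi)⟩

/-- The mass of the modules in `D` that have no nonzero homomorphisms to the modules in `T`. -/
noncomputable def partialMass (c : FiniteModule R → ℝ≥0∞) (T : Set (SimpleClass R))
    (D : Set (IsoClass R)) : ℝ≥0∞ :=
  ∑' E, (D ∩ {E | HomFree T E.out}).indicator (mass c) E

theorem partialMass_ne_top (hc : IsWeight c) (T : Set (SimpleClass R)) {D : Set (IsoClass R)}
    (hD : D.Finite) : partialMass c T D ≠ ⊤ := by
  rw [partialMass, tsum_eq_sum (s := hD.toFinset)]
  · exact ENNReal.sum_ne_top.2 fun _ _ =>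
      ne_top_of_le_ne_top (hc.mass_ne_top _) (Set.indicator_le_self _ _ _)
  · intro E hE
    rw [Set.Finite.mem_toFinset] at hE
    exact Set.indicator_of_notMem (fun h => hE h.1) _

theorem sum_mass_le_partialMass_empty {s : Finset (IsoClass R)} {D : Set (IsoClass R)}
    (hsD : ↑s ⊆ D) : ∑ E ∈ s, mass c E ≤ partialMass c ∅ D :=
  calc ∑ E ∈ s, mass c E = ∑ E ∈ s, (D ∩ {E | HomFree ∅ E.out}).indicator (mass c) E :=
        Finset.sum_congr rfl fun _ hE => (Set.indicator_of_mem (s := D ∩ {E | HomFree ∅ E.out})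
          ⟨hsD hE, fun K hK => absurd hK (Set.notMem_empty K)⟩ _).symm
    _ ≤ partialMass c ∅ D := ENNReal.sum_le_tsum s

variable {T : Set (SimpleClass R)} {D : Set (IsoClass R)}

theorem tsum_indicator_mul_surCount_div_le (hR : IsDedekindLike R) (hc : IsWeight c)
    (hD : IsSubmoduleClosed D) {L : SimpleClass R} (hL : L ∉ T) :
    ∑' E : IsoClass R, (D ∩ {E | HomFree T E.out}).indicator (mass c) E *
      ((surCount E.out L.out : ℝ≥0∞) / autCount L.out) ≤ mass c L.1 * partialMass c T D := by
  have hmoment := hc.tsum_indicator_mul_surCount_le hR L.out (D := D ∩ {E | HomFree T E.out}) (by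
    rintro K H ⟨hHD, hHT⟩ s
    exact ⟨hD K H hHD s.inc s.inc_injective,
      ((show HomFree T H.out from hHT).ker hR hL le_rfl s.proj).congr s.kerEquiv.symm⟩)
  simp only [div_eq_mul_inv, ← mul_assoc]
  rw [ENNReal.tsum_mul_right, mass, div_eq_mul_inv, mul_right_comm]
  exact mul_le_mul' hmoment le_rfl

theorem indicator_le_indicator_mul_surCount_div {E : IsoClass R} {L : SimpleClass R}
    {f : E.out →ₗ[R] L.out} (hf : f ≠ 0) :
    (D ∩ {E | HomFree T E.out}).indicator (mass c) E ≤
      (D ∩ {E | HomFree T E.out}).indicator (mass c) E *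
        ((surCount E.out L.out : ℝ≥0∞) / autCount L.out) :=
  le_mul_of_one_le_right' (one_le_surCount_div_autCount f (LinearMap.surjective_of_ne_zero hf))

theorem partialMass_le_insert (hR : IsDedekindLike R) (hc : IsWeight c) (hD : IsSubmoduleClosed D)
    {L : SimpleClass R} (hL : L ∉ T) :
    partialMass c T D ≤ partialMass c (insert L T) D + mass c L.1 * partialMass c T D := by
  refine le_trans ?_ (add_le_add le_rfl (tsum_indicator_mul_surCount_div_le hR hc hD hL))
  rw [partialMass, partialMass, ← ENNReal.tsum_add]
  refine ENNReal.tsum_le_tsum fun E => ?_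
  by_cases hf : ∃ f : E.out →ₗ[R] L.out, f ≠ 0
  · obtain ⟨f, hf⟩ := hf
    exact le_add_left (indicator_le_indicator_mul_surCount_div hf)
  · push Not at hf
    refine le_add_right (Set.indicator_apply_le fun hE => ?_)
    rw [Set.indicator_of_mem (s := D ∩ {E | HomFree (insert L T) E.out})
      ⟨hE.1, homFree_insert.2 ⟨hf, hE.2⟩⟩]

/-- The class of the zero module. -/
def zeroClass (R : Type u) [Ring R] : IsoClass R := FiniteModule.toClass { carrier := PUnit }

theorem eq_zeroClass {E : IsoClass R} [Subsingleton E.out] : E = zeroClass R :=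
  IsoClass.iso_out_iff.1 ⟨(0 : E.out ≃ₗ[R] (PUnit : Type))⟩

theorem exists_simpleClass_ne_zero (E : FiniteModule R) [Nontrivial E] :
    ∃ (L : SimpleClass R) (f : E →ₗ[R] L.out), f ≠ 0 := by
  obtain ⟨m, hm⟩ := exists_isSimpleModule_quotient_of_finite (R := R) E
  have : Finite (E ⧸ m) := Finite.of_surjective _ m.mkQ_surjective
  obtain ⟨L, ⟨e⟩⟩ := exists_simpleClass (R := R) (E ⧸ m)
  have := IsSimpleModule.nontrivial R L.out
  exact ⟨L, e.symm.toLinearMap ∘ₗ m.mkQ,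
    LinearMap.ne_zero_of_surjective (e.symm.surjective.comp m.mkQ_surjective)⟩

theorem partialMass_le_zeroClass_add (hR : IsDedekindLike R) (hc : IsWeight c)
    (hD : IsSubmoduleClosed D) :
    partialMass c T D ≤ mass c (zeroClass R) +
      (∑' L : {L // L ∉ T}, mass c L.1.1) * partialMass c T D := by
  classical
  rw [← ENNReal.tsum_mul_right]
  refine le_trans ?_ (add_le_add le_rfl (ENNReal.tsum_le_tsum fun L : {L // L ∉ T} =>
    tsum_indicator_mul_surCount_div_le hR hc hD L.2))
  rw [ENNReal.tsum_comm, ← tsum_ite_eq (zeroClass R) (fun E => mass c E), ← ENNReal.tsum_add,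
    partialMass]
  refine ENNReal.tsum_le_tsum fun E => ?_
  rcases subsingleton_or_nontrivial E.out with h | h
  · rw [if_pos eq_zeroClass]
    exact le_add_right (Set.indicator_le_self _ _ E)
  by_cases hE : E ∈ D ∩ {E | HomFree T E.out}
  · obtain ⟨L, f, hf⟩ := exists_simpleClass_ne_zero E.out
    exact le_add_left ((indicator_le_indicator_mul_surCount_div hf).trans
      (ENNReal.le_tsum (⟨L, fun h => hf (hE.2 L h f)⟩ : {L // L ∉ T})))
  · rw [Set.indicator_of_notMem hE]
    exact zero_le

/-- The partial masses of finite sets of isomorphism classes that are closed under submodules are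
uniformly bounded. The restriction to finite sets allows one to subtract partial masses. -/
def HasBoundedPartialMass (c : FiniteModule R → ℝ≥0∞) (T : Set (SimpleClass R)) : Prop :=
  ∃ B : ℝ≥0∞, B ≠ ⊤ ∧ ∀ D : Set (IsoClass R), D.Finite → IsSubmoduleClosed D →
    partialMass c T D ≤ B

theorem hasBoundedPartialMass_of_le_add_mul (hc : IsWeight c) {B m : ℝ≥0∞} (hB : B ≠ ⊤)
    (hm : m < 1) (h : ∀ D : Set (IsoClass R), D.Finite → IsSubmoduleClosed D →
      partialMass c T D ≤ B + m * partialMass c T D) : HasBoundedPartialMass c T := by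
  refine ⟨B / (1 - m), ENNReal.div_ne_top hB (tsub_pos_of_lt hm).ne', fun D hDf hD => ?_⟩
  rw [ENNReal.le_div_iff_mul_le (Or.inl (tsub_pos_of_lt hm).ne')
    (Or.inl (ENNReal.sub_ne_top ENNReal.one_ne_top)), mul_comm,
    ENNReal.sub_mul fun _ _ => partialMass_ne_top hc T hDf, one_mul]
  exact tsub_le_iff_right.2 (h D hDf hD)

theorem HasBoundedPartialMass.of_insert (hR : IsDedekindLike R) (hc : IsWeight c)
    {L : SimpleClass R} (hL : L ∉ T) (hm : mass c L.1 < 1)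
    (h : HasBoundedPartialMass c (insert L T)) : HasBoundedPartialMass c T :=
  have ⟨_, hB, h⟩ := h
  hasBoundedPartialMass_of_le_add_mul hc hB hm fun D hDf hD =>
    (partialMass_le_insert hR hc hD hL).trans (add_le_add (h D hDf hD) le_rfl)

theorem HasBoundedPartialMass.empty (hR : IsDedekindLike R) (hc : IsWeight c) (hd : HasDecay c)
    {T : Finset (SimpleClass R)} (h : HasBoundedPartialMass c T) : HasBoundedPartialMass c ∅ := by
  classical
  induction T using Finset.induction_on with
  | empty => simpa using h
  | insert L T hL ih =>
    rw [Finset.coe_insert] at h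
    exact ih (h.of_insert hR hc (by simpa using hL) (hd.mass_lt_one L))

theorem tsum_mass_ne_top (hR : IsDedekindLike R) (hc : IsWeight c) (hd : HasDecay c) :
    ∑' E, mass c E ≠ ⊤ := by
  have htail := (ENNReal.tendsto_tsum_compl_atTop_zero
    (hd.tsum_mass_simpleClass_ne_top hR.toIsArithmeticRing)).eventually_lt_const one_pos
  obtain ⟨T, hT⟩ := htail.exists
  have hbounded : HasBoundedPartialMass c (T : Set (SimpleClass R)) :=
    hasBoundedPartialMass_of_le_add_mul hc (hc.mass_ne_top (zeroClass R)) hT fun D _ hD =>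
      partialMass_le_zeroClass_add hR hc hD
  obtain ⟨B, hB, h⟩ := hbounded.empty hR hc hd
  refine ne_top_of_le_ne_top hB ?_
  rw [ENNReal.tsum_eq_iSup_sum]
  refine iSup_le fun s => ?_
  obtain ⟨D, hDf, hsD, hD⟩ := exists_finite_isSubmoduleClosed s
  exact (sum_mass_le_partialMass_empty hsD).trans (h D hDf hD)

theorem countable_isoClass (hR : IsDedekindLike R) (hc : IsWeight c) (hd : HasDecay c) :
    Countable (IsoClass R) := by
  have hsupp := Summable.countable_support_ennreal (tsum_mass_ne_top hR hc hd)
  rwa [Set.eq_univ_of_forall (s := Function.support (mass c)) hc.mass_ne_zero,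
    Set.countable_univ_iff] at hsupp

end Convergence

section Bonferroni

/-- The product `(q - 1) * (q ^ 2 - 1) * ⋯ * (q ^ j - 1)`, which appears in the denominators of
inclusion-exclusion formulas over finite vector spaces. -/
noncomputable def qPochhammer (q : ℝ) (j : ℕ) : ℝ := ∏ i ∈ Finset.range j, (q ^ (i + 1) - 1)

variable {q t : ℝ}

theorem pow_succ_sub_one_pos (hq : 1 < q) (i : ℕ) : 0 < q ^ (i + 1) - 1 :=
  sub_pos.2 (one_lt_pow₀ hq i.succ_ne_zero)

theorem qPochhammer_pos (hq : 1 < q) (j : ℕ) : 0 < qPochhammer q j :=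
  Finset.prod_pos fun i _ => pow_succ_sub_one_pos hq i

theorem two_pow_le_qPochhammer_succ (hq : 2 ≤ q) (j : ℕ) : (2 : ℝ) ^ j ≤ qPochhammer q (j + 1) := by
  induction j with
  | zero => simp only [qPochhammer, zero_add, Finset.prod_range_one, pow_zero, pow_one]; linarith
  | succ j ih =>
    have hfactor : 2 ≤ q ^ (j + 1 + 1) - 1 := by
      have : q ^ 2 ≤ q ^ (j + 1 + 1) := pow_le_pow_right₀ (by linarith) (by omega)
      nlinarith
    rw [qPochhammer, Finset.prod_range_succ, pow_succ]
    exact mul_le_mul ih hfactor zero_le_two ((by positivity : (0 : ℝ) ≤ 2 ^ j).trans ih)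

theorem neg_one_pow_mul_prod_sub_pow (q t : ℝ) (j : ℕ) :
    (-1) ^ (j + 1) * ∏ i ∈ Finset.range (j + 1), (t - q ^ i) =
      (1 - t) * ∏ i ∈ Finset.range j, (q ^ (i + 1) - t) := by
  have hneg : ∏ i ∈ Finset.range j, (q ^ (i + 1) - t) =
      (-1) ^ j * ∏ i ∈ Finset.range j, (t - q ^ (i + 1)) := by
    simp_rw [← neg_sub t, Finset.prod_neg, Finset.card_range]
  rw [Finset.prod_range_succ' (fun i => t - q ^ i), hneg, pow_zero, pow_succ]
  ring

theorem alternating_sum_div_qPochhammer (hq : 1 < q) (t : ℝ) (J : ℕ) :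
    ∑ j ∈ Finset.range (J + 1), (-1) ^ j * (∏ i ∈ Finset.range j, (t - q ^ i)) / qPochhammer q j =
      (∏ i ∈ Finset.range J, (q ^ (i + 1) - t)) / qPochhammer q J := by
  induction J with
  | zero => simp
  | succ J ih =>
    have hfactor := (pow_succ_sub_one_pos hq J).ne'
    have hprod := (qPochhammer_pos hq J).ne'
    have hsucc : qPochhammer q (J + 1) = qPochhammer q J * (q ^ (J + 1) - 1) :=
      Finset.prod_range_succ _ _
    rw [Finset.sum_range_succ, ih, neg_one_pow_mul_prod_sub_pow, hsucc, Finset.prod_range_succ]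
    field_simp
    ring

theorem abs_prod_pow_sub_le (hq : 1 ≤ q) (ht : t ≠ 1)
    (hnonneg : ∀ j, 0 ≤ ∏ i ∈ Finset.range j, (t - q ^ i)) (J : ℕ) :
    |∏ i ∈ Finset.range J, (q ^ (i + 1) - t)| ≤ ∏ i ∈ Finset.range J, (t - q ^ i) := by
  rcases (hnonneg J).eq_or_lt' with hJ | hJ
  · obtain ⟨i, hi, hti⟩ := Finset.prod_eq_zero_iff.1 hJ
    obtain ⟨k, rfl⟩ : ∃ k, i = k + 1 := Nat.exists_eq_succ_of_ne_zero fun h => ht (by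
      rw [h, pow_zero] at hti
      linarith)
    have hk : k ∈ Finset.range J :=
      Finset.mem_range.2 (k.lt_succ_self.trans (Finset.mem_range.1 hi))
    rw [hJ, Finset.prod_eq_zero hk (by linarith), abs_zero]
  · have htJ : q ^ J ≤ t := by
      have h := hnonneg (J + 1)
      rw [Finset.prod_range_succ] at h
      linarith [nonneg_of_mul_nonneg_right h hJ]
    rw [Finset.abs_prod]
    refine Finset.prod_le_prod (fun i _ => abs_nonneg _) fun i hi => ?_
    have h1 : q ^ (i + 1) ≤ q ^ J := pow_le_pow_right₀ hq (Finset.mem_range.1 hi)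
    have h2 : q ^ i ≤ q ^ (i + 1) := pow_le_pow_right₀ hq (Nat.le_succ i)
    rw [abs_of_nonpos (by linarith)]
    linarith

-- With `t = |Hom(M, L)|` and `q = |End(L)|`, the products on both sides count the surjections from
-- `M` to the powers of the simple module `L`, and the indicator detects `Hom(M, L) = 0`.
theorem abs_indicator_sub_alternating_sum_le (hq : 1 < q)
    (hnonneg : ∀ j, 0 ≤ ∏ i ∈ Finset.range j, (t - q ^ i)) (J : ℕ) :
    |(if t = 1 then 1 else 0) - ∑ j ∈ Finset.range (J + 1),
      (-1) ^ j * (∏ i ∈ Finset.range j, (t - q ^ i)) / qPochhammer q j| ≤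
      (∏ i ∈ Finset.range J, (t - q ^ i)) / qPochhammer q J := by
  have hpos := qPochhammer_pos hq J
  rw [alternating_sum_div_qPochhammer hq]
  split_ifs with ht
  · subst ht
    rw [← qPochhammer, div_self hpos.ne', sub_self, abs_zero]
    exact div_nonneg (hnonneg J) hpos.le
  · rw [zero_sub, abs_neg, abs_div, abs_of_pos hpos]
    exact div_le_div_of_nonneg_right (abs_prod_pow_sub_le hq.le ht hnonneg J) hpos.le

end Bonferroni

section FreeSurjections

variable {R : Type u} [Ring R]

/-- The number of surjections whose kernel has no nonzero homomorphism to the simple modules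
in `T`. -/
noncomputable def freeSurCount (T : Set (SimpleClass R)) (H G : FiniteModule R) : ℕ :=
  Nat.card {φ : H →ₗ[R] G // Function.Surjective φ ∧ HomFree T (LinearMap.ker φ)}

theorem freeSurCount_le (T : Set (SimpleClass R)) (H G : FiniteModule R) :
    freeSurCount T H G ≤ surCount H G :=
  Nat.card_le_card_of_injective _ (Subtype.map_injective (fun _ h => h.1) Function.injective_id)

theorem freeSurCount_empty (H G : FiniteModule R) : freeSurCount ∅ H G = surCount H G :=
  Nat.card_congr (Equiv.subtypeEquivRight fun φ => by simp [HomFree])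

/-- The number of pairs of a surjection `φ` as in `freeSurCount` and of a surjection from its kernel
to `K`. -/
noncomputable def freePairCount (T : Set (SimpleClass R)) (K H G : FiniteModule R) : ℕ :=
  Nat.card {z : SurPair R H K G // HomFree T (LinearMap.ker z.φ)}

def freePairEquiv (T : Set (SimpleClass R)) (K H G : FiniteModule R) :
    {z : SurPair R H K G // HomFree T (LinearMap.ker z.φ)} ≃
      Σ φ : {φ : H →ₗ[R] G // Function.Surjective φ ∧ HomFree T (LinearMap.ker φ)},
        {ψ : LinearMap.ker φ.1 →ₗ[R] K // Function.Surjective ψ} where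
  toFun z := ⟨⟨z.1.φ, z.1.φ_surjective, z.2⟩, z.1.ψ, z.1.ψ_surjective⟩
  invFun x := ⟨⟨x.1.1, x.1.2.1, x.2.1, x.2.2⟩, x.1.2.2⟩

theorem freePairCount_eq_sum (T : Set (SimpleClass R)) (K H G : FiniteModule R)
    [Fintype {φ : H →ₗ[R] G // Function.Surjective φ ∧ HomFree T (LinearMap.ker φ)}] :
    freePairCount T K H G =
      ∑ φ : {φ : H →ₗ[R] G // Function.Surjective φ ∧ HomFree T (LinearMap.ker φ)},
        surCountTo (LinearMap.ker φ.1) K := by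
  rw [freePairCount, Nat.card_congr (freePairEquiv T K H G), Nat.card_sigma]
  rfl

theorem card_hom_eq_one_iff {M N : Type*} [AddCommGroup M] [Module R M] [AddCommGroup N]
    [Module R N] : Nat.card (M →ₗ[R] N) = 1 ↔ ∀ f : M →ₗ[R] N, f = 0 := by
  rw [Nat.card_eq_one_iff_exists]
  exact ⟨fun ⟨x, hx⟩ f => (hx f).trans (hx 0).symm, fun h => ⟨0, h⟩⟩

theorem freeSurCount_insert_eq_sum (T : Set (SimpleClass R)) (L : SimpleClass R)
    (H G : FiniteModule R)
    [Fintype {φ : H →ₗ[R] G // Function.Surjective φ ∧ HomFree T (LinearMap.ker φ)}] :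
    (freeSurCount (insert L T) H G : ℝ) =
      ∑ φ : {φ : H →ₗ[R] G // Function.Surjective φ ∧ HomFree T (LinearMap.ker φ)},
        if (Nat.card (LinearMap.ker φ.1 →ₗ[R] L.out) : ℝ) = 1 then (1 : ℝ) else 0 := by
  classical
  rw [Finset.sum_boole, ← Fintype.card_subtype, ← Nat.card_eq_fintype_card, freeSurCount,
    Nat.card_congr (Equiv.subtypeSubtypeEquivSubtypeInter _
      fun φ : H →ₗ[R] G => (Nat.card (LinearMap.ker φ →ₗ[R] L.out) : ℝ) = 1)]
  refine congrArg Nat.cast (Nat.card_congr (Equiv.subtypeEquivRight fun φ => ?_))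
  rw [homFree_insert, Nat.cast_eq_one, card_hom_eq_one_iff, and_assoc, and_comm (a := ∀ f, f = 0)]

theorem abs_freeSurCount_insert_sub_le (T : Set (SimpleClass R)) (L : SimpleClass R)
    (H G : FiniteModule R) (J : ℕ) :
    |(freeSurCount (insert L T) H G : ℝ) - ∑ j ∈ Finset.range (J + 1),
      (-1) ^ j / qPochhammer (Nat.card (L.out →ₗ[R] L.out)) j * freePairCount T (L.out.pow j) H G| ≤
      freePairCount T (L.out.pow J) H G / qPochhammer (Nat.card (L.out →ₗ[R] L.out)) J := by
  have := Fintype.ofFinite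
    {φ : H →ₗ[R] G // Function.Surjective φ ∧ HomFree T (LinearMap.ker φ)}
  simp_rw [freeSurCount_insert_eq_sum, freePairCount_eq_sum, Nat.cast_sum, Finset.mul_sum]
  rw [Finset.sum_comm, ← Finset.sum_sub_distrib, Finset.sum_div]
  refine (Finset.abs_sum_le_sum_abs _ _).trans (Finset.sum_le_sum fun φ _ => ?_)
  simp_rw [surCountTo_pow_eq_prod, div_mul_eq_mul_div]
  exact abs_indicator_sub_alternating_sum_le (one_lt_two.trans_le (two_le_card_end L.out))
    (fun j => by rw [← surCountTo_pow_eq_prod]; positivity) J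

theorem homFree_ker_pullback_iff (hR : IsDedekindLike R) {T : Set (SimpleClass R)}
    {L : SimpleClass R} (hL : L ∉ T) {j : ℕ} {H E G : Type*} [AddCommGroup H] [Module R H]
    [AddCommGroup E] [Module R E] [AddCommGroup G] [Module R G]
    (s : ShortExactSeq R (L.out.pow j) E G) {χ : H →ₗ[R] E} (hχ : Function.Surjective χ) :
    HomFree T (LinearMap.ker (s.pullback χ hχ).φ) ↔ HomFree T (LinearMap.ker χ) := by
  set z := s.pullback χ hχ
  have e : LinearMap.ker z.ψ ≃ₗ[R] z.kernel :=
    Submodule.equivMapOfInjective _ (LinearMap.ker z.φ).injective_subtype _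
  rw [← s.kernel_pullback hχ, ← homFree_congr e]
  exact ⟨fun h => h.ker hR hL (annihilator_le_annihilator_pow L.out j) z.ψ,
    fun h => HomFree.of_ker z.ψ z.ψ_surjective h (homFree_pow hL j)⟩

theorem tsum_freeSurCount_mul_seqCount_div (hR : IsDedekindLike R) {T : Set (SimpleClass R)}
    {L : SimpleClass R} (hL : L ∉ T) (j : ℕ) (H G : FiniteModule R) :
    ∑' E : IsoClass R, (freeSurCount T H E.out : ℝ≥0∞) *
      ((seqCount (L.out.pow j) E.out G : ℝ≥0∞) / autCount E.out) =
      freePairCount T (L.out.pow j) H G := by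
  have : Finite {z : SurPair R H (L.out.pow j) G // HomFree T (LinearMap.ker z.φ)} :=
    Finite.of_equiv _ (freePairEquiv T (L.out.pow j) H G).symm
  rw [freePairCount, ← tsum_card_pullback_div_autCount]
  refine tsum_congr fun E => ?_
  rw [← mul_div_assoc, ← Nat.cast_mul, freeSurCount, seqCount, ← Nat.card_prod]
  congr 2
  exact Nat.card_congr
    { toFun := fun x => ⟨(⟨x.1.1, x.1.2.1⟩, x.2), (homFree_ker_pullback_iff hR hL _ _).2 x.1.2.2⟩
      invFun := fun y =>
        (⟨y.1.1.1, y.1.1.2, (homFree_ker_pullback_iff hR hL y.1.2 y.1.1.2).1 y.2⟩, y.1.2) }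

theorem exists_finset_injective_of_homFree_ker {H G : FiniteModule R} (φ : H →ₗ[R] G) :
    ∃ T₀ : Finset (SimpleClass R),
      HomFree (T₀ : Set (SimpleClass R)) (LinearMap.ker φ) → Function.Injective φ := by
  by_cases hφ : Function.Injective φ
  · exact ⟨∅, fun _ => hφ⟩
  have : Nontrivial (LinearMap.ker φ) :=
    Submodule.nontrivial_iff_ne_bot.2 fun h => hφ (LinearMap.ker_eq_bot.1 h)
  have e := FiniteModule.ofFiniteEquiv (R := R) (LinearMap.ker φ)
  have := e.toEquiv.nontrivial
  obtain ⟨L, f, hf⟩ := exists_simpleClass_ne_zero (FiniteModule.ofFinite (R := R) (LinearMap.ker φ))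
  exact ⟨{L}, fun h => absurd (h.congr e.symm L (Finset.mem_coe.2 (Finset.mem_singleton_self L)) f)
    hf⟩

theorem homFree_ker_of_injective {M N : Type*} [AddCommGroup M] [Module R M] [AddCommGroup N]
    [Module R N] {φ : M →ₗ[R] N} (hφ : Function.Injective φ) (T : Set (SimpleClass R)) :
    HomFree T (LinearMap.ker φ) := fun _ _ f => by
  have : Subsingleton (LinearMap.ker φ) := by
    rw [LinearMap.ker_eq_bot.2 hφ]
    infer_instance
  exact Subsingleton.elim f 0

theorem eventually_homFree_ker_iff (H G : FiniteModule R) :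
    ∀ᶠ T : Finset (SimpleClass R) in Filter.atTop, ∀ φ : H →ₗ[R] G,
      HomFree (T : Set (SimpleClass R)) (LinearMap.ker φ) ↔ Function.Injective φ := by
  refine Filter.eventually_all.2 fun φ => ?_
  obtain ⟨T₀, hT₀⟩ := exists_finset_injective_of_homFree_ker φ
  filter_upwards [Filter.eventually_ge_atTop T₀] with T hT
  exact ⟨fun h => hT₀ fun L hL => h L (hT hL), fun h => homFree_ker_of_injective h _⟩

theorem eventually_freeSurCount_eq [DecidableEq (IsoClass R)] (H G : IsoClass R) :
    ∀ᶠ T : Finset (SimpleClass R) in Filter.atTop,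
      freeSurCount (T : Set (SimpleClass R)) H.out G.out =
        if H = G then autCount H.out else 0 := by
  filter_upwards [eventually_homFree_ker_iff H.out G.out] with T hT
  simp_rw [freeSurCount, hT]
  split_ifs with hHG
  · subst hHG
    exact Nat.card_congr
      { toFun := fun φ => LinearEquiv.ofBijective φ.1 ⟨φ.2.2, φ.2.1⟩
        invFun := fun a => ⟨a.toLinearMap, a.surjective, a.injective⟩
        left_inv := fun _ => rfl
        right_inv := fun _ => LinearEquiv.ext fun _ => rfl }
  · have : IsEmpty {φ : H.out →ₗ[R] G.out // Function.Surjective φ ∧ Function.Injective φ} :=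
      ⟨fun φ => hHG (by
        rw [IsoClass.iso_out_iff.1 ⟨LinearEquiv.ofBijective φ.1 ⟨φ.2.2, φ.2.1⟩⟩, G.toClass_out])⟩
    exact Nat.card_of_isEmpty

end FreeSurjections

section Uniqueness

variable {R : Type u} [Ring R] {c : FiniteModule R → ℝ≥0∞}

/-- The moments of a measure on isomorphism classes, with kernels restricted by `T`. -/
noncomputable def freeMoment (y : IsoClass R → ℝ≥0∞) (T : Set (SimpleClass R))
    (G : FiniteModule R) : ℝ≥0∞ :=
  ∑' H, y H * freeSurCount T H.out G

/-- The expected number of pairs of surjections as in `freePairCount`. -/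
noncomputable def freePairMoment (y : IsoClass R → ℝ≥0∞) (T : Set (SimpleClass R))
    (K G : FiniteModule R) : ℝ≥0∞ :=
  ∑' H, y H * freePairCount T K H.out G

/-- The measure `y` on isomorphism classes has surjection moments `c`. -/
def HasMoments (c : FiniteModule R → ℝ≥0∞) (y : IsoClass R → ℝ≥0∞) : Prop :=
  ∀ G : FiniteModule R, ∑' H, y H * surCount H.out G = c G

theorem freePairMoment_eq_tsum (hR : IsDedekindLike R) (y : IsoClass R → ℝ≥0∞)
    {T : Set (SimpleClass R)} {L : SimpleClass R} (hL : L ∉ T) (j : ℕ) (G : FiniteModule R) :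
    freePairMoment y T (L.out.pow j) G = ∑' E : IsoClass R,
      ((seqCount (L.out.pow j) E.out G : ℝ≥0∞) / autCount E.out) * freeMoment y T E.out := by
  simp_rw [freePairMoment, ← tsum_freeSurCount_mul_seqCount_div hR hL, freeMoment,
    ← ENNReal.tsum_mul_left]
  rw [ENNReal.tsum_comm]
  exact tsum_congr fun E => tsum_congr fun H => by ring

theorem IsWeight.apply_pow_zero (hc : IsWeight c) (K : FiniteModule R) : c (K.pow 0) = 1 := by
  have s : ShortExactSeq R (K.pow 0) (K.pow 0) (K.pow 0) :=
    ⟨0, 0, Function.injective_of_subsingleton _, Function.surjective_to_subsingleton _,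
      fun _ => iff_of_true (Subsingleton.elim _ _) ⟨0, Subsingleton.elim _ _⟩⟩
  exact (ENNReal.mul_right_inj (hc.ne_zero _) (hc.ne_top _)).1
    ((hc.mul s).symm.trans (mul_one _).symm)

theorem IsWeight.apply_pow_le_one (hc : IsWeight c) {K : FiniteModule R} (hK : c K ≤ 1) (j : ℕ) :
    c (K.pow j) ≤ 1 := by
  induction j with
  | zero => exact (hc.apply_pow_zero K).le
  | succ j ih =>
    have s : ShortExactSeq R K (K.pow (j + 1)) (K.pow j) :=
      ⟨LinearMap.inl R K (K.pow j), LinearMap.snd R K (K.pow j), LinearMap.inl_injective,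
        Prod.snd_surjective, .inl_snd⟩
    rw [hc.mul s]
    exact mul_le_one' hK ih

theorem HasDecay.le_one (hd : HasDecay c) (K : SimpleClass R) : c K.out ≤ 1 := by
  obtain ⟨ε, hε, h⟩ := hd
  have hcard : (1 : ℝ) ≤ Nat.card K.out := by exact_mod_cast Nat.card_pos (α := K.out)
  exact (h K.out K.2).trans (ENNReal.ofReal_le_one.2
    (Real.rpow_le_one_of_one_le_of_nonpos hcard (by linarith)))

theorem hasSum_toReal_mul {ι : Type*} {y : ι → ℝ≥0∞} {n : ι → ℕ} (h : ∑' i, y i * n i ≠ ⊤) :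
    HasSum (fun i => (y i).toReal * n i) (∑' i, y i * n i).toReal := by
  rw [ENNReal.tsum_toReal_eq (ENNReal.ne_top_of_tsum_ne_top h)]
  simpa only [ENNReal.toReal_mul, ENNReal.toReal_natCast] using ENNReal.hasSum_toReal h

namespace HasMoments

variable {x y : IsoClass R → ℝ≥0∞} {T : Set (SimpleClass R)} {L : SimpleClass R}

theorem freeMoment_le (hy : HasMoments c y) (T : Set (SimpleClass R)) (G : FiniteModule R) :
    freeMoment y T G ≤ c G := by
  rw [← hy G]
  refine ENNReal.tsum_le_tsum fun H => mul_le_mul' le_rfl ?_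
  exact_mod_cast freeSurCount_le T H.out G

theorem freeMoment_ne_top (hy : HasMoments c y) (hc : IsWeight c) (T : Set (SimpleClass R))
    (G : FiniteModule R) : freeMoment y T G ≠ ⊤ :=
  ne_top_of_le_ne_top (hc.ne_top G) (hy.freeMoment_le T G)

theorem freePairMoment_le (hy : HasMoments c y) (hR : IsDedekindLike R) (hc : IsWeight c)
    (hL : L ∉ T) (hcL : c L.out ≤ 1) (j : ℕ) (G : FiniteModule R) :
    freePairMoment y T (L.out.pow j) G ≤ c G := by
  have hterm (E : IsoClass R) :
      ((seqCount (L.out.pow j) E.out G : ℝ≥0∞) / autCount E.out) * freeMoment y T E.out ≤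
        ((seqCount (L.out.pow j) E.out G : ℝ≥0∞) / autCount E.out) * c G := by
    rcases isEmpty_or_nonempty (ShortExactSeq R (L.out.pow j) E.out G) with h | ⟨⟨s⟩⟩
    · simp [seqCount]
    · refine mul_le_mul' le_rfl ((hy.freeMoment_le T E.out).trans ?_)
      rw [hc.mul s]
      exact mul_le_of_le_one_left' (hc.apply_pow_le_one hcL j)
  rw [freePairMoment_eq_tsum hR y hL]
  refine (ENNReal.tsum_le_tsum hterm).trans ?_
  rw [ENNReal.tsum_mul_right, hR.tsum_seqCount_div_autCount_eq_one, one_mul]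

theorem abs_freeMoment_insert_sub_le (hy : HasMoments c y) (hR : IsDedekindLike R)
    (hc : IsWeight c) (hL : L ∉ T) (hcL : c L.out ≤ 1) (G : FiniteModule R) (J : ℕ) :
    |(freeMoment y (insert L T) G).toReal - ∑ j ∈ Finset.range (J + 2),
      (-1) ^ j / qPochhammer (Nat.card (L.out →ₗ[R] L.out)) j *
        (freePairMoment y T (L.out.pow j) G).toReal| ≤ (c G).toReal / 2 ^ J := by
  set q : ℝ := (Nat.card (L.out →ₗ[R] L.out) : ℝ)
  have hpairLe (j : ℕ) : freePairMoment y T (L.out.pow j) G ≤ c G :=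
    hy.freePairMoment_le hR hc hL hcL j G
  have hpair (j : ℕ) := hasSum_toReal_mul (ne_top_of_le_ne_top (hc.ne_top G) (hpairLe j))
  have hfree := hasSum_toReal_mul (hy.freeMoment_ne_top hc (insert L T) G)
  have hterm (H : IsoClass R) : ‖(y H).toReal * freeSurCount (insert L T) H.out G -
      ∑ j ∈ Finset.range (J + 2), (-1) ^ j / qPochhammer q j *
        ((y H).toReal * freePairCount T (L.out.pow j) H.out G)‖ ≤
      (y H).toReal * freePairCount T (L.out.pow (J + 1)) H.out G / qPochhammer q (J + 1) := by
    simp_rw [mul_left_comm _ (y H).toReal]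
    rw [← Finset.mul_sum, ← mul_sub, norm_mul, Real.norm_of_nonneg ENNReal.toReal_nonneg,
      mul_div_assoc]
    exact mul_le_mul_of_nonneg_left (abs_freeSurCount_insert_sub_le T L H.out G (J + 1))
      ENNReal.toReal_nonneg
  calc _ ≤ (freePairMoment y T (L.out.pow (J + 1)) G).toReal / qPochhammer q (J + 1) :=
        (hfree.sub (hasSum_sum fun j _ => (hpair j).mul_left _)).norm_le_of_bounded
          ((hpair (J + 1)).div_const _) hterm
    _ ≤ (c G).toReal / 2 ^ J := by
        gcongr
        exacts [hc.ne_top G, hpairLe (J + 1), two_pow_le_qPochhammer_succ (two_le_card_end L.out) J]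

theorem freeMoment_insert_eq (hx : HasMoments c x) (hy : HasMoments c y) (hR : IsDedekindLike R)
    (hc : IsWeight c) (hL : L ∉ T) (hcL : c L.out ≤ 1)
    (hxy : ∀ G, freeMoment x T G = freeMoment y T G) (G : FiniteModule R) :
    freeMoment x (insert L T) G = freeMoment y (insert L T) G := by
  have hpair (j : ℕ) :
      freePairMoment x T (L.out.pow j) G = freePairMoment y T (L.out.pow j) G := by
    simp_rw [freePairMoment_eq_tsum hR _ hL, hxy]
  have hlim : Filter.Tendsto (fun J : ℕ => (c G).toReal / 2 ^ J + (c G).toReal / 2 ^ J)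
      Filter.atTop (nhds 0) := by
    have h := (tendsto_const_nhds (x := (c G).toReal)).div_atTop
      (tendsto_pow_atTop_atTop_of_one_lt (one_lt_two (α := ℝ)))
    simpa using h.add h
  have hle (J : ℕ) : |(freeMoment x (insert L T) G).toReal -
      (freeMoment y (insert L T) G).toReal| ≤ (c G).toReal / 2 ^ J + (c G).toReal / 2 ^ J := by
    have hxJ := hx.abs_freeMoment_insert_sub_le hR hc hL hcL G J
    have hyJ := hy.abs_freeMoment_insert_sub_le hR hc hL hcL G J
    simp_rw [hpair] at hxJ
    rw [abs_sub_comm] at hyJ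
    exact (abs_sub_le _ _ _).trans (add_le_add hxJ hyJ)
  rw [← ENNReal.toReal_eq_toReal_iff' (hx.freeMoment_ne_top hc _ G) (hy.freeMoment_ne_top hc _ G)]
  exact sub_eq_zero.1 (abs_nonpos_iff.1 (ge_of_tendsto' hlim hle))

theorem freeMoment_eq (hx : HasMoments c x) (hy : HasMoments c y) (hR : IsDedekindLike R)
    (hc : IsWeight c) (hd : HasDecay c) (T : Finset (SimpleClass R)) :
    ∀ G, freeMoment x T G = freeMoment y T G := by
  classical
  induction T using Finset.induction_on with
  | empty =>
    intro G
    simp_rw [freeMoment, Finset.coe_empty, freeSurCount_empty]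
    exact (hx G).trans (hy G).symm
  | insert L T hL ih =>
    rw [Finset.coe_insert]
    exact hx.freeMoment_insert_eq hy hR hc (by simpa using hL) (hd.le_one L) ih

theorem tendsto_freeMoment (hy : HasMoments c y) (hc : IsWeight c) (G : IsoClass R) :
    Filter.Tendsto (fun T : Finset (SimpleClass R) => (freeMoment y T G.out).toReal) Filter.atTop
      (nhds ((y G).toReal * autCount G.out)) := by
  classical
  have hdom := (hasSum_toReal_mul ((hy G.out).trans_ne (hc.ne_top G.out))).summable
  have hfree (T : Set (SimpleClass R)) : (freeMoment y T G.out).toReal =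
      ∑' H : IsoClass R, (y H).toReal * freeSurCount T H.out G.out :=
    (hasSum_toReal_mul (hy.freeMoment_ne_top hc T G.out)).tsum_eq.symm
  rw [← tsum_ite_eq G fun H : IsoClass R => (y H).toReal * (autCount H.out : ℝ)]
  simp_rw [hfree]
  refine tendsto_tsum_of_dominated_convergence hdom (fun H => ?_)
    (Filter.Eventually.of_forall fun T H => ?_)
  · refine tendsto_const_nhds.congr' ?_
    filter_upwards [eventually_freeSurCount_eq H G] with T hT
    rw [hT]
    split_ifs <;> simp
  · rw [Real.norm_of_nonneg (by positivity)]
    gcongr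
    exact freeSurCount_le _ _ _

theorem apply_ne_top (hy : HasMoments c y) (hc : IsWeight c) (E : IsoClass R) : y E ≠ ⊤ := by
  have hpos : (surCount E.out E.out : ℝ≥0∞) ≠ 0 := by
    exact_mod_cast ((autCount_pos E.out).trans_le
      (autCount_le_surCount LinearMap.id Function.surjective_id)).ne'
  have hne := ne_top_of_le_ne_top (hc.ne_top E.out)
    ((ENNReal.le_tsum (f := fun H => y H * surCount H.out E.out) E).trans_eq (hy E.out))
  exact fun h => hne (by rw [h, ENNReal.top_mul hpos])

theorem unique (hx : HasMoments c x) (hy : HasMoments c y) (hR : IsDedekindLike R)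
    (hc : IsWeight c) (hd : HasDecay c) : x = y := by
  funext E
  have hlim := hx.tendsto_freeMoment hc E
  simp_rw [hx.freeMoment_eq hy hR hc hd] at hlim
  have haut : (autCount E.out : ℝ) ≠ 0 := by exact_mod_cast (autCount_pos E.out).ne'
  exact (ENNReal.toReal_eq_toReal_iff' (hx.apply_ne_top hc E) (hy.apply_ne_top hc E)).1
    (mul_right_cancel₀ haut (tendsto_nhds_unique hlim (hy.tendsto_freeMoment hc E)))

end HasMoments

end Uniqueness

section Components

variable {R : Type u} [Ring R] {a : R}

theorem natCard_component_pos (a : R) (G : FiniteModule R) : 0 < Nat.card (component a G) := by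
  have : Nonempty (component a G) := ⟨⟨a • 0, 0, rfl⟩⟩
  exact Nat.card_pos

theorem smul_eq_self_of_mem_component (ha : IsIdempotentElem a) {G : FiniteModule R} {x : G}
    (hx : x ∈ component a G) : a • x = x := by
  obtain ⟨y, rfl⟩ := hx
  exact (mul_smul a a y).symm.trans (congrArg (· • y) ha.eq)

theorem mul_eq_self_of_mem_span_singleton (ha : IsIdempotentElem a) {r : R}
    (hr : r ∈ Ideal.span {a}) : r * a = r := by
  obtain ⟨b, rfl⟩ := Ideal.mem_span_singleton'.1 hr
  rw [mul_assoc, ha.eq]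

theorem projective_span_singleton (ha : IsIdempotentElem a) :
    Module.Projective R (Ideal.span {a}) :=
  .of_split (Ideal.span {a}).subtype
    ((LinearMap.toSpanSingleton R R a).codRestrict _ fun r =>
      Ideal.mul_mem_left _ r (Ideal.mem_span_singleton_self a))
    (LinearMap.ext fun r => Subtype.ext (mul_eq_self_of_mem_span_singleton ha r.2))

theorem natCard_component (ha : IsIdempotentElem a) (G : FiniteModule R) :
    Nat.card (component a G) = Nat.card (Ideal.span {a} →ₗ[R] G) :=
  let a' : Ideal.span {a} := ⟨a, Ideal.mem_span_singleton_self a⟩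
  Nat.card_congr
    { toFun x := (LinearMap.toSpanSingleton R G x).domRestrict _
      invFun f := ⟨f a', f a', (map_smul f a a').symm.trans (congrArg f (Subtype.ext ha.eq))⟩
      left_inv x := Subtype.ext (smul_eq_self_of_mem_component ha x.2)
      right_inv f := LinearMap.ext fun r => (map_smul f (r : R) a').symm.trans
        (congrArg f (Subtype.ext (mul_eq_self_of_mem_span_singleton ha r.2))) }

theorem natCard_component_congr (ha : IsIdempotentElem a) {G H : FiniteModule R}
    (f : G ≃ₗ[R] H) : Nat.card (component a G) = Nat.card (component a H) := by
  rw [natCard_component ha, natCard_component ha, card_hom_congr (.refl R _) f]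

theorem ShortExactSeq.natCard_component {K E G : FiniteModule R} (s : ShortExactSeq R K E G)
    (ha : IsIdempotentElem a) :
    Nat.card (component a E) = Nat.card (component a K) * Nat.card (component a G) := by
  have := projective_span_singleton ha
  rw [CohenMartinet.natCard_component ha, CohenMartinet.natCard_component ha,
    CohenMartinet.natCard_component ha, card_hom_eq_mul s.proj s.proj_surjective,
    card_hom_congr (.refl R _) s.kerEquiv]

end Components

section CentralIdempotents

variable {A : Type u} [Ring A]

theorem span_singleton_lt_span_singleton_add {g h : A} (hg : IsIdempotentElem g)
    (hh : IsIdempotentElem h) (hgh : g * h = 0) (hhg : h * g = 0) (h0 : h ≠ 0) :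
    Ideal.span {g} < Ideal.span {g + h} := by
  simp_rw [lt_iff_le_not_ge, Ideal.span_singleton_le_iff_mem, Ideal.mem_span_singleton']
  refine ⟨⟨g, by rw [mul_add, hgh, add_zero, hg.eq]⟩, fun ⟨a, ha⟩ => h0 ?_⟩
  calc h = h * (g + h) * h := by rw [mul_add, hhg, zero_add, hh.eq, hh.eq]
    _ = 0 := by rw [← ha, mul_assoc, mul_assoc, hgh, mul_zero, mul_zero]

theorem exists_isIrreducibleCentralIdempotent [IsArtinianRing A] {p : A → Prop} (h1 : p 1)
    (h0 : ¬ p 0) (hadd : ∀ f g : A, IsCentralIdempotent f → IsCentralIdempotent g →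
      p (f + g) → p f ∨ p g) :
    ∃ f, IsIrreducibleCentralIdempotent f ∧ p f := by
  obtain ⟨f, ⟨hf, hpf⟩, hmin⟩ := (InvImage.wf (fun f : A => Ideal.span {f})
    (wellFounded_lt (α := Ideal A))).has_min {f | IsCentralIdempotent f ∧ p f}
    ⟨1, ⟨.one, Set.one_mem_center⟩, h1⟩
  refine ⟨f, ⟨hf, fun h => h0 (h ▸ hpf), ?_⟩, hpf⟩
  rintro g h hg hh hgh rfl
  have hhg : h * g = 0 := ((Set.mem_center_iff.1 hh.2).comm g).trans hgh
  by_contra! hne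
  rcases hadd g h hg hh hpf with hp | hp
  · exact hmin g ⟨hg, hp⟩ (span_singleton_lt_span_singleton_add hg.1 hh.1 hgh hhg hne.2)
  · refine hmin h ⟨hh, hp⟩ ?_
    rw [InvImage, add_comm]
    exact span_singleton_lt_span_singleton_add hh.1 hg.1 hhg hgh hne.1

theorem IsIdempotentList.isCentralIdempotent {m : ℕ} {e : Fin m → A} (he : IsIdempotentList e)
    (i : Fin m) : IsCentralIdempotent (e i) :=
  ((he.mem_range_iff (e i)).1 ⟨i, rfl⟩).1

end CentralIdempotents

section CardPow

variable {A : Type u} [Ring A] [Algebra ℚ A] {S : Set Nat.Primes} {O : Subalgebra (ZS S) A}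

theorem IsOrderOver.finite (hO : IsOrderOver S O) : Module.Finite ℚ A := by
  obtain ⟨s, hs⟩ := hO.fg
  refine ⟨s, top_le_iff.1 (hO.span_eq_top.ge.trans (Submodule.span_le.2 ?_))⟩
  rw [← hs]
  exact Submodule.span_le_restrictScalars (ZS S) ℚ (s : Set A)

variable (hO : IsMaximalOrder S O) {m : ℕ} {e : Fin m → A} (he : IsIdempotentList e)

theorem isIdempotentElem_idem (i : Fin m) : IsIdempotentElem (idem hO he i) :=
  Subtype.ext (he.isCentralIdempotent i).1

theorem commute_idem (i : Fin m) (b : O) : Commute (idem hO he i) b :=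
  Subtype.ext ((Set.mem_center_iff.1 (he.isCentralIdempotent i).2).comm (b : A))

theorem cardPow_pos (u : Fin m → ℚ) (G : FiniteModule O) : 0 < cardPow hO he u G :=
  Finset.prod_pos fun i _ => Real.rpow_pos_of_pos
    (by exact_mod_cast natCard_component_pos (idem hO he i) G) _

theorem cardPow_congr (u : Fin m → ℚ) {G H : FiniteModule O} (f : G ≃ₗ[O] H) :
    cardPow hO he u G = cardPow hO he u H := by
  simp_rw [cardPow, natCard_component_congr (isIdempotentElem_idem hO he _) f]

theorem ShortExactSeq.cardPow_eq (u : Fin m → ℚ) {K E G : FiniteModule O}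
    (s : ShortExactSeq O K E G) :
    cardPow hO he u E = cardPow hO he u K * cardPow hO he u G := by
  simp_rw [cardPow, ← Finset.prod_mul_distrib, s.natCard_component (isIdempotentElem_idem hO he _),
    Nat.cast_mul, Real.mul_rpow (Nat.cast_nonneg _) (Nat.cast_nonneg _)]

/-- The weight `G ↦ |G|^{-u}`. -/
noncomputable def invCardPow (u : Fin m → ℚ) (G : FiniteModule O) : ℝ≥0∞ :=
  ENNReal.ofReal (1 / cardPow hO he u G)

theorem isWeight_invCardPow (u : Fin m → ℚ) : IsWeight (invCardPow hO he u) where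
  mul s := by
    rw [invCardPow, invCardPow, invCardPow,
      ← ENNReal.ofReal_mul (one_div_nonneg.2 (cardPow_pos hO he u _).le), s.cardPow_eq hO he u,
      one_div_mul_one_div]
  ne_zero G := (ENNReal.ofReal_pos.2 (one_div_pos.2 (cardPow_pos hO he u G))).ne'
  ne_top _ := ENNReal.ofReal_ne_top

theorem exists_idem_smul_ne_zero [IsArtinianRing A] {K : FiniteModule O} {x : K} (hx : x ≠ 0) :
    ∃ i : Fin m, idem hO he i • x ≠ 0 := by
  let p (f : A) : Prop := ∃ hf : f ∈ O, (⟨f, hf⟩ : O) • x ≠ 0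
  have hadd (f g : A) (hf : IsCentralIdempotent f) (hg : IsCentralIdempotent g) :
      p (f + g) → p f ∨ p g := by
    rintro ⟨_, hne⟩
    have hfO := hO.mem_of_isCentralIdempotent hf
    have hgO := hO.mem_of_isCentralIdempotent hg
    by_contra! h
    have hf0 : (⟨f, hfO⟩ : O) • x = 0 := not_not.1 fun h0 => h.1 ⟨hfO, h0⟩
    have hg0 : (⟨g, hgO⟩ : O) • x = 0 := not_not.1 fun h0 => h.2 ⟨hgO, h0⟩
    exact hne ((add_smul (⟨f, hfO⟩ : O) ⟨g, hgO⟩ x).trans (by rw [hf0, hg0, add_zero]))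
  obtain ⟨f, hf, hfO, hfx⟩ := exists_isIrreducibleCentralIdempotent (p := p)
    ⟨O.one_mem, (one_smul O x).trans_ne hx⟩ (fun ⟨_, h⟩ => h (zero_smul O x)) hadd
  obtain ⟨i, rfl⟩ := (he.mem_range_iff f).2 hf
  exact ⟨i, hfx⟩

theorem exists_component_eq_univ [IsArtinianRing A] (K : FiniteModule O) [IsSimpleModule O K] :
    ∃ i : Fin m, component (idem hO he i) K = Set.univ := by
  have := IsSimpleModule.nontrivial O K
  obtain ⟨x, hx⟩ := exists_ne (0 : K)
  obtain ⟨i, hi⟩ := exists_idem_smul_ne_zero hO he hx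
  let φ : K →ₗ[O] K :=
    { toFun y := idem hO he i • y
      map_add' := smul_add _
      map_smul' b y := by
        rw [RingHom.id_apply, ← mul_smul, ← mul_smul, (commute_idem hO he i b).eq] }
  have hφ : φ ≠ 0 := fun h => hi (LinearMap.congr_fun h x)
  exact ⟨i, Set.range_eq_univ.2 (LinearMap.surjective_of_ne_zero hφ)⟩

theorem rpow_natCard_component_le_cardPow {u : Fin m → ℚ} (hu : ∀ i, 0 ≤ u i)
    (G : FiniteModule O) (i : Fin m) :
    (Nat.card (component (idem hO he i) G) : ℝ) ^ (u i : ℝ) ≤ cardPow hO he u G := by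
  have hone (j : Fin m) : 1 ≤ (Nat.card (component (idem hO he j) G) : ℝ) ^ (u j : ℝ) :=
    Real.one_le_rpow (by exact_mod_cast natCard_component_pos _ G) (by exact_mod_cast hu j)
  rw [cardPow, ← Finset.mul_prod_erase _ _ (Finset.mem_univ i)]
  refine le_mul_of_one_le_right (zero_le_one.trans (hone i)) ?_
  exact Finset.prod_induction _ (1 ≤ ·) (fun _ _ => one_le_mul_of_one_le_of_one_le) le_rfl
    fun j _ => hone j

theorem hasDecay_invCardPow [IsArtinianRing A] {u : Fin m → ℚ} (hu : ∀ i, 0 < u i) :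
    HasDecay (invCardPow hO he u) := by
  obtain ⟨ε, hε, hεu⟩ : ∃ ε : ℚ, 0 < ε ∧ ∀ i, ε ≤ u i := by
    rcases isEmpty_or_nonempty (Fin m) with h | h
    · exact ⟨1, one_pos, h.elim⟩
    · obtain ⟨i, hi⟩ := Finite.exists_min u
      exact ⟨u i, hu i, hi⟩
  refine ⟨ε, by exact_mod_cast hε, fun K hK => ENNReal.ofReal_le_ofReal ?_⟩
  obtain ⟨i, hi⟩ := exists_component_eq_univ hO he K
  have hK1 : (1 : ℝ) ≤ Nat.card K := by exact_mod_cast Nat.card_pos (α := K)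
  rw [Real.rpow_neg (by positivity), one_div]
  refine inv_anti₀ (Real.rpow_pos_of_pos (by linarith) _) ?_
  calc (Nat.card K : ℝ) ^ (ε : ℝ) ≤ (Nat.card K : ℝ) ^ (u i : ℝ) :=
        Real.rpow_le_rpow_of_exponent_le hK1 (by exact_mod_cast hεu i)
    _ = (Nat.card (component (idem hO he i) K) : ℝ) ^ (u i : ℝ) := by rw [hi, Nat.card_univ]
    _ ≤ cardPow hO he u K := rpow_natCard_component_le_cardPow hO he (fun j => (hu j).le) K i

end CardPow

section RandomModules

variable {R : Type u} [Ring R] {Ω : Type*}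

theorem setOf_iso_out (X : Ω → FiniteModule R) (E : IsoClass R) :
    {ω | Iso (X ω) E.out} = (fun ω => (X ω).toClass) ⁻¹' {E} := by
  ext ω
  rw [Set.mem_preimage, Set.mem_singleton_iff, Set.mem_ofPred_eq, ← FiniteModule.toClass_eq_iff,
    E.toClass_out]

theorem probIso_eq_toReal [MeasurableSpace Ω] (P : Measure Ω) (X : Ω → FiniteModule R)
    (G : FiniteModule R) : probIso P X G = (P {ω | Iso (X ω) G.toClass.out}).toReal := by
  simp_rw [probIso, Measure.real, ← FiniteModule.toClass_eq_iff, IsoClass.toClass_out]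

variable [Countable (IsoClass R)]

theorem exists_measure_iso_eq {y : IsoClass R → ℝ≥0∞} (hy : ∑' E, y E = 1) :
    ∃ (Ω : Type) (_ : MeasurableSpace Ω) (P : Measure Ω) (X : Ω → FiniteModule R),
      IsProbabilityMeasure P ∧ IsRandomModule X ∧ ∀ E, P {ω | Iso (X ω) E.out} = y E := by
  let s : IsoClass R ≃ Shrink.{0} (IsoClass R) := equivShrink _
  let p : PMF (Shrink.{0} (IsoClass R)) :=
    ⟨fun ω => y (s.symm ω), (s.symm.tsum_eq y).trans hy ▸ ENNReal.summable.hasSum⟩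
  let _ : MeasurableSpace (Shrink.{0} (IsoClass R)) := ⊤
  refine ⟨_, ⊤, p.toMeasure, fun ω => (s.symm ω).out, inferInstance, fun _ => trivial, fun E => ?_⟩
  have hset : {ω | Iso (s.symm ω).out E.out} = {s E} := by
    ext ω
    rw [setOf_iso_out, Set.mem_preimage, IsoClass.toClass_out]
    exact s.symm_apply_eq
  rw [hset, PMF.toMeasure_apply_singleton _ _ (measurableSet_singleton _)]
  exact congrArg y (s.symm_apply_apply E)

namespace IsRandomModule

variable [MeasurableSpace Ω] {X : Ω → FiniteModule R}

theorem lintegral_toClass (hX : IsRandomModule X) (P : Measure Ω) (f : IsoClass R → ℝ≥0∞) :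
    ∫⁻ ω, f (X ω).toClass ∂P = ∑' E : IsoClass R, P {ω | Iso (X ω) E.out} * f E := by
  let _ : MeasurableSpace (IsoClass R) := ⊤
  have hmeas : Measurable fun ω => (X ω).toClass := measurable_to_countable' fun E =>
    setOf_iso_out X E ▸ hX E.out
  rw [← lintegral_map (f := f) measurable_from_top hmeas, lintegral_countable']
  simp_rw [Measure.map_apply hmeas (measurableSet_singleton _), ← setOf_iso_out, mul_comm]

theorem surMoment_eq (hX : IsRandomModule X) (P : Measure Ω) (G : FiniteModule R) :
    surMoment P X G = ∑' E : IsoClass R, P {ω | Iso (X ω) E.out} * surCount E.out G := by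
  rw [← hX.lintegral_toClass P fun E => (surCount E.out G : ℝ≥0∞), surMoment]
  refine lintegral_congr fun ω => ?_
  obtain ⟨s⟩ := (X ω).iso_out
  rw [surCount_congr s (LinearEquiv.refl R G)]

theorem tsum_measure_iso (hX : IsRandomModule X) (P : Measure Ω) [IsProbabilityMeasure P] :
    ∑' E : IsoClass R, P {ω | Iso (X ω) E.out} = 1 := by
  simpa using (hX.lintegral_toClass P fun _ => 1).symm

end IsRandomModule

end RandomModules

section CohenMartinetModules

variable {A : Type u} [Ring A] [Algebra ℚ A] {S : Set Nat.Primes} {O : Subalgebra (ZS S) A}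
  {hO : IsMaximalOrder S O} {m : ℕ} {e : Fin m → A} {he : IsIdempotentList e} {u : Fin m → ℚ}
  {Ω : Type*} [MeasurableSpace Ω] {P : Measure Ω} {X : Ω → FiniteModule O}

theorem cardPow_mul_autCount_pos (G : FiniteModule O) :
    0 < cardPow hO he u G * autCount G :=
  mul_pos (cardPow_pos hO he u G) (by exact_mod_cast autCount_pos G)

theorem mass_invCardPow (G : FiniteModule O) : mass (invCardPow hO he u) G.toClass =
    ENNReal.ofReal (cardPow hO he u G * autCount G)⁻¹ := by
  obtain ⟨f⟩ := G.iso_out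
  have haut : (0 : ℝ) < autCount G := by exact_mod_cast autCount_pos G
  rw [mass, invCardPow, cardPow_congr hO he u f, autCount_congr f, ← ENNReal.ofReal_natCast,
    ← ENNReal.ofReal_div_of_pos haut, div_div, one_div]

theorem isCohenMartinetModule_of_measure_eq [IsProbabilityMeasure P] (hX : IsRandomModule X)
    {a : ℝ≥0∞} (ha : a ≠ 0) (ha' : a ≠ ⊤)
    (h : ∀ E : IsoClass O, P {ω | Iso (X ω) E.out} = a * mass (invCardPow hO he u) E) :
    IsCohenMartinetModule hO he u P X := by
  refine ⟨inferInstance, hX, fun G₁ G₂ => ?_⟩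
  have hprob (G : FiniteModule O) :
      probIso P X G = a.toReal * (cardPow hO he u G * autCount G)⁻¹ := by
    rw [probIso_eq_toReal, h, ENNReal.toReal_mul, mass_invCardPow,
      ENNReal.toReal_ofReal (inv_nonneg.2 (cardPow_mul_autCount_pos G).le)]
  rw [hprob, hprob, mul_div_mul_left _ _ (ENNReal.toReal_pos ha ha').ne', inv_div_inv]

theorem IsCohenMartinetModule.exists_measure_eq (h : IsCohenMartinetModule hO he u P X) :
    ∃ a : ℝ≥0∞, ∀ E : IsoClass O,
      P {ω | Iso (X ω) E.out} = a * mass (invCardPow hO he u) E := by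
  have := h.1
  let G₀ := (zeroClass O).out
  refine ⟨ENNReal.ofReal (probIso P X G₀ * (cardPow hO he u G₀ * autCount G₀)), fun E => ?_⟩
  have hE : 0 < cardPow hO he u E.out * autCount E.out := cardPow_mul_autCount_pos _
  have hG₀ : 0 < cardPow hO he u G₀ * autCount G₀ := cardPow_mul_autCount_pos _
  have hratio := h.2.2 E.out G₀
  have hne : probIso P X G₀ ≠ 0 := fun h0 => by
    rw [h0, div_zero] at hratio
    exact (div_pos hG₀ hE).ne hratio
  have hnonneg : 0 ≤ probIso P X G₀ * (cardPow hO he u G₀ * autCount G₀) :=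
    mul_nonneg measureReal_nonneg hG₀.le
  rw [← E.toClass_out, mass_invCardPow, ← ENNReal.ofReal_mul hnonneg, E.toClass_out,
    ← div_eq_mul_inv, mul_div_assoc, ← hratio, mul_div_cancel₀ _ hne, probIso, ofReal_measureReal]

theorem IsCohenMartinetModule.surMoment_eq [Countable (IsoClass O)]
    (h : IsCohenMartinetModule hO he u P X) (G : FiniteModule O) :
    surMoment P X G = invCardPow hO he u G := by
  have := h.1
  obtain ⟨a, ha⟩ := h.exists_measure_eq
  have hone := h.2.1.tsum_measure_iso P
  simp_rw [ha, ENNReal.tsum_mul_left] at hone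
  simp_rw [h.2.1.surMoment_eq, ha, mul_assoc]
  rw [ENNReal.tsum_mul_left, (isWeight_invCardPow hO he u).tsum_mass_mul_surCount
    hO.isIntegrallyClosedOrder.isDedekindLike, mul_left_comm, hone, mul_one]

theorem exists_isCohenMartinetModule [Countable (IsoClass O)]
    (hsum : ∑' E, mass (invCardPow hO he u) E ≠ ⊤) :
    ∃ (Ω : Type) (_ : MeasurableSpace Ω) (P : Measure Ω) (X : Ω → FiniteModule O),
      IsCohenMartinetModule hO he u P X := by
  have hsum0 : ∑' E, mass (invCardPow hO he u) E ≠ 0 := fun h =>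
    (isWeight_invCardPow hO he u).mass_ne_zero _ (ENNReal.tsum_eq_zero.1 h (zeroClass O))
  obtain ⟨Ω, _, P, X, _, hX, hP⟩ := exists_measure_iso_eq
    (ENNReal.tsum_mul_left.trans (ENNReal.inv_mul_cancel hsum0 hsum))
  exact ⟨Ω, _, P, X, isCohenMartinetModule_of_measure_eq hX (ENNReal.inv_ne_zero.2 hsum)
    (ENNReal.inv_ne_top.2 hsum0) hP⟩

end CohenMartinetModules

end CohenMartinet

theorem theoremT_general {A : Type*} [Ring A] [Algebra ℚ A] (S : Set Nat.Primes)
    (O : Subalgebra (CohenMartinet.ZS S) A) (hO : CohenMartinet.IsMaximalOrder S O)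
    {m : ℕ} (e : Fin m → A) (he : CohenMartinet.IsIdempotentList e)
    (u : Fin m → ℚ) (hu : ∀ i, 0 < u i) :
    (∃ (Ω : Type) (_ : MeasurableSpace Ω) (P : Measure Ω)
        (X : Ω → CohenMartinet.FiniteModule O),
        CohenMartinet.IsCohenMartinetModule hO he u P X) ∧
      ∀ (Ω : Type*) [MeasurableSpace Ω] (P : Measure Ω) (X : Ω → CohenMartinet.FiniteModule O),
        CohenMartinet.IsCohenMartinetModule hO he u P X →
        (∀ G : CohenMartinet.FiniteModule O,
          CohenMartinet.surMoment P X G =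
            ENNReal.ofReal (1 / CohenMartinet.cardPow hO he u G)) ∧
        ∀ (Ω' : Type*) [MeasurableSpace Ω'] (P' : Measure Ω') [IsProbabilityMeasure P']
          (Y : Ω' → CohenMartinet.FiniteModule O), CohenMartinet.IsRandomModule Y →
          (∀ G : CohenMartinet.FiniteModule O,
            CohenMartinet.surMoment P' Y G =
              ENNReal.ofReal (1 / CohenMartinet.cardPow hO he u G)) →
          ∀ G : CohenMartinet.FiniteModule O,
            CohenMartinet.probIso P' Y G = CohenMartinet.probIso P X G := by
  have : Module.Finite ℚ A := hO.prop.finite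
  have : IsArtinianRing A := .of_finite ℚ A
  have hR := hO.isIntegrallyClosedOrder.isDedekindLike
  have hc := CohenMartinet.isWeight_invCardPow hO he u
  have hd := CohenMartinet.hasDecay_invCardPow hO he hu
  have := CohenMartinet.countable_isoClass hR hc hd
  refine ⟨CohenMartinet.exists_isCohenMartinetModule
    (CohenMartinet.tsum_mass_ne_top hR hc hd), fun Ω _ P X hX => ⟨hX.surMoment_eq, ?_⟩⟩
  intro Ω' _ P' _ Y hY hmoments G
  have hXmoments : CohenMartinet.HasMoments (CohenMartinet.invCardPow hO he u)
      fun E => P {ω | CohenMartinet.Iso (X ω) E.out} := fun H =>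
    (hX.2.1.surMoment_eq P H).symm.trans (hX.surMoment_eq H)
  have hYmoments : CohenMartinet.HasMoments (CohenMartinet.invCardPow hO he u)
      fun E => P' {ω | CohenMartinet.Iso (Y ω) E.out} := fun H =>
    (hY.surMoment_eq P' H).symm.trans (hmoments H)
  rw [CohenMartinet.probIso_eq_toReal, CohenMartinet.probIso_eq_toReal]
  exact congrArg ENNReal.toReal (congrFun (hYmoments.unique hXmoments hR hc hd) G.toClass)

theorem theoremT {A : Type*} [Ring A] [Algebra ℚ A] [Module.Finite ℚ A]
    [IsSemisimpleRing A] (S : Set Nat.Primes) (hS : S.Infinite)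
    (O : Subalgebra (CohenMartinet.ZS S) A) (hO : CohenMartinet.IsMaximalOrder S O)
    {m : ℕ} (e : Fin m → A) (he : CohenMartinet.IsIdempotentList e)
    (u : Fin m → ℚ) (hu : ∀ i, 0 < u i) :
    (∃ (Ω : Type) (_ : MeasurableSpace Ω) (P : Measure Ω)
        (X : Ω → CohenMartinet.FiniteModule O),
        CohenMartinet.IsCohenMartinetModule hO he u P X) ∧
      ∀ (Ω : Type*) [MeasurableSpace Ω] (P : Measure Ω) (X : Ω → CohenMartinet.FiniteModule O),
        CohenMartinet.IsCohenMartinetModule hO he u P X →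
        (∀ G : CohenMartinet.FiniteModule O,
          CohenMartinet.surMoment P X G =
            ENNReal.ofReal (1 / CohenMartinet.cardPow hO he u G)) ∧
        ∀ (Ω' : Type*) [MeasurableSpace Ω'] (P' : Measure Ω') [IsProbabilityMeasure P']
          (Y : Ω' → CohenMartinet.FiniteModule O), CohenMartinet.IsRandomModule Y →
          (∀ G : CohenMartinet.FiniteModule O,
            CohenMartinet.surMoment P' Y G =
              ENNReal.ofReal (1 / CohenMartinet.cardPow hO he u G)) →
          ∀ G : CohenMartinet.FiniteModule O,
            CohenMartinet.probIso P' Y G = CohenMartinet.probIso P X G :=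
  theoremT_general S O hO e he u hu
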